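/- Let $G$ be a compact connected Lie group with simple Lie algebra $\mathfrak g$ and Killing form $B$ (so $-B$ is positive definite), and let $M=G/K$ be a generalized flag manifold, i.e. $K=\{a\in G:\operatorname{Ad}(a)\gamma=\gamma\}$ is the stabilizer of an element $\gamma\in\mathfrak g$ under the adjoint representation and $G/K$ carries its quotient manifold structure (the projection $G\to G/K$ is a smooth submersion). Let $\mathfrak k$ be the Lie algebra of $K$ and let $\mathfrak m$ be the orthogonal complement of $\mathfrak k$ with respect to $-B$, identified with $T_o(G/K)$, $o=eK$. Suppose that $M$ has two isotropy summands: $\mathfrak m$ is the direct sum of two irreducible, inequivalent real $\operatorname{Ad}(K)$-submodules. Then the two summands can be labelled $\mathfrak m_1,\mathfrak m_2$ so that there is an element $Z$ of the centre of $\mathfrak k$ with $\operatorname{ad}(Z)^2=-n^2$ on $\mathfrak m_n$ for $n=1,2$, and with this labelling the following hold. 1. $[\mathfrak m_1,\mathfrak m_2]\subset\mathfrak m_1$, $[\mathfrak m_1,\mathfrak m_1]\subset\mathfrak k\oplus\mathfrak m_2$ and $[\mathfrak m_2,\mathfrak m_2]\subset\mathfrak k$. 2. For $(-B)$-orthonormal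 bases of $\mathfrak m_1$ and $\mathfrak m_2$ put $[ijk]=\sum_{\alpha,\beta,\gamma}\bigl(-B([X_\alpha,X_\beta],X_\gamma)\bigr)^2$, where $X_\alpha,X_\beta,X_\gamma$ run over the bases of $\mathfrak m_i,\mathfrak m_j,\mathfrak m_k$. Then $[111]=[222]=0$, $[221]=[212]=[122]=0$, and $[112]=[121]=[211]\neq 0$. 3. Let $d_i=\dim\mathfrak m_i$ and $t=[112]$. For all $x_1,x_2>0$, if $g$ is the $G$-invariant Riemannian metric on $M$ that is given on $T_oM=\mathfrak m$ by $x_1(-B)|_{\mathfrak m_1}+x_2(-B)|_{\mathfrak m_2}$, then the scalar curvature of $g$ is, at every point of $M$, $$S(g)=\frac12\Bigl(\frac{d_1}{x_1}+\frac{d_2}{x_2}\Bigr)-\frac14\Bigl(t\,\frac{x_2}{x_1^2}+2t\,\frac1{x_2}\Bigr).$$ -/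

import Mathlib

open scoped Manifold ContDiff

noncomputable section

namespace FlagManifold

/-! ### Curvature of a metric on an open subset of Euclidean space

`h y` is the value at `y` of a field of bilinear forms, in coordinates. -/

section Coordinates

variable {d : ℕ}

/-- The Christoffel symbols `Γ_y(u, v)` of the Levi-Civita connection, determined by
`2 h_y(Γ_y(u, v), w) = ∂_u h(v, w) + ∂_v h(u, w) - ∂_w h(u, v)`. -/
def christoffel
    (h : EuclideanSpace ℝ (Fin d) →
      EuclideanSpace ℝ (Fin d) →L[ℝ] EuclideanSpace ℝ (Fin d) →L[ℝ] ℝ)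
    (y u v : EuclideanSpace ℝ (Fin d)) : EuclideanSpace ℝ (Fin d) :=
  (1 / 2 : ℝ) • (h y).inverse
    (fderiv ℝ h y u v + fderiv ℝ h y v u - ((fderiv ℝ h y).flip u).flip v)

/-- The curvature `R(u, v) w = ∇_u ∇_v w - ∇_v ∇_u w` for constant coordinate fields `u, v, w`. -/
def curvature
    (h : EuclideanSpace ℝ (Fin d) →
      EuclideanSpace ℝ (Fin d) →L[ℝ] EuclideanSpace ℝ (Fin d) →L[ℝ] ℝ)
    (y u v w : EuclideanSpace ℝ (Fin d)) : EuclideanSpace ℝ (Fin d) :=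
  fderiv ℝ (fun z => christoffel h z v w) y u - fderiv ℝ (fun z => christoffel h z u w) y v
    + christoffel h y u (christoffel h y v w) - christoffel h y v (christoffel h y u w)

/-- The Ricci curvature `Ric(v, w)`, the trace of `u ↦ R(u, v) w`. -/
def ricci
    (h : EuclideanSpace ℝ (Fin d) →
      EuclideanSpace ℝ (Fin d) →L[ℝ] EuclideanSpace ℝ (Fin d) →L[ℝ] ℝ)
    (y v w : EuclideanSpace ℝ (Fin d)) : ℝ :=
  ∑ i, curvature h y (EuclideanSpace.single i 1) v w i

/-- The Gram matrix `h_{ij}` of the metric at `y`. -/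
def gramMatrix
    (h : EuclideanSpace ℝ (Fin d) →
      EuclideanSpace ℝ (Fin d) →L[ℝ] EuclideanSpace ℝ (Fin d) →L[ℝ] ℝ)
    (y : EuclideanSpace ℝ (Fin d)) : Matrix (Fin d) (Fin d) ℝ :=
  Matrix.of fun i j => h y (EuclideanSpace.single i 1) (EuclideanSpace.single j 1)

/-- The scalar curvature `∑ h^{ij} Ric_{ij}` at `y`. -/
def scalar
    (h : EuclideanSpace ℝ (Fin d) →
      EuclideanSpace ℝ (Fin d) →L[ℝ] EuclideanSpace ℝ (Fin d) →L[ℝ] ℝ)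
    (y : EuclideanSpace ℝ (Fin d)) : ℝ :=
  ∑ i, ∑ j, (gramMatrix h y)⁻¹ i j *
    ricci h y (EuclideanSpace.single i 1) (EuclideanSpace.single j 1)

end Coordinates

/-! ### Scalar curvature of a Riemannian manifold -/

section Riemannian

variable {d : ℕ} {M : Type*} [TopologicalSpace M] [ChartedSpace (EuclideanSpace ℝ (Fin d)) M]
  [IsManifold (𝓡 d) ∞ M]

/-- Smooth Riemannian metrics on `M`. -/
abbrev RiemMetric (d : ℕ) (M : Type*) [TopologicalSpace M]
    [ChartedSpace (EuclideanSpace ℝ (Fin d)) M] [IsManifold (𝓡 d) ∞ M] :=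
  Bundle.ContMDiffRiemannianMetric (𝓡 d) ∞ (EuclideanSpace ℝ (Fin d))
    (fun p : M => TangentSpace (𝓡 d) p)

/-- The expression of `g` in the chart around `p`: the pullback of `g` by the inverse chart. -/
def chartMetric (g : RiemMetric d M) (p : M) (y : EuclideanSpace ℝ (Fin d)) :
    EuclideanSpace ℝ (Fin d) →L[ℝ] EuclideanSpace ℝ (Fin d) →L[ℝ] ℝ :=
  let q : M := (extChartAt (𝓡 d) p).symm y
  let D : EuclideanSpace ℝ (Fin d) →L[ℝ] EuclideanSpace ℝ (Fin d) :=
    mfderiv (𝓡 d) (𝓡 d) (extChartAt (𝓡 d) p).symm y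
  let gq : EuclideanSpace ℝ (Fin d) →L[ℝ] EuclideanSpace ℝ (Fin d) →L[ℝ] ℝ := g.inner q
  gq.bilinearComp D D

/-- The scalar curvature of `g` at `p`, computed in the chart around `p`. -/
def scalarCurvature (g : RiemMetric d M) (p : M) : ℝ :=
  scalar (chartMetric g p) (extChartAt (𝓡 d) p p)

end Riemannian

/-! ### Lie groups and homogeneous spaces -/

/-- A smooth real Lie group has the regularity needed for its Lie algebra. -/
instance leInfty_minSmoothness_three : ENat.LEInfty (minSmoothness ℝ 3) where
  out := by
    rw [minSmoothness_of_isRCLikeNormedField]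
    exact ENat.LEInfty.out

section Group

variable {n : ℕ} {G : Type*} [TopologicalSpace G] [ChartedSpace (EuclideanSpace ℝ (Fin n)) G]
  [Group G]

/-- The adjoint representation: `Ad a` is the differential at `1` of `x ↦ a x a⁻¹`. -/
def Ad (a : G) : GroupLieAlgebra (𝓡 n) G →L[ℝ] GroupLieAlgebra (𝓡 n) G :=
  let D : EuclideanSpace ℝ (Fin n) →L[ℝ] EuclideanSpace ℝ (Fin n) :=
    mfderiv (𝓡 n) (𝓡 n) (fun x : G => a * x * a⁻¹) 1
  D

/-- `V` is an `Ad(K)`-invariant subspace. -/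
def IsAdInvariant (K : Subgroup G) (V : Submodule ℝ (GroupLieAlgebra (𝓡 n) G)) : Prop :=
  ∀ a ∈ K, ∀ X ∈ V, Ad a X ∈ V

/-- `V` is an irreducible (real) `Ad(K)`-module. -/
structure IsAdIrreducible (K : Subgroup G) (V : Submodule ℝ (GroupLieAlgebra (𝓡 n) G)) :
    Prop where
  ne_bot : V ≠ ⊥
  invariant : IsAdInvariant K V
  eq_bot_or_eq : ∀ W ≤ V, IsAdInvariant K W → W = ⊥ ∨ W = V

/-- `V` and `W` are equivalent `Ad(K)`-modules: there is a linear isomorphism intertwining the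
actions of `K`. -/
def AdEquivalent (K : Subgroup G) (V W : Submodule ℝ (GroupLieAlgebra (𝓡 n) G)) : Prop :=
  ∃ f : V ≃ₗ[ℝ] W, ∀ a ∈ K, ∀ X Y : V,
    (Y : GroupLieAlgebra (𝓡 n) G) = Ad a (X : GroupLieAlgebra (𝓡 n) G) →
      (f Y : GroupLieAlgebra (𝓡 n) G) = Ad a (f X : GroupLieAlgebra (𝓡 n) G)

/-- The differential at the identity of the projection `G → G/K`. -/
def projDeriv (n d : ℕ) {G : Type*} [TopologicalSpace G]
    [ChartedSpace (EuclideanSpace ℝ (Fin n)) G] [Group G]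
    (K : Subgroup G) [ChartedSpace (EuclideanSpace ℝ (Fin d)) (G ⧸ K)] :
    GroupLieAlgebra (𝓡 n) G →L[ℝ] TangentSpace (𝓡 d) (QuotientGroup.mk 1 : G ⧸ K) :=
  mfderiv (𝓡 n) (𝓡 d) (QuotientGroup.mk : G → G ⧸ K) 1

/-- The Lie algebra of `K`, as a subspace of the Lie algebra of `G`: the tangent space at the
identity of the fibre `K` of the projection `G → G/K`. -/
def lieK (n d : ℕ) {G : Type*} [TopologicalSpace G]
    [ChartedSpace (EuclideanSpace ℝ (Fin n)) G] [Group G]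
    (K : Subgroup G) [ChartedSpace (EuclideanSpace ℝ (Fin d)) (G ⧸ K)] :
    Submodule ℝ (GroupLieAlgebra (𝓡 n) G) :=
  LinearMap.ker (projDeriv n d K).toLinearMap

/-- A Riemannian metric on `G/K` is `G`-invariant if `G` acts by isometries. -/
def IsInvariantMetric {d : ℕ} (K : Subgroup G)
    [ChartedSpace (EuclideanSpace ℝ (Fin d)) (G ⧸ K)] [IsManifold (𝓡 d) ∞ (G ⧸ K)]
    (g : RiemMetric d (G ⧸ K)) : Prop :=
  ∀ (a : G) (p : G ⧸ K) (u v : TangentSpace (𝓡 d) p),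
    g.inner (a • p) (mfderiv (𝓡 d) (𝓡 d) (fun q : G ⧸ K => a • q) p u)
      (mfderiv (𝓡 d) (𝓡 d) (fun q : G ⧸ K => a • q) p v) = g.inner p u v

variable [LieGroup (𝓡 n) ∞ G]

/-- The Killing form `B` of the Lie algebra of `G`. -/
abbrev B (X Y : GroupLieAlgebra (𝓡 n) G) : ℝ := killingForm ℝ (GroupLieAlgebra (𝓡 n) G) X Y

/-- The orthogonal complement `𝔪` of `𝔨` with respect to the Killing form. -/
def complM (n d : ℕ) {G : Type*} [TopologicalSpace G]
    [ChartedSpace (EuclideanSpace ℝ (Fin n)) G] [Group G] [LieGroup (𝓡 n) ∞ G]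
    (K : Subgroup G) [ChartedSpace (EuclideanSpace ℝ (Fin d)) (G ⧸ K)] :
    Submodule ℝ (GroupLieAlgebra (𝓡 n) G) :=
  LinearMap.BilinForm.orthogonal (killingForm ℝ (GroupLieAlgebra (𝓡 n) G)) (lieK n d K)

/-- The isotropy representation of `G/K`, identified with `Ad(K)` on `𝔪`, is the direct sum of the
two irreducible inequivalent submodules `m 0` and `m 1`. -/
structure IsIsotropyDecomposition (d : ℕ) (K : Subgroup G)
    [ChartedSpace (EuclideanSpace ℝ (Fin d)) (G ⧸ K)]
    (m : Fin 2 → Submodule ℝ (GroupLieAlgebra (𝓡 n) G)) : Prop where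
  sup_eq : m 0 ⊔ m 1 = complM n d K
  disjoint : Disjoint (m 0) (m 1)
  irreducible : ∀ i, IsAdIrreducible K (m i)
  inequivalent : ¬ AdEquivalent K (m 0) (m 1)

/-- `[U, V] ⊂ W`. -/
def BracketLE (U V W : Submodule ℝ (GroupLieAlgebra (𝓡 n) G)) : Prop :=
  ∀ X ∈ U, ∀ Y ∈ V, ⁅X, Y⁆ ∈ W

/-- The basis `b i` of each `m i` is orthonormal for `-B`. -/
def IsOrthonormalFamily {m : Fin 2 → Submodule ℝ (GroupLieAlgebra (𝓡 n) G)}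
    (b : ∀ i, Module.Basis (Fin (Module.finrank ℝ (m i))) ℝ (m i)) : Prop :=
  ∀ i α β, -B (b i α : GroupLieAlgebra (𝓡 n) G) (b i β) = if α = β then 1 else 0

/-- The number `[ijk] = ∑ (-B([X_α, X_β], X_γ))²`, where `X_α`, `X_β`, `X_γ` run over the given
bases of `m i`, `m j`, `m k`. -/
def triple {m : Fin 2 → Submodule ℝ (GroupLieAlgebra (𝓡 n) G)}
    (b : ∀ i, Module.Basis (Fin (Module.finrank ℝ (m i))) ℝ (m i)) (i j k : Fin 2) : ℝ :=
  ∑ α, ∑ β, ∑ γ,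
    (-B ⁅(b i α : GroupLieAlgebra (𝓡 n) G), (b j β : GroupLieAlgebra (𝓡 n) G)⁆ (b k γ)) ^ 2

/-- `g` restricts on `T_o(G/K) = 𝔪 = U ⊕ V` to the inner product `x (-B)|_U + y (-B)|_V`. -/
def IsDiagonalMetric {d : ℕ} (K : Subgroup G)
    [ChartedSpace (EuclideanSpace ℝ (Fin d)) (G ⧸ K)] [IsManifold (𝓡 d) ∞ (G ⧸ K)]
    (g : RiemMetric d (G ⧸ K)) (U V : Submodule ℝ (GroupLieAlgebra (𝓡 n) G)) (x y : ℝ) : Prop :=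
  ∀ X₁ ∈ U, ∀ Y₁ ∈ U, ∀ X₂ ∈ V, ∀ Y₂ ∈ V,
    g.inner (QuotientGroup.mk 1) (projDeriv n d K (X₁ + X₂)) (projDeriv n d K (Y₁ + Y₂)) =
      x * -B X₁ Y₁ + y * -B X₂ Y₂

end Group

end FlagManifold

end

open FlagManifold

noncomputable section

open scoped Manifold ContDiff Topology
open FlagManifold Filter

set_option maxSynthPendingDepth 3
set_option linter.unusedSectionVars false
namespace FlagManifold

/-! ### Levi-Civita connection and curvature in coordinates, on arbitrary vector fields. -/

section Coordinates

variable {E : Type*} [NormedAddCommGroup E] [NormedSpace ℝ E] [CompleteSpace E]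


/-! The algebraic half rests on the operator ad(γ)². The form β = -B is positive definite, because
on a compact group ad(X) is skew for an averaged inner product, and it is invariant. Hence ad(γ) is
β-skew with kernel 𝔨, the centralizer of γ, and ad(γ)² is self-adjoint and commutes with Ad(K). By
Schur's lemma for inequivalent summands (`pairing_eq_zero`) it preserves each summand, and by
irreducibility it is a negative scalar -l² there (`exists_eigenvalue`). As over ℂ, where eigenvalues
of ad(γ) add under brackets, the bracket of vectors with parameters p and q splits into parts with
parameters p + q and p - q (`exists_lie_eq`). Only 0 and the two numbers l can occur.

Simplicity then fixes the ratio. A summand that commutes with the other one and has its own brackets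
in 𝔨 generates a proper nonzero ideal (`false_of_lie_eq_zero`). This excludes equal parameters, and
also every pair in which the larger is not twice the smaller. So the parameters are l and 2l, Z is γ
/ l, and the bracket relations are read off from the admissible sums and differences
(`exists_grading`). The vanishing of the other triples follows by orthogonality and by the symmetry
of [ijk] in its indices; [112] ≠ 0 is the ideal argument again.

The scalar curvature is computed from Killing fields. The fundamental fields of the isometric
G-action span each tangent space and their brackets are those of the Lie algebra up to sign, so the
Koszul formula turns every ⟨∇_X Y, Z⟩ into structure constants (`fieldNabla_eq`). Sectional
curvatures follow by differentiating such identities (`IsKillingFamily.curvature_eq`), and the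
normalization -tr ad(X)² = 1 for unit X collapses their sum to the stated expression
(`sum_sectional`, `IsReductiveBasis.scalar_eq`).

The remaining work connects this with manifolds: in charts the bracket is the antisymmetrized mixed
second derivative of the multiplication (`lie_eq_mixedDeriv`), Ad has derivative the bracket, the
action on G/K is smooth, and the kernel of the differential of the projection is the centralizer of
γ (`mem_lieK_iff`). -/

/-- The Koszul expression `u, v, w ↦ A u v w + A v u w - A w u v` of a derivative of a metric. -/
def koszulForm : (E →L[ℝ] E →L[ℝ] E →L[ℝ] ℝ) →L[ℝ] (E →L[ℝ] E →L[ℝ] E →L[ℝ] ℝ) :=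
  ContinuousLinearMap.id ℝ _ +
    (ContinuousLinearMap.flipₗᵢ ℝ E E (E →L[ℝ] ℝ)).toContinuousLinearEquiv.toContinuousLinearMap -
    ((ContinuousLinearMap.compL ℝ E (E →L[ℝ] E →L[ℝ] ℝ) (E →L[ℝ] E →L[ℝ] ℝ)
      (ContinuousLinearMap.flipₗᵢ ℝ E E ℝ).toContinuousLinearEquiv.toContinuousLinearMap).comp
    (ContinuousLinearMap.flipₗᵢ ℝ E E
      (E →L[ℝ] ℝ)).toContinuousLinearEquiv.toContinuousLinearMap)

lemma koszulForm_apply (A : E →L[ℝ] E →L[ℝ] E →L[ℝ] ℝ) (u v : E) :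
    koszulForm A u v = A u v + A v u - (A.flip u).flip v := by
  ext w
  simp [koszulForm]

/-- The Christoffel symbols as a continuous bilinear map. -/
def christoffelMap (h : E → E →L[ℝ] E →L[ℝ] ℝ) (y : E) : E →L[ℝ] E →L[ℝ] E :=
  (1 / 2 : ℝ) • (ContinuousLinearMap.compL ℝ E (E →L[ℝ] ℝ) E (h y).inverse).comp
    (koszulForm (fderiv ℝ h y))

lemma christoffelMap_eq (h : E → E →L[ℝ] E →L[ℝ] ℝ) (y u v : E) :
    christoffelMap h y u v = (1 / 2 : ℝ) • (h y).inverse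
    (fderiv ℝ h y u v + fderiv ℝ h y v u - ((fderiv ℝ h y).flip u).flip v) := by
  simp [christoffelMap, koszulForm_apply]

lemma christoffelMap_apply {d : ℕ} (h : EuclideanSpace ℝ (Fin d) →
      EuclideanSpace ℝ (Fin d) →L[ℝ] EuclideanSpace ℝ (Fin d) →L[ℝ] ℝ)
    (y u v : EuclideanSpace ℝ (Fin d)) :
    christoffelMap h y u v = christoffel h y u v := by
  rw [christoffelMap_eq, christoffel]

variable {h : E → E →L[ℝ] E →L[ℝ] ℝ} {y₀ : E}

lemma differentiableAt_christoffelMap (hh : ContDiffAt ℝ 2 h y₀) (hi : (h y₀).IsInvertible) :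
    DifferentiableAt ℝ (christoffelMap h) y₀ := by
  obtain ⟨e, he⟩ := hi
  have h1 : ContDiffAt ℝ 1 (fun y => (h y).inverse) y₀ := by
    have := contDiffAt_map_inverse (𝕜 := ℝ) (n := 1) e
    rw [he] at this
    exact this.comp y₀ (hh.of_le (by norm_num))
  have h2 : ContDiffAt ℝ 1 (fderiv ℝ h) y₀ := hh.fderiv_right (by norm_num)
  have h3 : ContDiffAt ℝ 1 (christoffelMap h) y₀ := by
    unfold christoffelMap
    refine ContDiffAt.const_smul _ (ContDiffAt.clm_comp ?_ ?_)
    · exact (ContinuousLinearMap.contDiff _).contDiffAt.comp y₀ h1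
    · exact (ContinuousLinearMap.contDiff _).contDiffAt.comp y₀ h2
  exact h3.differentiableAt (by norm_num)

/-- `ContinuousLinearMap.inverse` is zero on maps that are not invertible; nondegeneracy makes it a
true inverse, which gives back the defining Koszul identity. -/
lemma metric_christoffelMap (hi : (h y₀).IsInvertible) (u v w : E) :
    h y₀ (christoffelMap h y₀ u v) w =
      1 / 2 * (fderiv ℝ h y₀ u v w + fderiv ℝ h y₀ v u w - fderiv ℝ h y₀ w u v) := by
  obtain ⟨e, he⟩ := hi
  have : ∀ l, h y₀ ((h y₀).inverse l) = l := by
    intro l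
    rw [← he, ContinuousLinearMap.inverse_equiv]
    exact e.apply_symm_apply l
  rw [christoffelMap_eq]
  simp only [map_smul, this]
  simp

lemma fderiv_metric_symm (hh : DifferentiableAt ℝ h y₀)
    (hs : ∀ᶠ y in 𝓝 y₀, ∀ u v, h y u v = h y v u) (u v w : E) :
    fderiv ℝ h y₀ u v w = fderiv ℝ h y₀ u w v := by
  have key : ∀ v w, fderiv ℝ h y₀ u v w = fderiv ℝ (fun y => h y v w) y₀ u := by
    intro v w
    have := ((hh.hasFDerivAt.clm_apply (hasFDerivAt_const v y₀)).clm_apply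
      (hasFDerivAt_const w y₀)).fderiv
    rw [this]
    simp
  rw [key, key]
  have : (fun y => h y v w) =ᶠ[𝓝 y₀] (fun y => h y w v) := hs.mono fun y hy => hy v w
  rw [this.fderiv_eq]

lemma christoffelMap_symm (hh : DifferentiableAt ℝ h y₀)
    (hs : ∀ᶠ y in 𝓝 y₀, ∀ u v, h y u v = h y v u) (u v : E) :
    christoffelMap h y₀ u v = christoffelMap h y₀ v u := by
  rw [christoffelMap_eq, christoffelMap_eq]
  congr 2
  ext w
  simp only [sub_apply, add_apply,
    ContinuousLinearMap.flip_apply]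
  rw [fderiv_metric_symm hh hs w u v]
  ring

/-- The Levi-Civita connection is metric. -/
lemma fderiv_metric_eq_christoffelMap (hh : DifferentiableAt ℝ h y₀)
    (hs : ∀ᶠ y in 𝓝 y₀, ∀ u v, h y u v = h y v u) (hi : (h y₀).IsInvertible) (u v w : E) :
    fderiv ℝ h y₀ u v w =
      h y₀ (christoffelMap h y₀ u v) w + h y₀ v (christoffelMap h y₀ u w) := by
  rw [hs.self_of_nhds v, metric_christoffelMap hi, metric_christoffelMap hi,
    fderiv_metric_symm hh hs w u v, fderiv_metric_symm hh hs u w v,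
    fderiv_metric_symm hh hs v u w]
  ring

/-- The covariant derivative `∇_U W` of the vector field `W` along `U`. -/
def covDeriv (h : E → E →L[ℝ] E →L[ℝ] ℝ) (U W : E → E) (y : E) : E :=
  fderiv ℝ W y (U y) + christoffelMap h y (U y) (W y)

lemma differentiableAt_covDeriv {U W : E → E} (hh : ContDiffAt ℝ 2 h y₀)
    (hi : (h y₀).IsInvertible) (hU : DifferentiableAt ℝ U y₀) (hW : ContDiffAt ℝ 2 W y₀) :
    DifferentiableAt ℝ (covDeriv h U W) y₀ := by
  have h2 : ContDiffAt ℝ 1 (fderiv ℝ W) y₀ := hW.fderiv_right (by norm_num)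
  have h3 := h2.differentiableAt (by norm_num)
  have h4 := hW.differentiableAt (by norm_num)
  have h5 := differentiableAt_christoffelMap hh hi
  exact (h3.clm_apply hU).add ((h5.clm_apply hU).clm_apply h4)

lemma covDeriv_sub_covDeriv {U W : E → E} (hh : DifferentiableAt ℝ h y₀)
    (hs : ∀ᶠ y in 𝓝 y₀, ∀ u v, h y u v = h y v u) :
    covDeriv h U W y₀ - covDeriv h W U y₀ = fderiv ℝ W y₀ (U y₀) - fderiv ℝ U y₀ (W y₀) := by
  rw [covDeriv, covDeriv, christoffelMap_symm hh hs (U y₀)]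
  abel

lemma hasFDerivAt_metric_apply {U W : E → E} (hh : DifferentiableAt ℝ h y₀)
    (hU : DifferentiableAt ℝ U y₀) (hW : DifferentiableAt ℝ W y₀) (u : E) :
    fderiv ℝ (fun y => h y (U y) (W y)) y₀ u =
      fderiv ℝ h y₀ u (U y₀) (W y₀) + h y₀ (fderiv ℝ U y₀ u) (W y₀)
        + h y₀ (U y₀) (fderiv ℝ W y₀ u) := by
  rw [((hh.hasFDerivAt.clm_apply hU.hasFDerivAt).clm_apply hW.hasFDerivAt).fderiv]
  simp
  ring

/-- The product rule for the Levi-Civita connection. -/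
lemma fderiv_metric_covDeriv {U V W : E → E} (hh : DifferentiableAt ℝ h y₀)
    (hs : ∀ᶠ y in 𝓝 y₀, ∀ u v, h y u v = h y v u) (hi : (h y₀).IsInvertible)
    (hU : DifferentiableAt ℝ U y₀) (hW : DifferentiableAt ℝ W y₀) :
    fderiv ℝ (fun y => h y (U y) (W y)) y₀ (V y₀) =
      h y₀ (covDeriv h V U y₀) (W y₀) + h y₀ (U y₀) (covDeriv h V W y₀) := by
  rw [hasFDerivAt_metric_apply hh hU hW, fderiv_metric_eq_christoffelMap hh hs hi]
  simp [covDeriv]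
  ring

/-- The curvature tensor in terms of covariant derivatives of arbitrary vector fields. -/
lemma curvature_eq_covDeriv {d : ℕ} {h : EuclideanSpace ℝ (Fin d) →
      EuclideanSpace ℝ (Fin d) →L[ℝ] EuclideanSpace ℝ (Fin d) →L[ℝ] ℝ}
    {y₀ : EuclideanSpace ℝ (Fin d)} {U V W : EuclideanSpace ℝ (Fin d) → EuclideanSpace ℝ (Fin d)}
    (hh : ContDiffAt ℝ 2 h y₀)
    (hi : (h y₀).IsInvertible) (hU : DifferentiableAt ℝ U y₀) (hV : DifferentiableAt ℝ V y₀)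
    (hW : ContDiffAt ℝ 2 W y₀) :
    curvature h y₀ (U y₀) (V y₀) (W y₀) =
      covDeriv h U (covDeriv h V W) y₀ - covDeriv h V (covDeriv h U W) y₀
        - covDeriv h (fun y => fderiv ℝ V y (U y) - fderiv ℝ U y (V y)) W y₀ := by
  have h2 : ContDiffAt ℝ 1 (fderiv ℝ W) y₀ := hW.fderiv_right (by norm_num)
  have h3 := h2.differentiableAt (by norm_num)
  have h4 := hW.differentiableAt (by norm_num)
  have h5 := differentiableAt_christoffelMap hh hi
  have dcov : ∀ {U : EuclideanSpace ℝ (Fin d) → EuclideanSpace ℝ (Fin d)}, DifferentiableAt ℝ U y₀ → ∀ v, fderiv ℝ (covDeriv h U W) y₀ v =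
      fderiv ℝ (fderiv ℝ W) y₀ v (U y₀) + fderiv ℝ W y₀ (fderiv ℝ U y₀ v)
      + (fderiv ℝ (christoffelMap h) y₀ v (U y₀) (W y₀)
        + christoffelMap h y₀ (fderiv ℝ U y₀ v) (W y₀)
        + christoffelMap h y₀ (U y₀) (fderiv ℝ W y₀ v)) := by
    intro U hU v
    have := ((h3.hasFDerivAt.clm_apply hU.hasFDerivAt).add
      ((h5.hasFDerivAt.clm_apply hU.hasFDerivAt).clm_apply h4.hasFDerivAt)).fderiv
    have e : covDeriv h U W = (fun y => (fderiv ℝ W y) (U y)) +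
      fun y => (christoffelMap h y (U y)) (W y) := rfl
    rw [e, this]
    simp
    abel
  have dchr : ∀ u v w, fderiv ℝ (fun z => christoffel h z v w) y₀ u =
      fderiv ℝ (christoffelMap h) y₀ u v w := by
    intro u v w
    have := ((h5.hasFDerivAt.clm_apply (hasFDerivAt_const v y₀)).clm_apply
      (hasFDerivAt_const w y₀)).fderiv
    simp only [christoffelMap_apply] at this
    rw [this]
    simp
  -- The second derivatives of `W` cancel by symmetry. The derivatives of `U` and `V` are absorbed
  -- by the bracket term, so only their values at `y₀` survive.
  have hsymm : fderiv ℝ (fderiv ℝ W) y₀ (U y₀) (V y₀) = fderiv ℝ (fderiv ℝ W) y₀ (V y₀) (U y₀) :=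
    (hW.isSymmSndFDerivAt (by simp)) (U y₀) (V y₀)
  have cD : ∀ (A B : EuclideanSpace ℝ (Fin d) → EuclideanSpace ℝ (Fin d)), covDeriv h A B y₀ =
    fderiv ℝ B y₀ (A y₀) + christoffelMap h y₀ (A y₀) (B y₀) := fun A B => rfl
  rw [curvature, dchr, dchr, cD U, cD V (covDeriv h U W), cD _ W, dcov hV, dcov hU, hsymm, cD, cD]
  simp only [← christoffelMap_apply, map_add, map_sub, sub_apply]
  abel

end Coordinates

/-! ### Killing fields: Koszul formula and curvature. -/

section Killing

variable {E : Type*} [NormedAddCommGroup E] [NormedSpace ℝ E] [CompleteSpace E]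
  {L : Type*} [LieRing L]

/-- A family of Killing vector fields near `y`, whose brackets are given by a Lie algebra `L`
up to a sign, as for the fundamental vector fields of a left action. -/
structure IsKillingFamily (h : E → E →L[ℝ] E →L[ℝ] ℝ) (V : L → E → E) (y : E) : Prop where
  contDiff_metric : ∀ᶠ z in 𝓝 y, ContDiffAt ℝ 2 h z
  symm : ∀ᶠ z in 𝓝 y, ∀ u v, h z u v = h z v u
  invertible : ∀ᶠ z in 𝓝 y, (h z).IsInvertible
  contDiff_field : ∀ᶠ z in 𝓝 y, ∀ X, ContDiffAt ℝ 2 (V X) z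
  killing : ∀ᶠ z in 𝓝 y, ∀ X u w, fderiv ℝ h z (V X z) u w + h z (fderiv ℝ (V X) z u) w
    + h z u (fderiv ℝ (V X) z w) = 0
  bracket : ∀ᶠ z in 𝓝 y, ∀ X Y,
    fderiv ℝ (V Y) z (V X z) - fderiv ℝ (V X) z (V Y z) = -V ⁅X, Y⁆ z

/-- The inner product of two fields of the family. -/
def fieldInner (h : E → E →L[ℝ] E →L[ℝ] ℝ) (V : L → E → E) (X Y : L) (y : E) : ℝ :=
  h y (V X y) (V Y y)

/-- The function `⟨∇_X Y, Z⟩` for fields of the family. -/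
def fieldNabla (h : E → E →L[ℝ] E →L[ℝ] ℝ) (V : L → E → E) (X Y Z : L) (y : E) : ℝ :=
  h y (covDeriv h (V X) (V Y) y) (V Z y)

namespace IsKillingFamily

variable {h : E → E →L[ℝ] E →L[ℝ] ℝ} {V : L → E → E} {y : E}

/-- All conditions hold on a neighbourhood, so identities proved at the base point also hold nearby
and may be differentiated. -/
lemma eventually (H : IsKillingFamily h V y) : ∀ᶠ z in 𝓝 y, IsKillingFamily h V z := by
  filter_upwards [H.contDiff_metric.eventually_nhds, H.symm.eventually_nhds,
    H.invertible.eventually_nhds, H.contDiff_field.eventually_nhds, H.killing.eventually_nhds,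
    H.bracket.eventually_nhds] with z h1 h2 h3 h4 h5 h6
  exact ⟨h1, h2, h3, h4, h5, h6⟩

lemma differentiableAt_metric (H : IsKillingFamily h V y) : DifferentiableAt ℝ h y :=
  H.contDiff_metric.self_of_nhds.differentiableAt (by norm_num)

lemma differentiableAt_field (H : IsKillingFamily h V y) (X : L) : DifferentiableAt ℝ (V X) y :=
  (H.contDiff_field.self_of_nhds X).differentiableAt (by norm_num)

lemma fieldInner_symm (H : IsKillingFamily h V y) (X Y : L) :
    fieldInner h V X Y y = fieldInner h V Y X y :=
  H.symm.self_of_nhds _ _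

lemma differentiableAt_covDeriv (H : IsKillingFamily h V y) (X Y : L) :
    DifferentiableAt ℝ (covDeriv h (V X) (V Y)) y :=
  FlagManifold.differentiableAt_covDeriv H.contDiff_metric.self_of_nhds H.invertible.self_of_nhds
    (H.differentiableAt_field X) (H.contDiff_field.self_of_nhds Y)

lemma fderiv_fieldInner (H : IsKillingFamily h V y) (X Y Z : L) :
    fderiv ℝ (fieldInner h V Y Z) y (V X y) =
      -fieldInner h V ⁅X, Y⁆ Z y - fieldInner h V Y ⁅X, Z⁆ y := by
  have h1 := hasFDerivAt_metric_apply H.differentiableAt_metric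
    (H.differentiableAt_field Y) (H.differentiableAt_field Z) (V X y)
  have h2 := H.killing.self_of_nhds X (V Y y) (V Z y)
  have h3 := congrArg (fun v => h y v (V Z y)) (H.bracket.self_of_nhds X Y)
  have h4 := congrArg (fun v => h y (V Y y) v) (H.bracket.self_of_nhds X Z)
  simp only [map_sub, map_neg, sub_apply, neg_apply] at h3 h4
  unfold fieldInner
  rw [h1]
  linarith

/-- For a Killing field `V Y` the endomorphism `v ↦ ∇_v (V Y)` is skew: this is the Killing equation
combined with metric compatibility and torsion-freeness. -/
lemma fieldNabla_skew (H : IsKillingFamily h V y) (X Y Z : L) :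
    fieldNabla h V X Y Z y = -fieldNabla h V Z Y X y := by
  have h2 := H.killing.self_of_nhds Y (V X y) (V Z y)
  have h3 := fderiv_metric_eq_christoffelMap H.differentiableAt_metric H.symm
    H.invertible.self_of_nhds (V Y y) (V X y) (V Z y)
  unfold fieldNabla covDeriv
  rw [christoffelMap_symm H.differentiableAt_metric H.symm (V X y),
    christoffelMap_symm H.differentiableAt_metric H.symm (V Z y)]
  have h4 := H.symm.self_of_nhds (V X y) (fderiv ℝ (V Y) y (V Z y))
  have h5 := H.symm.self_of_nhds (V X y) (christoffelMap h y (V Y y) (V Z y))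
  simp only [map_add, add_apply]
  linarith

lemma fieldNabla_sub (H : IsKillingFamily h V y) (X Y Z : L) :
    fieldNabla h V X Y Z y - fieldNabla h V Y X Z y = -fieldInner h V ⁅X, Y⁆ Z y := by
  have h1 := covDeriv_sub_covDeriv (U := V X) (W := V Y) H.differentiableAt_metric H.symm
  rw [H.bracket.self_of_nhds X Y] at h1
  have h2 := congrArg (fun v => h y v (V Z y)) h1
  simp only [map_sub, map_neg, sub_apply, neg_apply] at h2
  exact h2

/-- The Koszul formula for Killing fields. -/
lemma fieldNabla_eq (H : IsKillingFamily h V y) (X Y Z : L) :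
    fieldNabla h V X Y Z y = -(1 / 2) * (fieldInner h V ⁅X, Y⁆ Z y + fieldInner h V ⁅X, Z⁆ Y y
      + fieldInner h V X ⁅Y, Z⁆ y) := by
  -- Alternating torsion-freeness (swap the first two arguments) with skewness (swap the first and
  -- third) runs through all six permutations and returns with the opposite sign, which determines
  -- the value.
  have a1 := H.fieldNabla_sub X Y Z
  have a2 := H.fieldNabla_skew Y X Z
  have a3 := H.fieldNabla_sub X Z Y
  have a4 := H.fieldNabla_skew X Z Y
  have a5 := H.fieldNabla_sub Y Z X
  have a6 := H.fieldNabla_skew X Y Z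
  have a7 := H.fieldInner_symm X ⁅Y, Z⁆
  linarith

lemma fderiv_fieldNabla (H : IsKillingFamily h V y) (W X Y Z : L) :
    fderiv ℝ (fieldNabla h V X Y Z) y (V W y) =
      h y (covDeriv h (V W) (covDeriv h (V X) (V Y)) y) (V Z y)
        + h y (covDeriv h (V X) (V Y) y) (covDeriv h (V W) (V Z) y) :=
  fderiv_metric_covDeriv H.differentiableAt_metric H.symm H.invertible.self_of_nhds
    (H.differentiableAt_covDeriv X Y) (H.differentiableAt_field Z)

lemma fieldNabla_self (H : IsKillingFamily h V y) (X Y : L) :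
    fieldNabla h V X Y X y = 0 := by
  have := H.fieldNabla_skew X Y X
  linarith

lemma fieldNabla_diag (H : IsKillingFamily h V y) (X Y : L) :
    fieldNabla h V Y Y X y = fieldInner h V ⁅X, Y⁆ Y y := by
  have h1 := H.fieldNabla_skew Y Y X
  have h2 := H.fieldNabla_sub X Y Y
  have h3 := H.fieldNabla_self Y X
  linarith

end IsKillingFamily

variable {d : ℕ} {h : EuclideanSpace ℝ (Fin d) →
      EuclideanSpace ℝ (Fin d) →L[ℝ] EuclideanSpace ℝ (Fin d) →L[ℝ] ℝ}
    {V : L → EuclideanSpace ℝ (Fin d) → EuclideanSpace ℝ (Fin d)} {y : EuclideanSpace ℝ (Fin d)}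

/-- The sectional curvature expression of two Killing fields. -/
lemma IsKillingFamily.curvature_eq (H : IsKillingFamily h V y) (X Y : L) :
    h y (curvature h y (V X y) (V Y y) (V Y y)) (V X y) =
      -fieldInner h V ⁅X, ⁅X, Y⁆⁆ Y y - fieldInner h V ⁅X, Y⁆ ⁅X, Y⁆ y
      - h y (covDeriv h (V Y) (V Y) y) (covDeriv h (V X) (V X) y)
      + h y (covDeriv h (V X) (V Y) y) (covDeriv h (V Y) (V X) y)
      + fieldNabla h V ⁅X, Y⁆ Y X y := by
  rw [curvature_eq_covDeriv H.contDiff_metric.self_of_nhds H.invertible.self_of_nhds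
    (H.differentiableAt_field X) (H.differentiableAt_field Y) (H.contDiff_field.self_of_nhds Y)]
  -- Second covariant derivatives need no direct computation: near `y` the functions ⟨∇_Y Y, X⟩ and
  -- ⟨∇_X Y, X⟩ equal ⟨[X, Y], Y⟩ and 0, and differentiating these along X and Y isolates them.
  have h1 := H.fderiv_fieldNabla X Y Y X
  have h2 := H.fderiv_fieldNabla Y X Y X
  have e1 : fieldNabla h V Y Y X =ᶠ[𝓝 y] fieldInner h V ⁅X, Y⁆ Y :=
    H.eventually.mono fun z hz => hz.fieldNabla_diag X Y
  have e2 : fieldNabla h V X Y X =ᶠ[𝓝 y] fun _ => 0 :=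
    H.eventually.mono fun z hz => hz.fieldNabla_self X Y
  rw [e1.fderiv_eq, H.fderiv_fieldInner] at h1
  rw [e2.fderiv_eq] at h2
  have h3 : covDeriv h (fun y => fderiv ℝ (V Y) y (V X y) - fderiv ℝ (V X) y (V Y y)) (V Y) y
      = - covDeriv h (V ⁅X, Y⁆) (V Y) y := by
    unfold covDeriv
    simp only [H.bracket.self_of_nhds X Y, map_neg, neg_apply]
    abel
  rw [h3]
  simp only [map_sub, map_neg, sub_apply, neg_apply]
  simp only [fderiv_fun_const, Pi.zero_apply, zero_apply] at h2
  unfold fieldNabla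
  linarith

end Killing

/-! ### Scalar curvature as a sum over an orthogonal basis. -/

section Trace

variable {d : ℕ} {ι : Type*} [Fintype ι] [DecidableEq ι]

/-- The trace of a bilinear form with respect to an inner product, in an orthogonal basis. -/
lemma sum_inv_gram_mul (g S : EuclideanSpace ℝ (Fin d) →ₗ[ℝ] EuclideanSpace ℝ (Fin d) →ₗ[ℝ] ℝ)
    (f : Module.Basis ι ℝ (EuclideanSpace ℝ (Fin d))) (x : ι → ℝ) (hx : ∀ a, x a ≠ 0)
    (hf : ∀ a b, g (f a) (f b) = if a = b then x a else 0) :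
    ∑ i, ∑ j, (Matrix.of fun i j => g (EuclideanSpace.single i (1 : ℝ))
        (EuclideanSpace.single j (1 : ℝ)) : Matrix (Fin d) (Fin d) ℝ)⁻¹ i j *
      S (EuclideanSpace.single i 1) (EuclideanSpace.single j 1) = ∑ a, (x a)⁻¹ * S (f a) (f a) := by
  set e := (EuclideanSpace.basisFun (Fin d) ℝ).toBasis with he
  have hes : ∀ i, EuclideanSpace.single i (1 : ℝ) = e i := by simp [he]
  simp only [hes]
  set P := f.toMatrix e with hP
  set P' := e.toMatrix f with hP'
  have hPP : P * P' = 1 := f.toMatrix_mul_toMatrix_flip e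
  have hPP' : P' * P = 1 := e.toMatrix_mul_toMatrix_flip f
  have hsum : ∀ i, e i = ∑ a, P a i • f a := fun i => (f.sum_toMatrix_smul_self e i).symm
  have hsum' : ∀ a, f a = ∑ i, P' i a • e i := fun i => (e.sum_toMatrix_smul_self f i).symm
  -- The Gram matrix is congruent to the diagonal one through the change of basis, so its inverse is
  -- the diagonal inverse transformed by the inverse base change.
  have hG : (Matrix.of fun i j => g (e i) (e j) : Matrix (Fin d) (Fin d) ℝ) =
      P.transpose * Matrix.diagonal x * P := by
    ext i j
    rw [Matrix.of_apply, hsum i, hsum j]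
    simp only [map_sum, map_smul, LinearMap.sum_apply, LinearMap.smul_apply, hf, smul_eq_mul,
      Matrix.mul_apply, Matrix.transpose_apply, Matrix.diagonal_apply]
    simp
    refine Finset.sum_congr rfl fun a _ => by ring
  have hGi : (Matrix.of fun i j => g (e i) (e j) : Matrix (Fin d) (Fin d) ℝ)⁻¹ =
      P' * Matrix.diagonal (fun a => (x a)⁻¹) * P'.transpose := by
    apply Matrix.inv_eq_right_inv
    rw [hG]
    have hd : Matrix.diagonal x * Matrix.diagonal (fun a => (x a)⁻¹) = 1 := by
      rw [Matrix.diagonal_mul_diagonal]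
      simp [hx]
    calc _ = P.transpose * (Matrix.diagonal x * ((P * P') * Matrix.diagonal (fun a => (x a)⁻¹))) *
          P'.transpose := by simp only [Matrix.mul_assoc]
      _ = 1 := by
        rw [hPP, Matrix.one_mul, hd, Matrix.mul_one, ← Matrix.transpose_mul, hPP',
          Matrix.transpose_one]
  rw [hGi]
  have hR : ∀ a, S (f a) (f a) = ∑ i, ∑ j, P' i a * P' j a * S (e i) (e j) := by
    intro a
    conv_lhs => rw [hsum' a]
    simp only [map_sum, map_smul, LinearMap.sum_apply, LinearMap.smul_apply, smul_eq_mul,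
      Finset.mul_sum]
    rw [Finset.sum_comm]
    refine Finset.sum_congr rfl fun i _ => Finset.sum_congr rfl fun j _ => by ring
  simp only [hR, Matrix.mul_apply, Matrix.diagonal_apply, Matrix.transpose_apply, Finset.mul_sum,
    Finset.sum_mul]
  simp only [mul_ite, ite_mul, mul_zero, zero_mul, Finset.sum_ite_eq', Finset.mem_univ, if_true]
  have hc : ∀ F : Fin d → Fin d → ι → ℝ, ∑ i, ∑ j, ∑ a, F i j a = ∑ a, ∑ i, ∑ j, F i j a := by
    intro F
    rw [Finset.sum_comm' (t' := Finset.univ) (s' := fun _ => Finset.univ) (by simp)]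
    rw [Finset.sum_comm]
    simp_rw [Finset.sum_comm (s := (Finset.univ : Finset (Fin d))) (t := (Finset.univ : Finset ι))]
  rw [hc]
  refine Finset.sum_congr rfl fun a _ => Finset.sum_congr rfl fun i _ =>
    Finset.sum_congr rfl fun j _ => by ring

variable {h : EuclideanSpace ℝ (Fin d) →
      EuclideanSpace ℝ (Fin d) →L[ℝ] EuclideanSpace ℝ (Fin d) →L[ℝ] ℝ}
    {y : EuclideanSpace ℝ (Fin d)}

/-- Differentiating the map-valued `christoffelMap` instead of its values makes linearity in each
slot visible; the linearity lemmas below and the trace argument depend on this form. -/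
lemma curvature_eq_christoffelMap (hd : DifferentiableAt ℝ (christoffelMap h) y)
    (u v w : EuclideanSpace ℝ (Fin d)) :
    curvature h y u v w = fderiv ℝ (christoffelMap h) y u v w
      - fderiv ℝ (christoffelMap h) y v u w
      + christoffelMap h y u (christoffelMap h y v w)
      - christoffelMap h y v (christoffelMap h y u w) := by
  have dchr : ∀ u v w, fderiv ℝ (fun z => christoffel h z v w) y u =
      fderiv ℝ (christoffelMap h) y u v w := by
    intro u v w
    have := ((hd.hasFDerivAt.clm_apply (hasFDerivAt_const v y)).clm_apply
      (hasFDerivAt_const w y)).fderiv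
    simp only [christoffelMap_apply] at this
    rw [this]
    simp
  rw [curvature, dchr, dchr]
  simp only [christoffelMap_apply]

lemma curvature_add_mid (hd : DifferentiableAt ℝ (christoffelMap h) y)
    (u v v' w : EuclideanSpace ℝ (Fin d)) :
    curvature h y u (v + v') w = curvature h y u v w + curvature h y u v' w := by
  simp only [curvature_eq_christoffelMap hd, map_add, add_apply]
  abel

lemma curvature_smul_mid (hd : DifferentiableAt ℝ (christoffelMap h) y) (c : ℝ)
    (u v w : EuclideanSpace ℝ (Fin d)) :
    curvature h y u (c • v) w = c • curvature h y u v w := by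
  simp only [curvature_eq_christoffelMap hd, map_smul, smul_apply, smul_sub, smul_add]

lemma curvature_add_right (hd : DifferentiableAt ℝ (christoffelMap h) y)
    (u v w w' : EuclideanSpace ℝ (Fin d)) :
    curvature h y u v (w + w') = curvature h y u v w + curvature h y u v w' := by
  simp only [curvature_eq_christoffelMap hd, map_add]
  abel

lemma curvature_smul_right (hd : DifferentiableAt ℝ (christoffelMap h) y) (c : ℝ)
    (u v w : EuclideanSpace ℝ (Fin d)) :
    curvature h y u v (c • w) = c • curvature h y u v w := by
  simp only [curvature_eq_christoffelMap hd, map_smul, smul_sub, smul_add]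

lemma ricci_add_left (hd : DifferentiableAt ℝ (christoffelMap h) y)
    (v v' w : EuclideanSpace ℝ (Fin d)) :
    ricci h y (v + v') w = ricci h y v w + ricci h y v' w := by
  simp only [ricci, curvature_add_mid hd, PiLp.add_apply, Finset.sum_add_distrib]

lemma ricci_smul_left (hd : DifferentiableAt ℝ (christoffelMap h) y) (c : ℝ)
    (v w : EuclideanSpace ℝ (Fin d)) :
    ricci h y (c • v) w = c • ricci h y v w := by
  simp only [ricci, curvature_smul_mid hd, PiLp.smul_apply, Finset.smul_sum]

lemma ricci_add_right (hd : DifferentiableAt ℝ (christoffelMap h) y)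
    (v w w' : EuclideanSpace ℝ (Fin d)) :
    ricci h y v (w + w') = ricci h y v w + ricci h y v w' := by
  simp only [ricci, curvature_add_right hd, PiLp.add_apply, Finset.sum_add_distrib]

lemma ricci_smul_right (hd : DifferentiableAt ℝ (christoffelMap h) y) (c : ℝ)
    (v w : EuclideanSpace ℝ (Fin d)) :
    ricci h y v (c • w) = c • ricci h y v w := by
  simp only [ricci, curvature_smul_right hd, PiLp.smul_apply, Finset.smul_sum]

/-- A trace does not depend on the basis, and in an orthogonal basis the coordinates of `v` are `(x
a)⁻¹ * h y v (f a)`. -/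
lemma ricci_eq_sum (hd : DifferentiableAt ℝ (christoffelMap h) y)
    (f : Module.Basis ι ℝ (EuclideanSpace ℝ (Fin d))) (x : ι → ℝ) (hx : ∀ a, x a ≠ 0)
    (hf : ∀ a b, h y (f a) (f b) = if a = b then x a else 0) (v w : EuclideanSpace ℝ (Fin d)) :
    ricci h y v w = ∑ a, (x a)⁻¹ * h y (curvature h y (f a) v w) (f a) := by
  set R : EuclideanSpace ℝ (Fin d) →ₗ[ℝ] EuclideanSpace ℝ (Fin d) :=
    { toFun := fun u => curvature h y u v w
      map_add' := fun u u' => by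
        simp only [curvature_eq_christoffelMap hd, map_add, add_apply]; abel
      map_smul' := fun c u => by
        simp only [curvature_eq_christoffelMap hd, map_smul, smul_apply, RingHom.id_apply,
          smul_sub, smul_add] } with hR
  have hrepr : ∀ v a, f.repr v a = (x a)⁻¹ * h y v (f a) := by
    intro v a
    conv_rhs => rw [← f.sum_repr v]
    simp only [map_sum, map_smul, sum_apply, smul_apply, hf]
    simp
    field_simp [hx a]
  have h1 : LinearMap.trace ℝ _ R = ricci h y v w := by
    rw [LinearMap.trace_eq_matrix_trace ℝ (EuclideanSpace.basisFun (Fin d) ℝ).toBasis,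
      Matrix.trace]
    simp [LinearMap.toMatrix_apply, ricci, hR]
  rw [← h1, LinearMap.trace_eq_matrix_trace ℝ f, Matrix.trace]
  simp only [Matrix.diag_apply, LinearMap.toMatrix_apply, hrepr]
  rfl

/-- The scalar curvature as a sum of sectional curvature expressions over an orthogonal basis. -/
lemma scalar_eq_sum (hd : DifferentiableAt ℝ (christoffelMap h) y)
    (f : Module.Basis ι ℝ (EuclideanSpace ℝ (Fin d))) (x : ι → ℝ) (hx : ∀ a, x a ≠ 0)
    (hf : ∀ a b, h y (f a) (f b) = if a = b then x a else 0) :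
    scalar h y =
      ∑ b, ∑ a, (x a)⁻¹ * (x b)⁻¹ * h y (curvature h y (f a) (f b) (f b)) (f a) := by
  set S : EuclideanSpace ℝ (Fin d) →ₗ[ℝ] EuclideanSpace ℝ (Fin d) →ₗ[ℝ] ℝ :=
    LinearMap.mk₂ ℝ (ricci h y) (ricci_add_left hd) (ricci_smul_left hd) (ricci_add_right hd)
      (ricci_smul_right hd)
  set g : EuclideanSpace ℝ (Fin d) →ₗ[ℝ] EuclideanSpace ℝ (Fin d) →ₗ[ℝ] ℝ :=
    LinearMap.mk₂ ℝ (fun u v => h y u v) (by simp) (by simp) (by simp) (by simp)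
  have h1 := sum_inv_gram_mul g S f x hx hf
  have h2 : scalar h y = ∑ a, (x a)⁻¹ * ricci h y (f a) (f a) := h1
  rw [h2]
  refine Finset.sum_congr rfl fun b _ => ?_
  rw [ricci_eq_sum hd f x hx hf, Finset.mul_sum]
  exact Finset.sum_congr rfl fun a _ => by ring

end Trace

/-! ### Summation of sectional curvatures. -/

section Sums

variable {ι : Type*} [Fintype ι]

lemma sum_symm_right (s F : ι → ι → ι → ℝ) (h : ∀ a b c, s a b c = s a c b) :
    ∑ a, ∑ b, ∑ c, s a b c * F a b c = ∑ a, ∑ b, ∑ c, s a b c * F a c b := by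
  refine Finset.sum_congr rfl fun a _ => ?_
  rw [Finset.sum_comm]
  refine Finset.sum_congr rfl fun b _ => Finset.sum_congr rfl fun c _ => by rw [h]

lemma sum_symm_left (s F : ι → ι → ι → ℝ) (h : ∀ a b c, s a b c = s b a c) :
    ∑ a, ∑ b, ∑ c, s a b c * F a b c = ∑ a, ∑ b, ∑ c, s a b c * F b a c := by
  rw [Finset.sum_comm]
  refine Finset.sum_congr rfl fun a _ => Finset.sum_congr rfl fun b _ =>
    Finset.sum_congr rfl fun c _ => by rw [h]

/-- The summation giving the scalar curvature of a diagonal metric from its sectional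
curvatures. -/
lemma sum_sectional (s : ι → ι → ι → ℝ) (A : ι → ι → ℝ) (w : ι → ℝ) (hw : ∀ a, w a ≠ 0)
    (h1 : ∀ a b c, s a b c = s b a c) (h2 : ∀ a b c, s a b c = s a c b)
    (hA : ∀ a b, A a b = A b a) (hk : ∀ a, ∑ b, (2 * A a b + ∑ c, s a b c) = 1) :
    ∑ b, ∑ a, (w a)⁻¹ * (w b)⁻¹ * (1 / 2 * (w a + w b) * (A a b + ∑ c, s a b c)
      - 1 / 2 * (∑ c, w c * s a b c)
      - 1 / 4 * ∑ c, (w c)⁻¹ * (w c ^ 2 - (w a - w b) ^ 2) * s a b c) =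
    1 / 2 * ∑ a, (w a)⁻¹ - 1 / 4 * ∑ a, ∑ b, ∑ c, s a b c * (w c * (w a)⁻¹ * (w b)⁻¹) := by
  have e1 : ∀ a b, (w a)⁻¹ * (w b)⁻¹ * (1 / 2 * (w a + w b) * (A a b + ∑ c, s a b c)
      - 1 / 2 * (∑ c, w c * s a b c)
      - 1 / 4 * ∑ c, (w c)⁻¹ * (w c ^ 2 - (w a - w b) ^ 2) * s a b c) =
      1 / 2 * ((w a)⁻¹ * A a b) + 1 / 2 * ((w b)⁻¹ * A b a)
      + 1 / 2 * (∑ c, s a b c * (w a)⁻¹) + 1 / 2 * (∑ c, s a b c * (w b)⁻¹)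
      - 3 / 4 * (∑ c, s a b c * (w c * (w a)⁻¹ * (w b)⁻¹))
      + 1 / 4 * (∑ c, s a b c * (w a * (w b)⁻¹ * (w c)⁻¹))
      + 1 / 4 * (∑ c, s a b c * (w b * (w a)⁻¹ * (w c)⁻¹))
      - 1 / 2 * (∑ c, s a b c * (w c)⁻¹) := by
    intro a b
    rw [hA b a]
    simp only [Finset.mul_sum, mul_add, mul_sub]
    have h3 : ∀ X Y : ℝ, ∀ F G : ι → ℝ, X = Y → (∀ c, F c = G c) →
      X + ∑ c, F c = Y + ∑ c, G c := by
      intro X Y F G h h'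
      rw [h, Finset.sum_congr rfl fun c _ => h' c]
    have ha := hw a
    have hb := hw b
    have : (w a)⁻¹ * (w b)⁻¹ * ((1 / 2 * w a + 1 / 2 * w b) * A a b) =
      1 / 2 * ((w a)⁻¹ * A a b) + 1 / 2 * ((w b)⁻¹ * A a b) := by field_simp; ring
    have h4 : ∀ P Q R S P' Q' : ℝ, P + Q - R - S = P + (Q - R - S) := by intros; ring
    rw [h4 _ _ _ _ 0 0]
    simp only [add_assoc, sub_eq_add_neg, ← Finset.sum_neg_distrib, ← Finset.sum_add_distrib]
    rw [← add_assoc (1 / 2 * ((w a)⁻¹ * A a b))]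
    refine h3 _ _ _ _ this fun c => ?_
    have hc := hw c
    field_simp
    ring
  simp only [e1]
  rw [Finset.sum_comm]
  simp only [Finset.sum_add_distrib, Finset.sum_sub_distrib, ← Finset.mul_sum]
  -- By symmetry of `s` all sums reduce to two types. The terms w_c / (w_a w_b) get coefficient -3/4
  -- + 1/4 + 1/4 = -1/4. The terms with a single inverse weight add up to half of ∑ (w_a)⁻¹ ∑ (2A +
  -- s), where `hk` applies.
  have f1 : ∑ a, ∑ b, (w b)⁻¹ * A b a = ∑ a, (w a)⁻¹ * ∑ b, A a b := by
    rw [Finset.sum_comm]; simp only [Finset.mul_sum]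
  have f2 : ∑ a, ∑ b, ∑ c, s a b c * (w b)⁻¹ = ∑ a, ∑ b, ∑ c, s a b c * (w a)⁻¹ :=
    sum_symm_left s (fun a b c => (w b)⁻¹) h1
  have f3 : ∑ a, ∑ b, ∑ c, s a b c * (w c)⁻¹ = ∑ a, ∑ b, ∑ c, s a b c * (w a)⁻¹ :=
    (sum_symm_right s (fun a b c => (w c)⁻¹) h2).trans f2
  have f4 : ∑ a, ∑ b, ∑ c, s a b c * (w b * (w a)⁻¹ * (w c)⁻¹) =
      ∑ a, ∑ b, ∑ c, s a b c * (w c * (w a)⁻¹ * (w b)⁻¹) :=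
    sum_symm_right s (fun a b c => w b * (w a)⁻¹ * (w c)⁻¹) h2
  have f5 : ∑ a, ∑ b, ∑ c, s a b c * (w a * (w b)⁻¹ * (w c)⁻¹) =
      ∑ a, ∑ b, ∑ c, s a b c * (w c * (w a)⁻¹ * (w b)⁻¹) :=
    (sum_symm_left s (fun a b c => w a * (w b)⁻¹ * (w c)⁻¹) h1).trans f4
  have f6 : ∑ a, (w a)⁻¹ = 2 * ∑ a, (w a)⁻¹ * ∑ b, A a b
      + ∑ a, ∑ b, ∑ c, s a b c * (w a)⁻¹ := by
    have : ∀ a, (w a)⁻¹ = 2 * ((w a)⁻¹ * ∑ b, A a b) + ∑ b, ∑ c, s a b c * (w a)⁻¹ := by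
      intro a
      conv_lhs => rw [← mul_one (w a)⁻¹, ← hk a]
      rw [Finset.sum_add_distrib, ← Finset.mul_sum, mul_add]
      simp only [← Finset.sum_mul]
      ring
    conv_lhs => rw [Finset.sum_congr rfl fun a _ => this a]
    rw [Finset.sum_add_distrib, Finset.mul_sum]
  rw [f1, f2, f3, f4, f5, f6]
  ring

end Sums

/-! ### Scalar curvature from structure constants. -/

section Scalar

variable {d : ℕ} {ι κ : Type*} [Fintype ι] [DecidableEq ι] [Fintype κ]
  {L : Type*} [LieRing L] [LieAlgebra ℝ L]

/-- An orthonormal basis of a Lie algebra for an invariant form `β`, in two parts `X` and `Y`,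
such that the span of `Y` is a subalgebra. -/
structure IsReductiveBasis (β : LinearMap.BilinForm ℝ L) (X : ι → L) (Y : κ → L) : Prop where
  symm : ∀ A B, β A B = β B A
  invariant : ∀ A B C, β ⁅A, B⁆ C = β A ⁅B, C⁆
  parseval : ∀ A B, β A B = ∑ a, β A (X a) * β B (X a) + ∑ r, β A (Y r) * β B (Y r)
  orthonormal : ∀ a b, β (X a) (X b) = if a = b then 1 else 0
  subalgebra : ∀ r s a, β ⁅Y r, Y s⁆ (X a) = 0
  killing : ∀ a, ∑ b, β ⁅X a, X b⁆ ⁅X a, X b⁆ + ∑ r, β ⁅X a, Y r⁆ ⁅X a, Y r⁆ = 1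

namespace IsReductiveBasis

variable {β : LinearMap.BilinForm ℝ L} {X : ι → L} {Y : κ → L}

lemma invariant' (H : IsReductiveBasis β X Y) (A B C : L) : β ⁅A, B⁆ C = -β B ⁅A, C⁆ := by
  rw [← lie_skew, map_neg, LinearMap.neg_apply, H.invariant]

lemma structure_swap_left (_H : IsReductiveBasis β X Y) (A B C : L) :
    β ⁅A, B⁆ C = -β ⁅B, A⁆ C := by
  rw [← lie_skew, map_neg, LinearMap.neg_apply]

lemma structure_swap_right (H : IsReductiveBasis β X Y) (A B C : L) :
    β ⁅A, B⁆ C = -β ⁅A, C⁆ B := by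
  rw [H.invariant', H.symm]

/-- The normalization is -tr ad(X_a)² = 1 in structure constants. The factor 2 appears because the
Y_r-component of [X_a, X_b] occurs again, by invariance, as the X_b-component of [X_a, Y_r], which
has no Y-components. -/
lemma killing_eq (H : IsReductiveBasis β X Y) (a : ι) :
    ∑ b, (2 * ∑ r, β ⁅X a, X b⁆ (Y r) ^ 2 + ∑ c, β ⁅X a, X b⁆ (X c) ^ 2) = 1 := by
  rw [← H.killing a]
  have e1 : ∀ b, β ⁅X a, X b⁆ ⁅X a, X b⁆ = ∑ c, β ⁅X a, X b⁆ (X c) ^ 2 +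
      ∑ r, β ⁅X a, X b⁆ (Y r) ^ 2 := by
    intro b
    rw [H.parseval]
    simp only [sq]
  have e2 : ∀ r, β ⁅X a, Y r⁆ ⁅X a, Y r⁆ = ∑ c, β ⁅X a, X c⁆ (Y r) ^ 2 := by
    intro r
    rw [H.parseval]
    have h1 : ∀ s, β ⁅X a, Y r⁆ (Y s) = 0 := by
      intro s
      rw [H.invariant, H.symm, H.subalgebra]
    have h2 : ∀ c, β ⁅X a, Y r⁆ (X c) = -β ⁅X a, X c⁆ (Y r) := fun c =>
      H.structure_swap_right _ _ _
    simp only [h1, h2]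
    simp only [mul_zero, Finset.sum_const_zero, add_zero, neg_mul_neg, sq]
  simp only [e1, e2]
  rw [Finset.sum_comm (s := (Finset.univ : Finset κ)), ← Finset.sum_add_distrib]
  exact Finset.sum_congr rfl fun b _ => by ring

variable {h : EuclideanSpace ℝ (Fin d) →
      EuclideanSpace ℝ (Fin d) →L[ℝ] EuclideanSpace ℝ (Fin d) →L[ℝ] ℝ}
    {V : L → EuclideanSpace ℝ (Fin d) → EuclideanSpace ℝ (Fin d)} {y : EuclideanSpace ℝ (Fin d)}
    {w : ι → ℝ}

/-- The metric at a point in terms of an orthogonal basis. -/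
lemma metric_eq_sum (hw : ∀ a, w a ≠ 0)
    (f : Module.Basis ι ℝ (EuclideanSpace ℝ (Fin d)))
    (hf : ∀ a b, h y (f a) (f b) = if a = b then w a else 0) (u v : EuclideanSpace ℝ (Fin d)) :
    h y u v = ∑ c, (w c)⁻¹ * (h y u (f c) * h y v (f c)) := by
  have hrepr : ∀ v a, h y v (f a) = w a * f.repr v a := by
    intro v a
    conv_lhs => rw [← f.sum_repr v]
    simp only [map_sum, map_smul, sum_apply, smul_apply, hf]
    simp
    ring
  simp only [hrepr]
  conv_lhs => rw [← f.sum_repr v]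
  simp only [map_sum, map_smul, hrepr, smul_eq_mul]
  refine Finset.sum_congr rfl fun c _ => ?_
  field_simp [hw c]

/-- The scalar curvature, at a point, of a metric with a transitive family of Killing fields, in
terms of the structure constants. -/
theorem scalar_eq (H : IsReductiveBasis β X Y) (K : IsKillingFamily h V y) (hw : ∀ a, w a ≠ 0)
    (hQ : ∀ A B, fieldInner h V A B y = ∑ a, w a * (β A (X a) * β B (X a)))
    (f : Module.Basis ι ℝ (EuclideanSpace ℝ (Fin d))) (hfX : ∀ a, f a = V (X a) y) :
    scalar h y = 1 / 2 * ∑ a, (w a)⁻¹ -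
      1 / 4 * ∑ a, ∑ b, ∑ c, β ⁅X a, X b⁆ (X c) ^ 2 * (w c * (w a)⁻¹ * (w b)⁻¹) := by
  have hQX : ∀ A b, fieldInner h V A (X b) y = w b * β A (X b) := by
    intro A b
    rw [hQ]
    simp [H.orthonormal]
  have hf : ∀ a b, h y (f a) (f b) = if a = b then w a else 0 := by
    intro a b
    have := hQX (X a) b
    rw [H.orthonormal] at this
    rw [hfX, hfX]
    refine this.trans ?_
    split_ifs with hab
    · rw [hab, mul_one]
    · rw [mul_zero]
  have hd := differentiableAt_christoffelMap K.contDiff_metric.self_of_nhds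
    K.invertible.self_of_nhds
  rw [scalar_eq_sum hd f w hw hf, ← sum_sectional (fun a b c => β ⁅X a, X b⁆ (X c) ^ 2)
    (fun a b => ∑ r, β ⁅X a, X b⁆ (Y r) ^ 2) w hw]
  rotate_left
  · intro a b c
    rw [H.structure_swap_left, neg_sq]
  · intro a b c
    rw [H.structure_swap_right, neg_sq]
  · intro a b
    refine Finset.sum_congr rfl fun r _ => ?_
    rw [H.structure_swap_left, neg_sq]
  · exact H.killing_eq
  refine Finset.sum_congr rfl fun b _ => Finset.sum_congr rfl fun a _ => ?_
  congr 1
  -- Koszul's formula for a diagonal metric: by total skewness of the structure constants, the three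
  -- terms differ only by a weight and a sign.
  have hnab : ∀ a b c, fieldNabla h V (X a) (X b) (X c) y =
      -(1 / 2) * ((w c - w b + w a) * β ⁅X a, X b⁆ (X c)) := by
    intro a b c
    rw [K.fieldNabla_eq, hQX, hQX, K.fieldInner_symm, hQX, H.structure_swap_right (X a) (X c),
      ← H.symm (X a) ⁅X b, X c⁆, ← H.invariant]
    ring
  have hN : β ⁅X a, X b⁆ ⁅X a, X b⁆ = ∑ c, β ⁅X a, X b⁆ (X c) ^ 2 +
      ∑ r, β ⁅X a, X b⁆ (Y r) ^ 2 := by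
    rw [H.parseval]
    simp only [sq]
  rw [hfX, hfX, K.curvature_eq, metric_eq_sum hw f hf (covDeriv h (V (X b)) (V (X b)) y),
    metric_eq_sum hw f hf (covDeriv h (V (X a)) (V (X b)) y)]
  have t1 : ∀ a b c, h y (covDeriv h (V (X a)) (V (X b)) y) (f c) =
      -(1 / 2) * ((w c - w b + w a) * β ⁅X a, X b⁆ (X c)) := by
    intro a b c
    rw [hfX, ← hnab]
    rfl
  have t2 : β ⁅X a, ⁅X a, X b⁆⁆ (X b) = -β ⁅X a, X b⁆ ⁅X a, X b⁆ := H.invariant' _ _ _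
  have t3 : fieldInner h V ⁅X a, X b⁆ ⁅X a, X b⁆ y = ∑ c, w c * β ⁅X a, X b⁆ (X c) ^ 2 := by
    rw [hQ]
    simp only [sq]
  have t4 : fieldNabla h V ⁅X a, X b⁆ (X b) (X a) y =
      1 / 2 * (w a - w b) * β ⁅X a, X b⁆ ⁅X a, X b⁆ +
        1 / 2 * ∑ c, w c * β ⁅X a, X b⁆ (X c) ^ 2 := by
    have h5 : β ⁅⁅X a, X b⁆, X b⁆ (X a) = -β ⁅X a, X b⁆ ⁅X a, X b⁆ := by
      rw [H.invariant, ← lie_skew (X b) (X a), map_neg]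
    rw [K.fieldNabla_eq, hQX, hQX, h5, H.invariant ⁅X a, X b⁆ (X a) (X b), ← t3]
    have : fieldInner h V ⁅X a, X b⁆ ⁅X b, X a⁆ y = - fieldInner h V ⁅X a, X b⁆ ⁅X a, X b⁆ y := by
      rw [hQ, hQ, ← Finset.sum_neg_distrib]
      refine Finset.sum_congr rfl fun c _ => ?_
      rw [H.structure_swap_left (X b) (X a)]
      ring
    rw [this]
    ring
  simp only [t1, hQX, t2, t3, t4, hN]
  -- The fields are geodesic at this point: ∇_{X_b} X_b has all components proportional to [X_b,
  -- X_b] = 0.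
  simp only [lie_self, map_zero, LinearMap.zero_apply, mul_zero, Finset.sum_const_zero, sub_zero]
  -- Here (w_c - w_b + w_a)(w_c - w_a + w_b) = w_c² - (w_a - w_b)², and the sign comes from swapping
  -- X_a and X_b.
  have t5 : ∑ c, (w c)⁻¹ * (-(1 / 2) * ((w c - w b + w a) * β ⁅X a, X b⁆ (X c)) *
      (-(1 / 2) * ((w c - w a + w b) * β ⁅X b, X a⁆ (X c)))) =
      -(1 / 4) * ∑ c, (w c)⁻¹ * (w c ^ 2 - (w a - w b) ^ 2) * β ⁅X a, X b⁆ (X c) ^ 2 := by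
    rw [Finset.mul_sum]
    refine Finset.sum_congr rfl fun c _ => ?_
    rw [H.structure_swap_left (X b) (X a)]
    ring
  rw [t5]
  ring

end IsReductiveBasis

end Scalar

/-! ### Infinitesimal flag data: Schur's lemma and the eigenvalues of ad(γ)². -/

section Algebra

/-- The inner product given by a positive definite form. -/
abbrev innerCore {W : Type*} [AddCommGroup W] [Module ℝ W] (β : LinearMap.BilinForm ℝ W)
    (hs : ∀ A B, β A B = β B A) (hp : ∀ A, A ≠ 0 → 0 < β A A) : InnerProductSpace.Core ℝ W where
  inner := fun A B => β A B
  conj_inner_symm := fun A B => by simp [hs A B]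
  re_inner_nonneg := fun A => by
    by_cases h : A = 0
    · simp [h]
    · simpa using (hp A h).le
  add_left := fun A B C => by simp
  smul_left := fun A B r => by simp
  definite := fun A h => by
    by_contra hA
    exact (hp A hA).ne' h

/-- A self-adjoint operator for a positive definite form on a nonzero finite-dimensional real space
has an eigenvector. -/
lemma exists_eigenvector_of_symmetric {W : Type*} [AddCommGroup W] [Module ℝ W]
    [FiniteDimensional ℝ W] [Nontrivial W] (β : LinearMap.BilinForm ℝ W)
    (hs : ∀ A B, β A B = β B A) (hp : ∀ A, A ≠ 0 → 0 < β A A) (T : W →ₗ[ℝ] W)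
    (hT : ∀ A B, β (T A) B = β A (T B)) : ∃ (μ : ℝ) (A : W), A ≠ 0 ∧ T A = μ • A := by
  let : NormedAddCommGroup W := (innerCore β hs hp).toNormedAddCommGroup
  let : InnerProductSpace ℝ W := InnerProductSpace.ofCore (innerCore β hs hp).toCore
  have hsym : T.IsSymmetric := fun A B => hT A B
  obtain ⟨A, hA⟩ := hsym.hasEigenvalue_iSup_of_finiteDimensional.exists_hasEigenvector
  exact ⟨_, A, hA.2, hA.apply_eq_smul⟩

/-- A positive definite form on a finite-dimensional space has an orthonormal basis. -/
lemma exists_orthonormal_basis {W : Type*} [AddCommGroup W] [Module ℝ W]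
    [FiniteDimensional ℝ W] (β : LinearMap.BilinForm ℝ W)
    (hs : ∀ A B, β A B = β B A) (hp : ∀ A, A ≠ 0 → 0 < β A A) :
    ∃ b : Module.Basis (Fin (Module.finrank ℝ W)) ℝ W,
      ∀ i j, β (b i) (b j) = if i = j then 1 else 0 := by
  let : NormedAddCommGroup W := (innerCore β hs hp).toNormedAddCommGroup
  let : InnerProductSpace ℝ W := InnerProductSpace.ofCore (innerCore β hs hp).toCore
  refine ⟨(stdOrthonormalBasis ℝ W).toBasis, fun i j => ?_⟩
  have := orthonormal_iff_ite.mp (stdOrthonormalBasis ℝ W).orthonormal i j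
  rw [OrthonormalBasis.coe_toBasis]
  exact this

variable {L : Type*} [LieRing L] [LieAlgebra ℝ L]

/-- The infinitesimal data of a generalized flag manifold with two isotropy summands: `β` is minus
the Killing form, `S` is the isotropy group acting on the Lie algebra. -/
structure IsFlagData (β : LinearMap.BilinForm ℝ L) (γ : L) (𝔨 : Submodule ℝ L)
    (m : Fin 2 → Submodule ℝ L) (S : Set (L →ₗ[ℝ] L)) : Prop where
  symm : ∀ A B, β A B = β B A
  invariant : ∀ A B C, β ⁅A, B⁆ C = β A ⁅B, C⁆
  pos : ∀ A, A ≠ 0 → 0 < β A A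
  mem_k : ∀ A, A ∈ 𝔨 ↔ ⁅γ, A⁆ = 0
  mem_m : ∀ A, A ∈ m 0 ⊔ m 1 ↔ ∀ B ∈ 𝔨, β A B = 0
  preserves : ∀ a ∈ S, ∀ A B, β (a A) (a B) = β A B
  commutes : ∀ a ∈ S, ∀ A, a ⁅γ, A⁆ = ⁅γ, a A⁆
  ne_bot : ∀ i, m i ≠ ⊥
  mapsTo : ∀ i, ∀ a ∈ S, ∀ A ∈ m i, a A ∈ m i
  irreducible : ∀ i, ∀ W ≤ m i, (∀ a ∈ S, ∀ A ∈ W, a A ∈ W) → W = ⊥ ∨ W = m i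
  inequivalent : ¬ ∃ f : m 0 ≃ₗ[ℝ] m 1, ∀ a ∈ S, ∀ A B : m 0, (B : L) = a A → (f B : L) = a (f A)
  lie_mem : ∀ i, ∀ A ∈ 𝔨, ∀ B ∈ m i, ⁅A, B⁆ ∈ m i

namespace IsFlagData

variable [FiniteDimensional ℝ L] {β : LinearMap.BilinForm ℝ L} {γ : L} {𝔨 : Submodule ℝ L}
    {m : Fin 2 → Submodule ℝ L} {S : Set (L →ₗ[ℝ] L)}

lemma eq_zero (H : IsFlagData β γ 𝔨 m S) {A : L} (h : β A A = 0) : A = 0 := by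
  by_contra hA
  exact (H.pos A hA).ne' h

lemma restrict_nondegenerate (H : IsFlagData β γ 𝔨 m S) (W : Submodule ℝ L) :
    (β.restrict W).Nondegenerate := by
  refine ⟨fun A h => ?_, fun A h => ?_⟩
  · exact Subtype.ext (H.eq_zero (h A))
  · exact Subtype.ext (H.eq_zero (h A))

/-- Schur's lemma for invariant pairings of inequivalent summands. -/
lemma pairing_eq_zero (H : IsFlagData β γ 𝔨 m S) (b : LinearMap.BilinForm ℝ L)
    (hb : ∀ a ∈ S, ∀ A B, b (a A) (a B) = b A B) {A B : L} (hA : A ∈ m 0) (hB : B ∈ m 1) :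
    b A B = 0 := by
  -- The pairing is represented through `β` by a linear map `f : m 0 → m 1`, which turns out
  -- equivariant; the usual Schur dichotomy then applies to `f`.
  set e := (β.restrict (m 1)).toDual (H.restrict_nondegenerate _) with he
  set f : m 0 →ₗ[ℝ] m 1 := e.symm.toLinearMap ∘ₗ (Submodule.dualRestrict (m 1)) ∘ₗ
    b ∘ₗ (m 0).subtype with hf
  have hf1 : ∀ (A : m 0) (B : m 1), β (f A) B = b A B := by
    intro A B
    have := LinearMap.BilinForm.apply_toDual_symm_apply (B := β.restrict (m 1))
      (hB := H.restrict_nondegenerate _) ((Submodule.dualRestrict (m 1)) (b A)) B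
    exact this
  -- `S` is only a set, without inverses. Preserving a definite form on a finite-dimensional space
  -- replaces them: injective implies surjective.
  have hsurj : ∀ a ∈ S, ∀ B ∈ m 1, ∃ B' ∈ m 1, a B' = B := by
    intro a ha B hB
    have hinj : Function.Injective (a.restrict (H.mapsTo 1 a ha)) := by
      rw [← LinearMap.ker_eq_bot, LinearMap.ker_eq_bot']
      intro A hA
      have h1 : a A = 0 := congrArg Subtype.val hA
      apply Subtype.ext
      apply H.eq_zero
      rw [← H.preserves a ha, h1, map_zero]
    obtain ⟨B', h⟩ := LinearMap.injective_iff_surjective.mp hinj ⟨B, hB⟩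
    exact ⟨B', B'.2, congrArg Subtype.val h⟩
  have hequiv : ∀ a ∈ S, ∀ A B : m 0, (B : L) = a A → (f B : L) = a (f A) := by
    intro a ha A B hAB
    rw [← sub_eq_zero]
    have hmem : (f B : L) - a (f A) ∈ m 1 := (m 1).sub_mem (f B).2 (H.mapsTo 1 a ha _ (f A).2)
    obtain ⟨C, hC, hCe⟩ := hsurj a ha _ hmem
    apply H.eq_zero
    have h2 : β (f B) (a C) = b B (a C) := hf1 B ⟨a C, H.mapsTo 1 a ha _ hC⟩
    have h3 : β (f A) C = b A C := hf1 A ⟨C, hC⟩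
    have h4 : β ((f B : L) - a (f A)) (a C) = 0 := by
      rw [map_sub, LinearMap.sub_apply, H.preserves a ha, h2, h3, hAB, hb a ha, sub_self]
    rwa [hCe] at h4
  suffices h0 : f = 0 by
    have := hf1 ⟨A, hA⟩ ⟨B, hB⟩
    rw [h0] at this
    simpa using this.symm
  have hker := H.irreducible 0 ((LinearMap.ker f).map (m 0).subtype)
    (Submodule.map_subtype_le _ _) (by
      rintro a ha _ ⟨A, hA, rfl⟩
      refine ⟨⟨a A, H.mapsTo 0 a ha _ A.2⟩, ?_, rfl⟩
      have h1 := hequiv a ha A ⟨a A, H.mapsTo 0 a ha _ A.2⟩ rfl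
      have h2 : f A = 0 := hA
      rw [h2] at h1
      simpa using h1)
  rcases hker with hker | hker
  · have hinj : LinearMap.ker f = ⊥ := by
      rwa [(Submodule.map_injective_of_injective (Submodule.injective_subtype _)).eq_iff' (Submodule.map_bot _)] at hker
    have hran := H.irreducible 1 ((LinearMap.range f).map (m 1).subtype)
      (Submodule.map_subtype_le _ _) (by
        rintro a ha _ ⟨_, ⟨A, rfl⟩, rfl⟩
        refine ⟨f ⟨a A, H.mapsTo 0 a ha _ A.2⟩, ⟨_, rfl⟩, ?_⟩
        exact hequiv a ha A ⟨a A, H.mapsTo 0 a ha _ A.2⟩ rfl)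
    rcases hran with hran | hran
    · rw [(Submodule.map_injective_of_injective (Submodule.injective_subtype _)).eq_iff' (Submodule.map_bot _)] at hran
      exact LinearMap.range_eq_bot.mp hran
    · exfalso
      have hs : Function.Surjective f := by
        intro B
        have : (B : L) ∈ (LinearMap.range f).map (m 1).subtype := by rw [hran]; exact B.2
        obtain ⟨_, ⟨A, rfl⟩, h⟩ := this
        exact ⟨A, Subtype.ext h⟩
      exact H.inequivalent ⟨LinearEquiv.ofBijective f ⟨LinearMap.ker_eq_bot.mp hinj, hs⟩, hequiv⟩
  · ext A
    have : (A : L) ∈ (LinearMap.ker f).map (m 0).subtype := by rw [hker]; exact A.2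
    obtain ⟨A', hA', h⟩ := this
    have h' : A' = A := Subtype.ext h
    rw [← h']
    simpa using hA'

/-- Orthogonality of the summands is not part of the data; it is Schur's lemma for `β` itself. -/
lemma orthogonal (H : IsFlagData β γ 𝔨 m S) {i j : Fin 2} (hij : i ≠ j) {A B : L}
    (hA : A ∈ m i) (hB : B ∈ m j) : β A B = 0 := by
  have h := fun {A B} => H.pairing_eq_zero (A := A) (B := B) β H.preserves
  fin_cases i <;> fin_cases j
  · exact absurd rfl hij
  · exact h hA hB
  · rw [H.symm]; exact h hB hA
  · exact absurd rfl hij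

lemma lie_skew_adjoint (H : IsFlagData β γ 𝔨 m S) (A B C : L) : β ⁅A, B⁆ C = -β B ⁅A, C⁆ := by
  rw [← lie_skew, map_neg, LinearMap.neg_apply, H.invariant]

/-- The form β(ad(γ)² A, B) is invariant because the isotropy group commutes with ad(γ), so Schur's
lemma kills it across the summands. -/
lemma orthogonal_sq (H : IsFlagData β γ 𝔨 m S) {i j : Fin 2} (hij : i ≠ j) {A B : L}
    (hA : A ∈ m i) (hB : B ∈ m j) : β ⁅γ, ⁅γ, A⁆⁆ B = 0 := by
  have h := fun {A B} => H.pairing_eq_zero (A := A) (B := B)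
    (β ∘ₗ (LieAlgebra.ad ℝ L γ ∘ₗ LieAlgebra.ad ℝ L γ : L →ₗ[ℝ] L)) (by
      intro a ha A B
      simp only [LinearMap.comp_apply, LieAlgebra.ad_apply]
      rw [← H.commutes a ha, ← H.commutes a ha, H.preserves a ha])
  simp only [LinearMap.comp_apply, LieAlgebra.ad_apply] at h
  fin_cases i <;> fin_cases j
  · exact absurd rfl hij
  · exact h hA hB
  · rw [H.lie_skew_adjoint, H.lie_skew_adjoint, neg_neg, H.symm]; exact h hB hA
  · exact absurd rfl hij

lemma le_sup (i : Fin 2) : m i ≤ m 0 ⊔ m 1 := by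
  fin_cases i
  · exact le_sup_left
  · exact le_sup_right

lemma orthogonal_k (H : IsFlagData β γ 𝔨 m S) {i : Fin 2} {A B : L} (hA : A ∈ m i) (hB : B ∈ 𝔨) :
    β A B = 0 :=
  (H.mem_m A).mp (le_sup i hA) B hB

/-- The image of ad(γ) is orthogonal to 𝔨, and the component in the other summand is orthogonal to
itself by `orthogonal_sq`. -/
lemma lie_gamma_gamma_mem (H : IsFlagData β γ 𝔨 m S) {i : Fin 2} {A : L} (hA : A ∈ m i) :
    ⁅γ, ⁅γ, A⁆⁆ ∈ m i := by
  have h1 : ⁅γ, ⁅γ, A⁆⁆ ∈ m 0 ⊔ m 1 := by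
    rw [H.mem_m]
    intro B hB
    rw [H.lie_skew_adjoint, (H.mem_k B).mp hB, map_zero, neg_zero]
  obtain ⟨A0, h0, A1, h1, he⟩ := Submodule.mem_sup.mp h1
  fin_cases i
  · have h2 := H.orthogonal_sq (i := 0) (j := 1) (by decide) hA h1
    rw [← he, map_add, LinearMap.add_apply, H.orthogonal (i := 0) (j := 1) (by decide) h0 h1,
      zero_add] at h2
    rw [← he, H.eq_zero h2, add_zero]
    exact h0
  · have h2 := H.orthogonal_sq (i := 1) (j := 0) (by decide) hA h0
    rw [← he, map_add, LinearMap.add_apply, H.orthogonal (i := 1) (j := 0) (by decide) h1 h0,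
      add_zero] at h2
    rw [← he, H.eq_zero h2, zero_add]
    exact h1

/-- On each irreducible summand the square of `ad γ` is a negative scalar. -/
lemma exists_eigenvalue (H : IsFlagData β γ 𝔨 m S) (i : Fin 2) :
    ∃ l : ℝ, 0 < l ∧ ∀ A ∈ m i, ⁅γ, ⁅γ, A⁆⁆ = -(l ^ 2 • A) := by
  have : Nontrivial (m i) := Submodule.nontrivial_iff_ne_bot.mpr (H.ne_bot i)
  set T : L →ₗ[ℝ] L := LieAlgebra.ad ℝ L γ ∘ₗ LieAlgebra.ad ℝ L γ with hT
  have hTa : ∀ A, T A = ⁅γ, ⁅γ, A⁆⁆ := fun A => rfl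
  obtain ⟨μ, A, hA, hμ⟩ := exists_eigenvector_of_symmetric (β.restrict (m i))
    (fun A B => H.symm A B) (fun A hA => H.pos A (by simpa using hA))
    (T.restrict fun A hA => H.lie_gamma_gamma_mem hA)
    (fun A B => by
      change β ⁅γ, ⁅γ, (A : L)⁆⁆ (B : L) = β (A : L) ⁅γ, ⁅γ, (B : L)⁆⁆
      rw [H.lie_skew_adjoint, H.lie_skew_adjoint, neg_neg])
  have hμ' : ⁅γ, ⁅γ, (A : L)⁆⁆ = μ • (A : L) := congrArg Subtype.val hμ
  have hA' : (A : L) ≠ 0 := by simpa using hA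
  -- Skewness gives μ β(A, A) = -β([γ, A], [γ, A]), and [γ, A] = 0 would put A in 𝔨, which is
  -- orthogonal to `m i`.
  have hneg : μ < 0 := by
    have h1 : β ⁅γ, ⁅γ, (A : L)⁆⁆ (A : L) = -β ⁅γ, (A : L)⁆ ⁅γ, (A : L)⁆ := H.lie_skew_adjoint _ _ _
    rw [hμ', map_smul, LinearMap.smul_apply, smul_eq_mul] at h1
    have h2 : ⁅γ, (A : L)⁆ ≠ 0 := by
      intro h
      exact hA' (H.eq_zero (H.orthogonal_k A.2 ((H.mem_k _).mpr h)))
    have h3 := H.pos _ h2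
    have h4 := H.pos _ hA'
    by_contra hc
    push Not at hc
    nlinarith [mul_nonneg hc h4.le]
  -- One real eigenvector suffices: its eigenspace is invariant and nonzero, hence the whole
  -- summand. Self-adjointness supplies the real eigenvalue that irreducibility over ℝ alone would
  -- not.
  have hall := H.irreducible i (m i ⊓ LinearMap.ker (T - μ • LinearMap.id)) inf_le_left (by
    rintro a ha B ⟨hB1, hB2⟩
    refine ⟨H.mapsTo i a ha B hB1, ?_⟩
    have h1 : ⁅γ, ⁅γ, B⁆⁆ - μ • B = 0 := hB2
    change ⁅γ, ⁅γ, a B⁆⁆ - μ • a B = 0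
    rw [← H.commutes a ha, ← H.commutes a ha, ← map_smul, ← map_sub, h1, map_zero])
  have hmem : (A : L) ∈ m i ⊓ LinearMap.ker (T - μ • LinearMap.id) :=
    ⟨A.2, by simp [hTa, hμ']⟩
  rcases hall with hall | hall
  · rw [hall] at hmem
    exact absurd hmem hA'
  · refine ⟨Real.sqrt (-μ), Real.sqrt_pos.mpr (by linarith), fun B hB => ?_⟩
    rw [← hall] at hB
    have h1 : ⁅γ, ⁅γ, B⁆⁆ - μ • B = 0 := hB.2
    rw [Real.sq_sqrt (by linarith), neg_smul, neg_neg]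
    exact sub_eq_zero.mp h1

lemma exists_decomposition (H : IsFlagData β γ 𝔨 m S) (A : L) :
    ∃ C ∈ 𝔨, ∃ A0 ∈ m 0, ∃ A1 ∈ m 1, A = C + (A0 + A1) := by
  have h1 : IsCompl 𝔨 (β.orthogonal 𝔨) :=
    LinearMap.BilinForm.isCompl_orthogonal_of_restrict_nondegenerate
      (fun A B h => by rw [H.symm]; exact h) (H.restrict_nondegenerate 𝔨)
  have h2 : A ∈ 𝔨 ⊔ β.orthogonal 𝔨 := by rw [h1.sup_eq_top]; trivial
  obtain ⟨C, hC, D, hD, hCD⟩ := Submodule.mem_sup.mp h2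
  have hD' : D ∈ m 0 ⊔ m 1 := by
    rw [H.mem_m]
    intro B hB
    rw [H.symm]
    exact hD B hB
  obtain ⟨A0, h0, A1, h1, he⟩ := Submodule.mem_sup.mp hD'
  exact ⟨C, hC, A0, h0, A1, h1, by rw [he, hCD]⟩

end IsFlagData

end Algebra

/-! ### The grading: parameters in ratio 1 : 2. -/

section Structure

variable {L : Type*} [LieRing L] [LieAlgebra ℝ L] [FiniteDimensional ℝ L]

namespace IsFlagData

variable {β : LinearMap.BilinForm ℝ L} {γ : L} {𝔨 : Submodule ℝ L}
    {m : Fin 2 → Submodule ℝ L} {S : Set (L →ₗ[ℝ] L)}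

lemma exists_decomposition' (H : IsFlagData β γ 𝔨 m S) {i j : Fin 2} (hij : i ≠ j) (A : L) :
    ∃ C ∈ 𝔨, ∃ A0 ∈ m i, ∃ A1 ∈ m j, A = C + (A0 + A1) := by
  obtain ⟨C, hC, A0, h0, A1, h1, he⟩ := H.exists_decomposition A
  fin_cases i <;> fin_cases j
  · exact absurd rfl hij
  · exact ⟨C, hC, A0, h0, A1, h1, he⟩
  · exact ⟨C, hC, A1, h1, A0, h0, by rw [he, add_comm A0]⟩
  · exact absurd rfl hij

/-- On the orthogonal pieces 𝔨, `m i`, `m j` the operator ad(γ)² has eigenvalues 0, -(l i)², -(l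
j)². Comparing components of an eigenvector kills those with the wrong eigenvalue; no eigenvalues
are assumed distinct here. -/
lemma eigen_decomposition (H : IsFlagData β γ 𝔨 m S) {i j : Fin 2} (hij : i ≠ j) {l : Fin 2 → ℝ}
    (hl : ∀ i, ∀ A ∈ m i, ⁅γ, ⁅γ, A⁆⁆ = -(l i ^ 2 • A)) {c : ℝ} {A : L}
    (hA : ⁅γ, ⁅γ, A⁆⁆ = -(c ^ 2 • A)) :
    ∃ C ∈ 𝔨, ∃ A0 ∈ m i, ∃ A1 ∈ m j, A = C + (A0 + A1) ∧ c ^ 2 • C = 0 ∧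
      (l i ^ 2 - c ^ 2) • A0 = 0 ∧ (l j ^ 2 - c ^ 2) • A1 = 0 := by
  obtain ⟨C, hC, A0, h0, A1, h1, he⟩ := H.exists_decomposition' hij A
  have e1 : c ^ 2 • C - ((l i ^ 2 - c ^ 2) • A0 + (l j ^ 2 - c ^ 2) • A1) = 0 := by
    rw [he] at hA
    simp only [lie_add, (H.mem_k C).mp hC, hl i A0 h0, hl j A1 h1, lie_zero] at hA
    have : c ^ 2 • C - ((l i ^ 2 - c ^ 2) • A0 + (l j ^ 2 - c ^ 2) • A1) =
      (0 + (-(l i ^ 2 • A0) + -(l j ^ 2 • A1))) - -(c ^ 2 • (C + (A0 + A1))) := by module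
    rw [this, hA, sub_self]
  have oC0 := H.orthogonal_k h0 hC
  have oC1 := H.orthogonal_k h1 hC
  have o01 := H.orthogonal hij h0 h1
  have oC0' := (H.symm C A0).trans oC0
  have oC1' := (H.symm C A1).trans oC1
  have o01' := (H.symm A1 A0).trans o01
  refine ⟨C, hC, A0, h0, A1, h1, he, ?_, ?_, ?_⟩
  · have := congrArg (fun x => β x (c ^ 2 • C)) e1
    apply H.eq_zero
    simpa [oC0, oC1] using this
  · have := congrArg (fun x => β x ((l i ^ 2 - c ^ 2) • A0)) e1
    apply H.eq_zero
    simpa [oC0', o01'] using this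
  · have := congrArg (fun x => β x ((l j ^ 2 - c ^ 2) • A1)) e1
    apply H.eq_zero
    simpa [oC1', o01] using this

lemma eigen_zero (H : IsFlagData β γ 𝔨 m S) {A : L} (hA : ⁅γ, ⁅γ, A⁆⁆ = 0) : A ∈ 𝔨 := by
  rw [H.mem_k]
  apply H.eq_zero
  rw [H.lie_skew_adjoint, hA, map_zero, neg_zero]

lemma eigen_ne (H : IsFlagData β γ 𝔨 m S) {i j : Fin 2} (hij : i ≠ j) {l : Fin 2 → ℝ}
    (hl : ∀ i, ∀ A ∈ m i, ⁅γ, ⁅γ, A⁆⁆ = -(l i ^ 2 • A)) {c : ℝ} {A : L}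
    (hA : ⁅γ, ⁅γ, A⁆⁆ = -(c ^ 2 • A)) (hc : c ≠ 0) (hj : l j ^ 2 ≠ c ^ 2) : A ∈ m i := by
  obtain ⟨C, hC, A0, h0, A1, h1, he, z, z0, z1⟩ := H.eigen_decomposition hij hl hA
  have hC0 : C = 0 := (smul_eq_zero.mp z).resolve_left (pow_ne_zero 2 hc)
  have hA1 : A1 = 0 := (smul_eq_zero.mp z1).resolve_left (sub_ne_zero.mpr hj)
  rw [he, hC0, hA1, zero_add, add_zero]
  exact h0

lemma eigen_ne_ne (H : IsFlagData β γ 𝔨 m S) {i j : Fin 2} (hij : i ≠ j) {l : Fin 2 → ℝ}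
    (hl : ∀ i, ∀ A ∈ m i, ⁅γ, ⁅γ, A⁆⁆ = -(l i ^ 2 • A)) {c : ℝ} {A : L}
    (hA : ⁅γ, ⁅γ, A⁆⁆ = -(c ^ 2 • A)) (hc : c ≠ 0) (hi : l i ^ 2 ≠ c ^ 2)
    (hj : l j ^ 2 ≠ c ^ 2) : A = 0 :=
  H.eq_zero (H.orthogonal hij (H.eigen_ne hij hl hA hc hj) (H.eigen_ne hij.symm hl hA hc hi))

/-- Over ℂ, [γ, A] + ipA and [γ, B] + iεqB are eigenvectors of ad(γ) for ip and iεq, so their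
bracket belongs to i(p + εq). The combination here is -ε times the real part of that bracket. -/
lemma lie_lie_gamma (γ A B : L) {p q : ℝ} (hA : ⁅γ, ⁅γ, A⁆⁆ = -(p ^ 2 • A))
    (hB : ⁅γ, ⁅γ, B⁆⁆ = -(q ^ 2 • B)) (ε : ℝ) (hε : ε ^ 2 = 1) :
    ⁅γ, ⁅γ, (p * q) • ⁅A, B⁆ - ε • ⁅⁅γ, A⁆, ⁅γ, B⁆⁆⁆⁆ =
      -((p + ε * q) ^ 2 • ((p * q) • ⁅A, B⁆ - ε • ⁅⁅γ, A⁆, ⁅γ, B⁆⁆)) := by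
  have d1 : ⁅γ, ⁅A, B⁆⁆ = ⁅⁅γ, A⁆, B⁆ + ⁅A, ⁅γ, B⁆⁆ := leibniz_lie _ _ _
  have d2 : ⁅γ, ⁅⁅γ, A⁆, B⁆⁆ = -(p ^ 2 • ⁅A, B⁆) + ⁅⁅γ, A⁆, ⁅γ, B⁆⁆ := by
    rw [leibniz_lie, hA, neg_lie, smul_lie]
  have d3 : ⁅γ, ⁅A, ⁅γ, B⁆⁆⁆ = ⁅⁅γ, A⁆, ⁅γ, B⁆⁆ + -(q ^ 2 • ⁅A, B⁆) := by
    rw [leibniz_lie, hB, lie_neg, lie_smul]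
  have d4 : ⁅γ, ⁅⁅γ, A⁆, ⁅γ, B⁆⁆⁆ = -(p ^ 2 • ⁅A, ⁅γ, B⁆⁆) + -(q ^ 2 • ⁅⁅γ, A⁆, B⁆) := by
    rw [leibniz_lie, hA, hB, neg_lie, smul_lie, lie_neg, lie_smul]
  simp only [lie_sub, lie_smul, lie_add, lie_neg, d1, d2, d3, d4]
  generalize ⁅A, B⁆ = U
  generalize ⁅⁅γ, A⁆, ⁅γ, B⁆⁆ = W
  match_scalars
  · linear_combination (p * q ^ 3) * hε
  · linear_combination (-(2 * p * q + q ^ 2 * ε)) * hε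

/-- The brackets of eigenvectors, split according to the eigenvalues of `ad γ` squared. -/
lemma exists_lie_eq (γ A B : L) {p q : ℝ} (hp : 0 < p) (hq : 0 < q)
    (hA : ⁅γ, ⁅γ, A⁆⁆ = -(p ^ 2 • A)) (hB : ⁅γ, ⁅γ, B⁆⁆ = -(q ^ 2 • B)) :
    ∃ U W : L, ⁅A, B⁆ = U + W ∧ ⁅γ, ⁅γ, U⁆⁆ = -((p + q) ^ 2 • U) ∧
      ⁅γ, ⁅γ, W⁆⁆ = -((p - q) ^ 2 • W) := by
  have h1 := lie_lie_gamma γ A B hA hB 1 (by norm_num)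
  have h2 := lie_lie_gamma γ A B hA hB (-1) (by norm_num)
  refine ⟨(2 * (p * q))⁻¹ • ((p * q) • ⁅A, B⁆ - (1 : ℝ) • ⁅⁅γ, A⁆, ⁅γ, B⁆⁆),
    (2 * (p * q))⁻¹ • ((p * q) • ⁅A, B⁆ - (-1 : ℝ) • ⁅⁅γ, A⁆, ⁅γ, B⁆⁆), ?_, ?_, ?_⟩
  · rw [← smul_add, eq_inv_smul_iff₀ (by positivity)]
    module
  · rw [lie_smul, lie_smul, h1, one_mul, smul_neg, smul_comm]
  · rw [lie_smul, lie_smul, h2, smul_neg, smul_comm]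
    congr 4
    ring

variable [LieAlgebra.IsSimple ℝ L]

/-- A summand commuting with the other one and with brackets in the isotropy algebra generates a
proper ideal, so it cannot exist in a simple Lie algebra. -/
lemma false_of_lie_eq_zero (H : IsFlagData β γ 𝔨 m S) {i j : Fin 2} (hij : i ≠ j)
    (h1 : ∀ A ∈ m i, ∀ B ∈ m j, ⁅A, B⁆ = 0) (h2 : ∀ A ∈ m i, ∀ B ∈ m i, ⁅A, B⁆ ∈ 𝔨) : False := by
  set D : Submodule ℝ L := Submodule.span ℝ {C | ∃ A ∈ m i, ∃ B ∈ m i, ⁅A, B⁆ = C} with hD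
  have hDk : D ≤ 𝔨 := by
    rw [hD, Submodule.span_le]
    rintro _ ⟨A, hA, B, hB, rfl⟩
    exact h2 A hA B hB
  have hDi : ∀ A ∈ m i, ∀ B ∈ m i, ⁅A, B⁆ ∈ D := fun A hA B hB =>
    Submodule.subset_span ⟨A, hA, B, hB, rfl⟩
  have hxD : ∀ X : L, (∀ A ∈ m i, ⁅X, A⁆ ∈ m i) → ∀ C ∈ D, ⁅X, C⁆ ∈ D := by
    intro X hX C hC
    induction hC using Submodule.span_induction with
    | mem C hC =>
      obtain ⟨A, hA, B, hB, rfl⟩ := hC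
      rw [leibniz_lie]
      exact D.add_mem (hDi _ (hX A hA) _ hB) (hDi _ hA _ (hX B hB))
    | zero => rw [lie_zero]; exact D.zero_mem
    | add x y _ _ hx hy => rw [lie_add]; exact D.add_mem hx hy
    | smul c x _ hx => rw [lie_smul]; exact D.smul_mem c hx
  -- m_i + [m_i, m_i] is stable under 𝔨 and m_i by the bracket relations, and under m_j because m_j
  -- commutes with m_i.
  let I : LieIdeal ℝ L :=
    { (m i ⊔ D) with
      lie_mem := by
        intro X C hC
        change C ∈ m i ⊔ D at hC
        change ⁅X, C⁆ ∈ m i ⊔ D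
        obtain ⟨A, hA, E, hE, rfl⟩ := Submodule.mem_sup.mp hC
        obtain ⟨Xk, hXk, X0, hX0, X1, hX1, rfl⟩ := H.exists_decomposition' hij X
        have hl : D ≤ m i ⊔ D := le_sup_right
        have hr : m i ≤ m i ⊔ D := le_sup_left
        simp only [add_lie, lie_add]
        refine Submodule.add_mem _ (Submodule.add_mem _ ?_ (Submodule.add_mem _ ?_ ?_))
          (Submodule.add_mem _ ?_ (Submodule.add_mem _ ?_ ?_))
        · exact hr (H.lie_mem i Xk hXk A hA)
        · exact hl (hDi _ hX0 _ hA)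
        · rw [← lie_skew, h1 A hA X1 hX1, neg_zero]; exact Submodule.zero_mem _
        · exact hl (hxD Xk (fun A hA => H.lie_mem i Xk hXk A hA) E hE)
        · rw [← lie_skew]
          exact hr ((m i).neg_mem (H.lie_mem i E (hDk hE) X0 hX0))
        · refine hl (hxD X1 (fun A hA => ?_) E hE)
          rw [← lie_skew, h1 A hA X1 hX1, neg_zero]; exact Submodule.zero_mem _ }
  have hI : ∀ C, C ∈ I ↔ C ∈ m i ⊔ D := fun C => Iff.rfl
  rcases LieAlgebra.IsSimple.eq_bot_or_eq_top (R := ℝ) I with hb | ht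
  · refine H.ne_bot i ((Submodule.eq_bot_iff _).mpr fun A hA => ?_)
    have : A ∈ I := (hI A).mpr (le_sup_left (a := m i) hA)
    rw [hb] at this
    simpa using this
  -- The ideal lies in m_i + 𝔨, which is orthogonal to the nonzero m_j, so it is not everything.
  · refine H.ne_bot j ((Submodule.eq_bot_iff _).mpr fun A hA => ?_)
    have : A ∈ I := by rw [ht]; trivial
    obtain ⟨B, hB, C, hC, h⟩ := Submodule.mem_sup.mp ((hI A).mp this)
    apply H.eq_zero
    have hAA : β A A = β B A + β C A := by rw [← LinearMap.add_apply, ← map_add, h]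
    rw [hAA, H.orthogonal hij hB hA, H.symm, H.orthogonal_k hA (hDk hC), add_zero]

/-- The structure of the Lie algebra of a generalized flag manifold with two summands. -/
theorem exists_grading (H : IsFlagData β γ 𝔨 m S) : ∃ i j : Fin 2, i ≠ j ∧
    (∃ c : ℝ, (∀ A ∈ m i, ⁅c • γ, ⁅c • γ, A⁆⁆ = -A) ∧
      (∀ A ∈ m j, ⁅c • γ, ⁅c • γ, A⁆⁆ = -((4 : ℝ) • A))) ∧
    (∀ A ∈ m i, ∀ B ∈ m j, ⁅A, B⁆ ∈ m i) ∧ (∀ A ∈ m i, ∀ B ∈ m i, ⁅A, B⁆ ∈ 𝔨 ⊔ m j) ∧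
    (∀ A ∈ m j, ∀ B ∈ m j, ⁅A, B⁆ ∈ 𝔨) := by
  choose l hl0 hl using H.exists_eigenvalue
  -- With equal parameters l, the sum 2l does not occur, so all brackets of the summands lie in 𝔨.
  -- Then [m_0, m_1] = 0, since β([A, B], [A, B]) pairs A with an element of [𝔨, m_1] ⊂ m_1.
  have hne : l 0 ≠ l 1 := by
    intro h01
    have hall : ∀ i, l i = l 0 := by intro i; fin_cases i; rfl; exact h01.symm
    have hk : ∀ i j, ∀ A ∈ m i, ∀ B ∈ m j, ⁅A, B⁆ ∈ 𝔨 := by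
      intro i j A hA B hB
      obtain ⟨U, W, e, hU, hW⟩ := exists_lie_eq γ A B (hl0 i) (hl0 j) (hl i A hA) (hl j B hB)
      have p0 := hl0 0
      have hUz : U = 0 := by
        rw [hall i, hall j] at hU
        refine H.eigen_ne_ne (i := 0) (j := 1) (by decide) hl hU (by linarith) ?_ ?_
        · nlinarith
        · rw [hall 1]; nlinarith
      rw [e, hUz, zero_add]
      apply H.eigen_zero
      rw [hW, hall i, hall j, sub_self]
      simp
    refine H.false_of_lie_eq_zero (i := 0) (j := 1) (by decide) ?_ (hk 0 0)
    intro A hA B hB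
    have hAB := hk 0 1 A hA B hB
    apply H.eq_zero
    rw [H.invariant, ← lie_skew, map_neg, H.orthogonal (i := 0) (j := 1) (by decide) hA
      (H.lie_mem 1 _ hAB B hB), neg_zero]
  obtain ⟨i, j, hij, hlt⟩ : ∃ i j : Fin 2, i ≠ j ∧ l i < l j := by
    rcases lt_or_gt_of_ne hne with h | h
    · exact ⟨0, 1, by decide, h⟩
    · exact ⟨1, 0, by decide, h⟩
  have pi := hl0 i
  have pj := hl0 j
  -- The sum l_i + l_j exceeds both parameters. The difference l_j - l_i is nonzero and less than
  -- l_j, and equals l_i only in the claimed case; likewise 2 l_i = l_j. Otherwise m_i generates a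
  -- proper ideal.
  have hlj : l j = 2 * l i := by
    by_contra hc
    refine H.false_of_lie_eq_zero hij ?_ ?_
    · intro A hA B hB
      obtain ⟨U, W, e, hU, hW⟩ := exists_lie_eq γ A B (hl0 i) (hl0 j) (hl i A hA) (hl j B hB)
      have hUz : U = 0 := H.eigen_ne_ne hij hl hU (by linarith) (by nlinarith) (by nlinarith)
      have hWz : W = 0 := by
        refine H.eigen_ne_ne hij hl hW (by linarith) ?_ (by nlinarith)
        intro h
        have : (2 * l i - l j) * l j = 0 := by linear_combination h
        rcases mul_eq_zero.mp this with h | h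
        · exact hc (by linarith)
        · linarith
      rw [e, hUz, hWz, add_zero]
    · intro A hA B hB
      obtain ⟨U, W, e, hU, hW⟩ := exists_lie_eq γ A B (hl0 i) (hl0 i) (hl i A hA) (hl i B hB)
      have hUz : U = 0 := by
        refine H.eigen_ne_ne hij hl hU (by linarith) (by nlinarith) ?_
        intro h
        have : (l j - 2 * l i) * (l j + 2 * l i) = 0 := by linear_combination h
        rcases mul_eq_zero.mp this with h | h
        · exact hc (by linarith)
        · linarith
      rw [e, hUz, zero_add]
      apply H.eigen_zero
      rw [hW, sub_self]
      simp
  -- Scaling γ by 1 / l_i makes the parameters 1 and 2. Of the sums 3, 2, 4 only 2 occurs (in m_j),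
  -- and the differences -1, 0, 0 belong to m_i, 𝔨, 𝔨.
  refine ⟨i, j, hij, ⟨(l i)⁻¹, ?_, ?_⟩, ?_, ?_, ?_⟩
  · intro A hA
    simp only [smul_lie, lie_smul, hl i A hA, smul_neg, smul_smul]
    rw [show (l i)⁻¹ * ((l i)⁻¹ * l i ^ 2) = 1 by field_simp, one_smul]
  · intro A hA
    simp only [smul_lie, lie_smul, hl j A hA, smul_neg, smul_smul]
    rw [hlj, show (l i)⁻¹ * ((l i)⁻¹ * (2 * l i) ^ 2) = 4 by field_simp; norm_num]
  · intro A hA B hB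
    obtain ⟨U, W, e, hU, hW⟩ := exists_lie_eq γ A B (hl0 i) (hl0 j) (hl i A hA) (hl j B hB)
    have hUz : U = 0 := H.eigen_ne_ne hij hl hU (by linarith) (by nlinarith) (by nlinarith)
    rw [e, hUz, zero_add]
    exact H.eigen_ne hij hl hW (by linarith) (by nlinarith)
  · intro A hA B hB
    obtain ⟨U, W, e, hU, hW⟩ := exists_lie_eq γ A B (hl0 i) (hl0 i) (hl i A hA) (hl i B hB)
    rw [e, add_comm]
    refine Submodule.add_mem_sup (H.eigen_zero ?_) ?_
    · rw [hW, sub_self]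
      simp
    · exact H.eigen_ne hij.symm hl hU (by linarith) (by nlinarith)
  · intro A hA B hB
    obtain ⟨U, W, e, hU, hW⟩ := exists_lie_eq γ A B (hl0 j) (hl0 j) (hl j A hA) (hl j B hB)
    have hUz : U = 0 := H.eigen_ne_ne hij hl hU (by linarith) (by nlinarith) (by nlinarith)
    rw [e, hUz, zero_add]
    apply H.eigen_zero
    rw [hW, sub_self]
    simp

end IsFlagData

end Structure

/-! ### The numbers [ijk] and the algebraic scalar curvature formula. -/

section Triples

variable {L : Type*} [LieRing L] [LieAlgebra ℝ L] [FiniteDimensional ℝ L]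

/-- The numbers `[ijk]` for an invariant form `β`. -/
def tripleForm (β : LinearMap.BilinForm ℝ L) {m : Fin 2 → Submodule ℝ L}
    (b : ∀ i, Module.Basis (Fin (Module.finrank ℝ (m i))) ℝ (m i)) (i j k : Fin 2) : ℝ :=
  ∑ α, ∑ α', ∑ α'', (β ⁅(b i α : L), (b j α' : L)⁆ (b k α'')) ^ 2

lemma coe_eq_sum_repr {ι : Type*} [Fintype ι] {W : Submodule ℝ L} (b : Module.Basis ι ℝ W) {A : L}
    (hA : A ∈ W) : A = ∑ a, b.repr ⟨A, hA⟩ a • (b a : L) := by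
  have := congrArg W.subtype (b.sum_repr ⟨A, hA⟩)
  rw [map_sum] at this
  simpa only [map_smul, Submodule.subtype_apply] using this.symm

/-- The trace of an operator in an orthonormal basis. -/
lemma trace_eq_sum_form {ι : Type*} [Fintype ι] [DecidableEq ι] {W : Type*} [AddCommGroup W]
    [Module ℝ W] [FiniteDimensional ℝ W] (β : LinearMap.BilinForm ℝ W)
    (h0 : ∀ A, β A A = 0 → A = 0) (Z : ι → W)
    (hZ : ∀ a b, β (Z a) (Z b) = if a = b then 1 else 0)
    (hp : ∀ A B, β A B = ∑ a, β A (Z a) * β B (Z a)) (T : W →ₗ[ℝ] W) :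
    LinearMap.trace ℝ W T = ∑ a, β (T (Z a)) (Z a) := by
  have hsum : ∀ A, A = ∑ a, β A (Z a) • Z a := by
    intro A
    rw [← sub_eq_zero]
    apply h0
    have h1 : ∀ b, β (A - ∑ a, β A (Z a) • Z a) (Z b) = 0 := by
      intro b
      simp [hZ]
    rw [hp]
    exact Finset.sum_eq_zero fun b _ => by rw [h1, zero_mul]
  have hli : LinearIndependent ℝ Z := by
    rw [Fintype.linearIndependent_iff]
    intro g hg b
    have := congrArg (fun A => β A (Z b)) hg
    simpa [hZ] using this
  have hsp : ⊤ ≤ Submodule.span ℝ (Set.range Z) := by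
    intro A _
    rw [hsum A]
    exact Submodule.sum_mem _ fun a _ => Submodule.smul_mem _ _ (Submodule.subset_span ⟨a, rfl⟩)
  set e := Module.Basis.mk hli hsp with he
  have hrepr : ∀ A a, e.repr A a = β A (Z a) := by
    intro A a
    conv_rhs => rw [← e.sum_repr A]
    simp [he, hZ]
  rw [LinearMap.trace_eq_matrix_trace ℝ e, Matrix.trace]
  simp only [Matrix.diag_apply, LinearMap.toMatrix_apply, hrepr]
  simp [he]

namespace IsFlagData

variable {β : LinearMap.BilinForm ℝ L} {γ : L} {𝔨 : Submodule ℝ L}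
    {m : Fin 2 → Submodule ℝ L} {S : Set (L →ₗ[ℝ] L)}
    {b : ∀ i, Module.Basis (Fin (Module.finrank ℝ (m i))) ℝ (m i)}

lemma tripleForm_swap_left (_H : IsFlagData β γ 𝔨 m S) (i j k : Fin 2) :
    tripleForm β b i j k = tripleForm β b j i k := by
  unfold tripleForm
  rw [Finset.sum_comm]
  refine Finset.sum_congr rfl fun a _ => Finset.sum_congr rfl fun a' _ =>
    Finset.sum_congr rfl fun a'' _ => ?_
  rw [← lie_skew, map_neg, LinearMap.neg_apply, neg_sq]

lemma tripleForm_swap_right (H : IsFlagData β γ 𝔨 m S) (i j k : Fin 2) :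
    tripleForm β b i j k = tripleForm β b i k j := by
  unfold tripleForm
  refine Finset.sum_congr rfl fun a _ => ?_
  rw [Finset.sum_comm]
  refine Finset.sum_congr rfl fun a' _ =>
    Finset.sum_congr rfl fun a'' _ => ?_
  rw [H.lie_skew_adjoint, neg_sq, H.symm]

lemma tripleForm_eq_zero {i j k : Fin 2}
    (h : ∀ A ∈ m i, ∀ B ∈ m j, ∀ C ∈ m k, β ⁅A, B⁆ C = 0) : tripleForm β b i j k = 0 := by
  unfold tripleForm
  refine Finset.sum_eq_zero fun a _ => Finset.sum_eq_zero fun a' _ =>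
    Finset.sum_eq_zero fun a'' _ => ?_
  rw [h _ (b i a).2 _ (b j a').2 _ (b k a'').2, sq, mul_zero]

/-- A vanishing sum of squares kills every structure constant; trilinearity passes from the bases to
the whole summands. -/
lemma eq_zero_of_tripleForm_eq_zero {i j k : Fin 2} (h : tripleForm β b i j k = 0) :
    ∀ A ∈ m i, ∀ B ∈ m j, ∀ C ∈ m k, β ⁅A, B⁆ C = 0 := by
  have h1 : ∀ α α' α'', β ⁅(b i α : L), (b j α' : L)⁆ (b k α'') = 0 := by
    intro α α' α''
    unfold tripleForm at h
    rw [Finset.sum_eq_zero_iff_of_nonneg fun _ _ => Finset.sum_nonneg fun _ _ =>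
      Finset.sum_nonneg fun _ _ => sq_nonneg _] at h
    have h2 := h α (Finset.mem_univ _)
    rw [Finset.sum_eq_zero_iff_of_nonneg fun _ _ => Finset.sum_nonneg fun _ _ => sq_nonneg _] at h2
    have h3 := h2 α' (Finset.mem_univ _)
    rw [Finset.sum_eq_zero_iff_of_nonneg fun _ _ => sq_nonneg _] at h3
    exact pow_eq_zero_iff (two_ne_zero) |>.mp (h3 α'' (Finset.mem_univ _))
  intro A hA B hB C hC
  rw [coe_eq_sum_repr (b i) hA, coe_eq_sum_repr (b j) hB, coe_eq_sum_repr (b k) hC]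
  simp only [sum_lie, lie_sum, smul_lie, lie_smul, map_sum,
    map_smul, LinearMap.sum_apply, LinearMap.smul_apply, h1, smul_zero, Finset.sum_const_zero]

/-- Orthonormal bases of the summands and of the isotropy algebra. -/
lemma exists_isReductiveBasis (H : IsFlagData β γ 𝔨 m S)
    (hβ : ∀ A B, β A B = -killingForm ℝ L A B)
    (hb : ∀ i α α', β (b i α) (b i α') = if α = α' then 1 else 0) :
    ∃ Y : Fin (Module.finrank ℝ 𝔨) → L, IsReductiveBasis β
      (fun a : (i : Fin 2) × Fin (Module.finrank ℝ (m i)) => (b a.1 a.2 : L)) Y ∧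
      (∀ r, Y r ∈ 𝔨) := by
  obtain ⟨e, he⟩ := exists_orthonormal_basis (β.restrict 𝔨) (fun A B => H.symm A B)
    (fun A hA => H.pos A (by simpa using hA))
  have he' : ∀ r s, β (e r : L) (e s : L) = if r = s then 1 else 0 := he
  set X := fun a : (i : Fin 2) × Fin (Module.finrank ℝ (m i)) => (b a.1 a.2 : L) with hX
  have hXo : ∀ a a', β (X a) (X a') = if a = a' then 1 else 0 := by
    rintro ⟨i, α⟩ ⟨j, α'⟩
    by_cases hij : i = j
    · subst hij
      simp [hX, hb]
    · rw [if_neg (fun h => hij (congrArg Sigma.fst h))]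
      exact H.orthogonal hij (b i α).2 (b j α').2
  have hXk : ∀ a, ∀ C ∈ 𝔨, β (X a) C = 0 := fun a C hC => H.orthogonal_k (b a.1 a.2).2 hC
  have hsumk : ∀ C (hC : C ∈ 𝔨), ∃ g : Fin (Module.finrank ℝ 𝔨) → ℝ, C = ∑ r, g r • (e r : L) := by
    intro C hC
    exact ⟨fun r => e.repr ⟨C, hC⟩ r, coe_eq_sum_repr e hC⟩
  have hsumm : ∀ (i : Fin 2) (A : L) (hA : A ∈ m i), ∃ g : Fin (Module.finrank ℝ (m i)) → ℝ,
      A = ∑ a, g a • (b i a : L) := by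
    intro i A hA
    exact ⟨fun r => (b i).repr ⟨A, hA⟩ r, coe_eq_sum_repr (b i) hA⟩
  have hsum : ∀ A, ∃ (g : _ → ℝ) (g' : _ → ℝ), A = ∑ a, g a • X a + ∑ r, g' r • (e r : L) := by
    intro A
    obtain ⟨C, hC, A0, h0, A1, h1, rfl⟩ := H.exists_decomposition A
    obtain ⟨g', hg'⟩ := hsumk C hC
    obtain ⟨g0, hg0⟩ := hsumm 0 A0 h0
    obtain ⟨g1, hg1⟩ := hsumm 1 A1 h1
    refine ⟨fun a => match a with | ⟨0, α⟩ => g0 α | ⟨1, α⟩ => g1 α, g', ?_⟩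
    rw [Fintype.sum_sigma, Fin.sum_univ_two, hg', hg0, hg1, add_comm]
  have hkX : ∀ r a, β (e r : L) (X a) = 0 := fun r a => by rw [H.symm]; exact hXk a _ (e r).2
  have hpars : ∀ A B, β A B = ∑ a, β A (X a) * β B (X a)
      + ∑ r, β A (e r : L) * β B (e r : L) := by
    intro A B
    obtain ⟨g, g', hA⟩ := hsum A
    have c1 : ∀ a, β A (X a) = g a := by
      intro a
      rw [hA]
      simp [hXo, hkX]
    have c2 : ∀ r, β A (e r : L) = g' r := by
      intro r
      rw [hA]
      simp [he', hXk _ _ (e r).2]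
    simp only [c1, c2]
    conv_lhs => rw [hA]
    simp [H.symm B]
  refine ⟨fun r => (e r : L), ⟨H.symm, H.invariant, hpars, hXo, ?_, ?_⟩, fun r => (e r).2⟩
  · intro r s a
    have hrs : ⁅(e r : L), (e s : L)⁆ ∈ 𝔨 := by
      rw [H.mem_k, leibniz_lie, (H.mem_k _).mp (e r).2, (H.mem_k _).mp (e s).2, zero_lie, lie_zero,
        add_zero]
    rw [H.symm]
    exact hXk a _ hrs
  · intro a
    -- The normalization: 1 = β(X_a, X_a) is minus the trace of ad(X_a)², expanded in the joint
    -- orthonormal basis.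
    have h1 := hβ (X a) (X a)
    rw [hXo, if_pos rfl, killingForm, LieModule.traceForm_apply_apply,
      trace_eq_sum_form β (fun A h => H.eq_zero h) (Sum.elim X fun r => (e r : L)) ?_ ?_] at h1
    · rw [Fintype.sum_sum_type] at h1
      simp only [Sum.elim_inl, Sum.elim_inr, LinearMap.comp_apply, LieModule.toEnd_apply_apply,
        H.lie_skew_adjoint (X a) ⁅_, _⁆] at h1
      rw [h1]
      simp only [Finset.sum_neg_distrib]
      ring
    · rintro (a | r) (a' | r')
      · simpa using hXo a a'
      · simpa using hXk a _ (e r').2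
      · simpa using hkX r a'
      · simpa using he' r r'
    · intro A B
      rw [Fintype.sum_sum_type]
      exact hpars A B

/-- If [iij] vanished, then [m_i, m_j] ⊂ m_i would be orthogonal to m_i and [m_i, m_i] would have no
m_j-part, so m_i would generate a proper ideal. Full symmetry in the indices gives the rest from the
bracket relations. -/
lemma tripleForm_values [LieAlgebra.IsSimple ℝ L] (H : IsFlagData β γ 𝔨 m S) {i j : Fin 2}
    (hij : i ≠ j)
    (h1 : ∀ A ∈ m i, ∀ B ∈ m j, ⁅A, B⁆ ∈ m i) (h2 : ∀ A ∈ m i, ∀ B ∈ m i, ⁅A, B⁆ ∈ 𝔨 ⊔ m j)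
    (h3 : ∀ A ∈ m j, ∀ B ∈ m j, ⁅A, B⁆ ∈ 𝔨) :
    tripleForm β b i i j ≠ 0 ∧
    tripleForm β b i j i = tripleForm β b i i j ∧ tripleForm β b j i i = tripleForm β b i i j ∧
    tripleForm β b i i i = 0 ∧ tripleForm β b j j j = 0 ∧
    tripleForm β b j j i = 0 ∧ tripleForm β b j i j = 0 ∧ tripleForm β b i j j = 0 := by
  have z1 : tripleForm β b j j i = 0 := tripleForm_eq_zero fun A hA B hB C hC => by
    rw [H.symm, H.orthogonal_k hC (h3 A hA B hB)]
  have z2 : tripleForm β b j j j = 0 := tripleForm_eq_zero fun A hA B hB C hC => by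
    rw [H.symm, H.orthogonal_k hC (h3 A hA B hB)]
  have z3 : tripleForm β b i i i = 0 := tripleForm_eq_zero fun A hA B hB C hC => by
    obtain ⟨U, hU, W, hW, he⟩ := Submodule.mem_sup.mp (h2 A hA B hB)
    rw [← he, map_add, LinearMap.add_apply, H.symm, H.orthogonal_k hC hU,
      H.orthogonal hij.symm hW hC, add_zero]
  refine ⟨fun h0 => ?_, H.tripleForm_swap_right i j i, ?_, z3, z2, z1, ?_, ?_⟩
  · have h4 := eq_zero_of_tripleForm_eq_zero h0
    refine H.false_of_lie_eq_zero hij ?_ ?_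
    · intro A hA B hB
      apply H.eq_zero
      rw [H.lie_skew_adjoint, H.symm, h4 A hA _ (h1 A hA B hB) B hB, neg_zero]
    · intro A hA B hB
      obtain ⟨U, hU, W, hW, he⟩ := Submodule.mem_sup.mp (h2 A hA B hB)
      have h5 := h4 A hA B hB W hW
      rw [← he, map_add, LinearMap.add_apply, H.symm, H.orthogonal_k hW hU, zero_add] at h5
      rw [← he, H.eq_zero h5, add_zero]
      exact hU
  · rw [H.tripleForm_swap_left j i i, H.tripleForm_swap_right i j i]
  · rw [H.tripleForm_swap_right, z1]
  · rw [H.tripleForm_swap_left, H.tripleForm_swap_right, z1]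

end IsFlagData

lemma sum_sigma_tripleForm (β : LinearMap.BilinForm ℝ L) {m : Fin 2 → Submodule ℝ L}
    (b : ∀ i, Module.Basis (Fin (Module.finrank ℝ (m i))) ℝ (m i)) (x : Fin 2 → ℝ) :
    ∑ a : (i : Fin 2) × Fin (Module.finrank ℝ (m i)),
      ∑ a' : (i : Fin 2) × Fin (Module.finrank ℝ (m i)),
      ∑ a'' : (i : Fin 2) × Fin (Module.finrank ℝ (m i)),
      β ⁅(b a.1 a.2 : L), (b a'.1 a'.2 : L)⁆ (b a''.1 a''.2 : L) ^ 2 *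
        (x a''.1 * (x a.1)⁻¹ * (x a'.1)⁻¹) =
    ∑ i, ∑ j, ∑ k, tripleForm β b i j k * (x k * (x i)⁻¹ * (x j)⁻¹) := by
  simp only [Fintype.sum_sigma, tripleForm, Finset.sum_mul]
  refine Finset.sum_congr rfl fun i _ => ?_
  rw [Finset.sum_comm]
  refine Finset.sum_congr rfl fun j _ => ?_
  symm
  rw [Finset.sum_comm]
  refine Finset.sum_congr rfl fun α _ => ?_
  rw [Finset.sum_comm]

/-- The scalar curvature, at a point, of a diagonal metric on a flag manifold with two isotropy
summands. -/
theorem IsFlagData.scalar_eq {β : LinearMap.BilinForm ℝ L} {γ : L} {𝔨 : Submodule ℝ L}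
    {m : Fin 2 → Submodule ℝ L} {S : Set (L →ₗ[ℝ] L)}
    {b : ∀ i, Module.Basis (Fin (Module.finrank ℝ (m i))) ℝ (m i)} [LieAlgebra.IsSimple ℝ L]
    (H : IsFlagData β γ 𝔨 m S) (hβ : ∀ A B, β A B = -killingForm ℝ L A B)
    (hb : ∀ i α α', β (b i α) (b i α') = if α = α' then 1 else 0) {i j : Fin 2} (hij : i ≠ j)
    (h1 : ∀ A ∈ m i, ∀ B ∈ m j, ⁅A, B⁆ ∈ m i) (h2 : ∀ A ∈ m i, ∀ B ∈ m i, ⁅A, B⁆ ∈ 𝔨 ⊔ m j)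
    (h3 : ∀ A ∈ m j, ∀ B ∈ m j, ⁅A, B⁆ ∈ 𝔨)
    {d : ℕ} {h : EuclideanSpace ℝ (Fin d) →
      EuclideanSpace ℝ (Fin d) →L[ℝ] EuclideanSpace ℝ (Fin d) →L[ℝ] ℝ}
    {V : L → EuclideanSpace ℝ (Fin d) → EuclideanSpace ℝ (Fin d)} {y : EuclideanSpace ℝ (Fin d)}
    (K : IsKillingFamily h V y) (hadd : ∀ A B, V (A + B) y = V A y + V B y)
    (hsmul : ∀ (c : ℝ) A, V (c • A) y = c • V A y) (hsurj : ∀ v, ∃ A, V A y = v)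
    (hk : ∀ C ∈ 𝔨, V C y = 0) {x₁ x₂ : ℝ} (hx₁ : 0 < x₁) (hx₂ : 0 < x₂)
    (hQ : ∀ A ∈ m i, ∀ A' ∈ m i, ∀ B ∈ m j, ∀ B' ∈ m j,
      h y (V (A + B) y) (V (A' + B') y) = x₁ * β A A' + x₂ * β B B') :
    scalar h y = 1 / 2 * (Module.finrank ℝ (m i) / x₁ + Module.finrank ℝ (m j) / x₂) -
      1 / 4 * (tripleForm β b i i j * x₂ / x₁ ^ 2 + 2 * tripleForm β b i i j / x₂) := by
  obtain ⟨Y, R, hY⟩ := H.exists_isReductiveBasis hβ hb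
  set X := fun a : (i : Fin 2) × Fin (Module.finrank ℝ (m i)) => (b a.1 a.2 : L) with hX
  set x : Fin 2 → ℝ := fun k => if k = i then x₁ else x₂ with hx
  have hxi : x i = x₁ := by simp [hx]
  have hxj : x j = x₂ := by simp [hx, hij.symm]
  have hx0 : ∀ k, 0 < x k := by
    intro k
    simp only [hx]
    split_ifs <;> assumption
  have hsum2 : ∀ F : Fin 2 → ℝ, ∑ k, F k = F i + F j := by
    intro F
    rw [Fin.sum_univ_two]
    fin_cases i <;> fin_cases j
    · exact absurd rfl hij
    · rfl
    · exact add_comm _ _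
    · exact absurd rfl hij
  have hQ' : ∀ A B, fieldInner h V A B y =
      ∑ a : (i : Fin 2) × Fin (Module.finrank ℝ (m i)), x a.1 * (β A (X a) * β B (X a)) := by
    intro A B
    obtain ⟨C, hC, A0, hA0, A1, hA1, rfl⟩ := H.exists_decomposition' hij A
    obtain ⟨D, hD, B0, hB0, B1, hB1, rfl⟩ := H.exists_decomposition' hij B
    unfold fieldInner
    rw [hadd C, hadd D, hk C hC, hk D hD, zero_add, zero_add, hQ A0 hA0 B0 hB0 A1 hA1 B1 hB1]
    rw [R.parseval A0 B0, R.parseval A1 B1]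
    have k0 : ∀ {k : Fin 2} {A : L}, A ∈ m k → ∀ r, β A (Y r) = 0 :=
      fun hA r => H.orthogonal_k hA (hY r)
    have kC : ∀ {C : L}, C ∈ 𝔨 → ∀ a, β C (X a) = 0 :=
      fun hC a => by rw [H.symm]; exact H.orthogonal_k (b a.1 a.2).2 hC
    simp only [k0 hA0, k0 hA1, map_add, LinearMap.add_apply, kC hC, kC hD, zero_add, zero_mul,
      Finset.sum_const_zero, add_zero]
    simp only [Fintype.sum_sigma, hsum2, hxi, hxj]
    have o1 : ∀ {A : L}, A ∈ m i → ∀ α, β A (X ⟨j, α⟩) = 0 :=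
      fun hA α => H.orthogonal hij hA (b j α).2
    have o2 : ∀ {A : L}, A ∈ m j → ∀ α, β A (X ⟨i, α⟩) = 0 :=
      fun hA α => H.orthogonal hij.symm hA (b i α).2
    simp only [o1 hA0, o1 hB0, o2 hA1, o2 hB1, zero_mul, Finset.sum_const_zero, add_zero, zero_add,
      Finset.mul_sum]
  have hw : ∀ a : (i : Fin 2) × Fin (Module.finrank ℝ (m i)), x a.1 ≠ 0 := fun a => (hx0 _).ne'
  set Vl : L →ₗ[ℝ] EuclideanSpace ℝ (Fin d) :=
    { toFun := fun A => V A y, map_add' := hadd, map_smul' := hsmul } with hVl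
  have hf : ∀ a a', h y (Vl (X a)) (Vl (X a')) = if a = a' then x a.1 else 0 := by
    intro a a'
    refine (hQ' (X a) (X a')).trans ?_
    simp only [R.orthonormal]
    by_cases haa : a = a'
    · subst haa
      simp
    · simp [haa]
  have hli : LinearIndependent ℝ (fun a => Vl (X a)) := by
    rw [Fintype.linearIndependent_iff]
    intro g hg a
    have h0 := congrArg (fun v => h y v (Vl (X a))) hg
    simp only [map_sum, map_smul, sum_apply, smul_apply, hf, map_zero, zero_apply] at h0
    simpa [(hx0 a.1).ne'] using h0
  have hsp : ⊤ ≤ Submodule.span ℝ (Set.range fun a => Vl (X a)) := by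
    intro v _
    obtain ⟨A, rfl⟩ := hsurj v
    obtain ⟨C, hC, A0, hA0, A1, hA1, rfl⟩ := H.exists_decomposition' hij A
    rw [hadd, hk C hC, zero_add, hadd]
    have : ∀ k, ∀ A ∈ m k, V A y ∈ Submodule.span ℝ (Set.range fun a => Vl (X a)) := by
      intro k A hA
      have h2 : Vl A = ∑ a, (b k).repr ⟨A, hA⟩ a • Vl (X ⟨k, a⟩) := by
        conv_lhs => rw [coe_eq_sum_repr (b k) hA]
        simp [hX]
      change Vl A ∈ _
      rw [h2]
      exact Submodule.sum_mem _ fun a _ => Submodule.smul_mem _ _ (Submodule.subset_span ⟨_, rfl⟩)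
    exact Submodule.add_mem _ (this i A0 hA0) (this j A1 hA1)
  have hmain := R.scalar_eq K hw hQ' (Module.Basis.mk hli hsp) (fun a => by simp [hVl])
  obtain ⟨-, t1, t2, t3, t4, t5, t6, t7⟩ := H.tripleForm_values (b := b) hij h1 h2 h3
  rw [hmain, sum_sigma_tripleForm β b x]
  -- Only the arrangements of (i, i, j) survive: (i, i, j) contributes t x₂ / x₁², and each of (i,
  -- j, i) and (j, i, i) contributes t / x₂.
  simp only [Fintype.sum_sigma, hsum2, hxi, hxj, t1, t2, t3, t4, t5, t6, t7, Finset.sum_const,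
    Finset.card_univ, Fintype.card_fin, nsmul_eq_mul]
  field_simp
  ring

end Triples

/-! ### Smooth local actions on normed spaces and their fundamental fields. -/

section LocalAction

variable {E F : Type*} [NormedAddCommGroup E] [NormedSpace ℝ E]
  [NormedAddCommGroup F] [NormedSpace ℝ F]

/-- The fundamental vector fields of a local action in coordinates. -/
def fundamentalField (α : E × F → F) (e X : E) (y : F) : F := fderiv ℝ α (e, y) (X, 0)

/-- The mixed second derivative of a multiplication at the identity. -/
def mixedDeriv (μ : E × E → E) (e X Y : E) : E := fderiv ℝ (fderiv ℝ μ) (e, e) (X, 0) (0, Y)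

/-- A smooth local action, in coordinates near `(e, y)`, of a group with multiplication `μ`. -/
structure IsLocalAction (μ : E × E → E) (α : E × F → F) (e : E) (y : F) : Prop where
  smooth_mul : ContDiffAt ℝ 3 μ (e, e)
  smooth : ContDiffAt ℝ 3 α (e, y)
  mul_one : ∀ᶠ x in 𝓝 e, μ (x, e) = x
  one_mul : ∀ᶠ x in 𝓝 e, μ (e, x) = x
  one_smul : ∀ᶠ z in 𝓝 y, α (e, z) = z
  mul_smul : ∀ᶠ z in 𝓝 (e, e, y), α (μ (z.1, z.2.1), z.2.2) = α (z.1, α (z.2.1, z.2.2))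

namespace IsLocalAction

variable {μ : E × E → E} {α : E × F → F} {e : E} {y : F}

lemma eventually (H : IsLocalAction μ α e y) : ∀ᶠ z in 𝓝 y, IsLocalAction μ α e z := by
  have h1 : ∀ᶠ z in 𝓝 y, ContDiffAt ℝ 3 α (e, z) := by
    have := H.smooth.eventually (by simp)
    exact (Continuous.prodMk_right e).continuousAt.eventually this
  have h2 : ∀ᶠ z in 𝓝 y, ∀ᶠ w in 𝓝 (e, e, z),
      α (μ (w.1, w.2.1), w.2.2) = α (w.1, α (w.2.1, w.2.2)) := by
    have h3 := H.mul_smul.eventually_nhds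
    have h4 : ContinuousAt (fun z : F => (e, e, z)) y := by fun_prop
    exact h4.eventually h3
  filter_upwards [h1, h2, H.one_smul.eventually_nhds] with z a b c
  exact ⟨H.smooth_mul, a, H.mul_one, H.one_mul, c, b⟩

lemma contDiffAt_fundamentalField (H : IsLocalAction μ α e y) (X : E) :
    ContDiffAt ℝ 2 (fundamentalField α e X) y := by
  have h1 : ContDiffAt ℝ 2 (fderiv ℝ α) (e, y) := H.smooth.fderiv_right (by norm_num)
  have h2 : ContDiffAt ℝ 2 (fun z : F => (e, z)) y := by fun_prop
  exact (h1.comp y h2).clm_apply contDiffAt_const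

lemma fderiv_one_smul (H : IsLocalAction μ α e y) (u : F) : fderiv ℝ α (e, y) (0, u) = u := by
  have h1 := (H.smooth.differentiableAt (by norm_num)).hasFDerivAt.comp y
    (hasFDerivAt_prodMk_right e y)
  have h2 : HasFDerivAt (α ∘ fun z => (e, z)) (ContinuousLinearMap.id ℝ F) y :=
    (hasFDerivAt_id y).congr_of_eventuallyEq H.one_smul
  have := congrArg (fun L => L u) (h1.unique h2)
  simpa using this

lemma fderiv_mul_one (H : IsLocalAction μ α e y) (u : E) : fderiv ℝ μ (e, e) (u, 0) = u := by
  have h1 := (H.smooth_mul.differentiableAt (by norm_num)).hasFDerivAt.comp (f := fun x : E => (x, e)) e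
    (hasFDerivAt_prodMk_left e e)
  have h2 : HasFDerivAt (μ ∘ fun z => (z, e)) (ContinuousLinearMap.id ℝ E) e :=
    (hasFDerivAt_id e).congr_of_eventuallyEq H.mul_one
  have := congrArg (fun L => L u) (h1.unique h2)
  simpa using this

lemma fderiv_one_mul (H : IsLocalAction μ α e y) (u : E) : fderiv ℝ μ (e, e) (0, u) = u := by
  have h1 := (H.smooth_mul.differentiableAt (by norm_num)).hasFDerivAt.comp e
    (hasFDerivAt_prodMk_right e e)
  have h2 : HasFDerivAt (μ ∘ fun z => (e, z)) (ContinuousLinearMap.id ℝ E) e :=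
    (hasFDerivAt_id e).congr_of_eventuallyEq H.one_mul
  have := congrArg (fun L => L u) (h1.unique h2)
  simpa using this

lemma differentiableAt_fderiv (H : IsLocalAction μ α e y) :
    DifferentiableAt ℝ (fderiv ℝ α) (e, y) :=
  (H.smooth.fderiv_right (m := 2) (by norm_num)).differentiableAt (by norm_num)

lemma isSymmSndFDerivAt (H : IsLocalAction μ α e y) : IsSymmSndFDerivAt ℝ α (e, y) :=
  H.smooth.isSymmSndFDerivAt (by rw [minSmoothness_of_isRCLikeNormedField]; norm_num)

/-- The derivative of a fundamental field. -/
lemma fderiv_fundamentalField (H : IsLocalAction μ α e y) (X : E) (u : F) :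
    fderiv ℝ (fundamentalField α e X) y u = fderiv ℝ (fderiv ℝ α) (e, y) (0, u) (X, 0) := by
  have h1 := (H.differentiableAt_fderiv.hasFDerivAt.comp y
    (hasFDerivAt_prodMk_right e y)).clm_apply (hasFDerivAt_const ((X, 0) : E × F) y)
  have := h1.fderiv
  unfold fundamentalField
  have e1 : (fun y => fderiv ℝ α (e, y) (X, 0)) =
    fun y => ((fderiv ℝ α ∘ fun y => (e, y)) y) (X, 0) := rfl
  rw [e1, this]
  simp

/-- The derivative of the identity `(x k) y = x (k y)` with respect to `k`. -/
lemma eventually_fderiv_mul_smul (H : IsLocalAction μ α e y) (X : E) :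
    ∀ᶠ x in 𝓝 e, fderiv ℝ α (x, y) (fderiv ℝ μ (x, e) (0, X), 0) =
      fderiv ℝ α (x, y) (0, fundamentalField α e X y) := by
  have c1 : ContinuousAt (fun x : E => (x, y)) e := by fun_prop
  have c2 : ContinuousAt (fun x : E => (x, e)) e := by fun_prop
  have c3 : ContinuousAt (fun x : E => (x, e, y)) e := by fun_prop
  filter_upwards [c1.eventually (H.smooth.eventually (by simp)),
    c2.eventually (H.smooth_mul.eventually (by simp)), H.mul_one,
    c3.eventually H.mul_smul.eventually_nhds] with x h1 h2 h3 h4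
  have h5 : (fun k => α (μ (x, k), y)) =ᶠ[𝓝 e] fun k => α (x, α (k, y)) := by
    have c4 : ContinuousAt (fun k : E => (x, k, y)) e := by fun_prop
    exact c4.eventually h4
  have d1 : DifferentiableAt ℝ α (x, y) := h1.differentiableAt (by norm_num)
  have d2 : DifferentiableAt ℝ μ (x, e) := h2.differentiableAt (by norm_num)
  have d3 : DifferentiableAt ℝ α (e, y) := H.smooth.differentiableAt (by norm_num)
  have l1 : HasFDerivAt (fun k => (μ (x, k), y))
      (((fderiv ℝ μ (x, e)).comp (ContinuousLinearMap.inr ℝ E E)).prod 0) e :=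
    (d2.hasFDerivAt.comp e (hasFDerivAt_prodMk_right x e)).prodMk (hasFDerivAt_const y e)
  have l2 : HasFDerivAt (fun k => α (μ (x, k), y)) _ e :=
    HasFDerivAt.comp (g := α) e (by rw [h3]; exact d1.hasFDerivAt) l1
  have r1 : HasFDerivAt (fun k => (x, α (k, y)))
      (ContinuousLinearMap.prod 0 ((fderiv ℝ α (e, y)).comp (ContinuousLinearMap.inl ℝ E F))) e :=
    (hasFDerivAt_const x e).prodMk (d3.hasFDerivAt.comp e (hasFDerivAt_prodMk_left e y))
  have r2 : HasFDerivAt (fun k => α (x, α (k, y))) _ e :=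
    HasFDerivAt.comp (g := α) e (by rw [H.one_smul.self_of_nhds]; exact d1.hasFDerivAt) r1
  have := congrArg (fun L => L X) (l2.unique (r2.congr_of_eventuallyEq h5))
  simpa [fundamentalField] using this

/-- The brackets of the fundamental fields of a left action. -/
lemma fderiv_fundamentalField_sub (H : IsLocalAction μ α e y) (X Y : E) :
    fderiv ℝ (fundamentalField α e Y) y (fundamentalField α e X y)
      - fderiv ℝ (fundamentalField α e X) y (fundamentalField α e Y y) =
      -fundamentalField α e (mixedDeriv μ e X Y - mixedDeriv μ e Y X) y := by
  -- Differentiating the identity of `eventually_fderiv_mul_smul` at `e` along Y gives this. The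
  -- second derivative of `α` in the group directions is symmetric and cancels in the bracket.
  have key : ∀ X Y : E, fderiv ℝ (fundamentalField α e Y) y (fundamentalField α e X y) =
      fderiv ℝ (fderiv ℝ α) (e, y) (Y, 0) (X, 0) + fundamentalField α e (mixedDeriv μ e Y X) y := by
    intro X Y
    have h1 := H.eventually_fderiv_mul_smul X
    have dα := H.differentiableAt_fderiv.hasFDerivAt
    have dμ : DifferentiableAt ℝ (fderiv ℝ μ) (e, e) :=
      (H.smooth_mul.fderiv_right (m := 2) (by norm_num)).differentiableAt (by norm_num)
    have a1 : HasFDerivAt (fun x : E => fderiv ℝ α (x, y)) _ e :=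
      dα.comp e (hasFDerivAt_prodMk_left e y)
    have a2 : HasFDerivAt (fun x : E => fderiv ℝ μ (x, e)) _ e :=
      dμ.hasFDerivAt.comp (f := fun x : E => (x, e)) e (hasFDerivAt_prodMk_left e e)
    have a3 := (a2.clm_apply (hasFDerivAt_const ((0, X) : E × E) e)).prodMk
      (hasFDerivAt_const (0 : F) e)
    have a4 := a1.clm_apply a3
    have a5 := a1.clm_apply (hasFDerivAt_const ((0, fundamentalField α e X y) : E × F) e)
    have h2 := congrArg (fun L => L Y) (a4.unique (a5.congr_of_eventuallyEq h1))
    simp only [ContinuousLinearMap.comp_zero, zero_add,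
      add_apply, ContinuousLinearMap.comp_apply, ContinuousLinearMap.flip_apply,
      ContinuousLinearMap.prod_apply, ContinuousLinearMap.inl_apply, zero_apply,
      H.fderiv_one_mul] at h2
    rw [H.fderiv_fundamentalField, H.isSymmSndFDerivAt (0, _) (Y, 0), ← h2, add_comm]
    rfl
  rw [key, key, H.isSymmSndFDerivAt (Y, 0) (X, 0)]
  unfold fundamentalField
  have : ((mixedDeriv μ e X Y - mixedDeriv μ e Y X, 0) : E × F) =
      (mixedDeriv μ e X Y, 0) - (mixedDeriv μ e Y X, 0) := by simp
  rw [this, map_sub]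
  abel

/-- Fundamental fields of an isometric action are Killing fields. -/
lemma killing_fundamentalField (H : IsLocalAction μ α e y) {h : F → F →L[ℝ] F →L[ℝ] ℝ}
    (hh : DifferentiableAt ℝ h y)
    (hiso : ∀ᶠ x in 𝓝 e, ∀ u w,
      h (α (x, y)) (fderiv ℝ α (x, y) (0, u)) (fderiv ℝ α (x, y) (0, w)) = h y u w)
    (X : E) (u w : F) :
    fderiv ℝ h y (fundamentalField α e X y) u w + h y (fderiv ℝ (fundamentalField α e X) y u) w
      + h y u (fderiv ℝ (fundamentalField α e X) y w) = 0 := by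
  have dα := H.differentiableAt_fderiv.hasFDerivAt
  have a1 : HasFDerivAt (fun x : E => fderiv ℝ α (x, y)) _ e :=
    dα.comp e (hasFDerivAt_prodMk_left e y)
  have a2 : HasFDerivAt (fun x : E => α (x, y)) _ e :=
    (H.smooth.differentiableAt (by norm_num)).hasFDerivAt.comp e (hasFDerivAt_prodMk_left e y)
  have a3 : HasFDerivAt (fun x : E => h (α (x, y))) _ e :=
    HasFDerivAt.comp (g := h) e (by rw [H.one_smul.self_of_nhds]; exact hh.hasFDerivAt) a2
  have a4 := fun u : F => a1.clm_apply (hasFDerivAt_const ((0, u) : E × F) e)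
  have a5 := (a3.clm_apply (a4 u)).clm_apply (a4 w)
  have a6 : HasFDerivAt (fun x : E => h (α (x, y)) (fderiv ℝ α (x, y) (0, u))
      -- By isometry the pulled-back metric is constant in the group variable; its vanishing
      -- derivative at `e` is the Killing equation.
      (fderiv ℝ α (x, y) (0, w))) (0 : E →L[ℝ] ℝ) e :=
    (hasFDerivAt_const (h y u w) e).congr_of_eventuallyEq (hiso.mono fun x hx => hx u w)
  have h2 := congrArg (fun L => L X) (a5.unique a6)
  simp only [ContinuousLinearMap.comp_zero, zero_add,
      add_apply, ContinuousLinearMap.comp_apply, ContinuousLinearMap.flip_apply,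
      ContinuousLinearMap.inl_apply, zero_apply,
      H.fderiv_one_smul, H.one_smul.self_of_nhds] at h2
  rw [H.fderiv_fundamentalField, H.fderiv_fundamentalField, H.isSymmSndFDerivAt (0, u) (X, 0),
    H.isSymmSndFDerivAt (0, w) (X, 0)]
  unfold fundamentalField
  linarith

end IsLocalAction

end LocalAction

/-! ### Differentials between manifolds, read on the model spaces. -/

section Differentials

variable {E F E' : Type*} [NormedAddCommGroup E] [NormedSpace ℝ E]
  [NormedAddCommGroup F] [NormedSpace ℝ F] [NormedAddCommGroup E'] [NormedSpace ℝ E']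
  {M N P : Type*} [TopologicalSpace M] [ChartedSpace E M] [TopologicalSpace N] [ChartedSpace F N]
  [TopologicalSpace P] [ChartedSpace E' P]

variable (E F) in
/-- The differential of a map between manifolds, as a map between the model spaces. -/
def dAt (f : M → N) (x : M) : E →L[ℝ] F := mfderiv 𝓘(ℝ, E) 𝓘(ℝ, F) f x

lemma dAt_comp {g : N → P} {f : M → N} {x : M} {y : N}
    (hg : MDifferentiableAt 𝓘(ℝ, F) 𝓘(ℝ, E') g y)
    (hf : MDifferentiableAt 𝓘(ℝ, E) 𝓘(ℝ, F) f x) (hy : f x = y) :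
    dAt E E' (fun z => g (f z)) x = (dAt F E' g y).comp (dAt E F f x) := by
  subst hy
  exact mfderiv_comp x hg hf

lemma dAt_congr {f g : M → N} {x : M} (h : f =ᶠ[𝓝 x] g) : dAt E F f x = dAt E F g x :=
  h.mfderiv_eq

lemma dAt_eq_fderiv (f : E → F) (x : E) : dAt E F f x = fderiv ℝ f x := mfderiv_eq_fderiv

lemma dAt_id (x : M) : dAt E E (fun z : M => z) x = ContinuousLinearMap.id ℝ E := mfderiv_id

lemma dAt_const (c : N) (x : M) : dAt E F (fun _ : M => c) x = 0 := mfderiv_const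

variable [IsManifold 𝓘(ℝ, E) ∞ M] [IsManifold 𝓘(ℝ, F) ∞ N]

lemma mdifferentiableAt_extChartAt_symm (p : M) {y : E} (hy : y ∈ (extChartAt 𝓘(ℝ, E) p).target) :
    MDifferentiableAt 𝓘(ℝ, E) 𝓘(ℝ, E) (extChartAt 𝓘(ℝ, E) p).symm y :=
  ((contMDiffOn_extChartAt_symm (n := ∞) p).contMDiffAt
    ((isOpen_extChartAt_target p).mem_nhds hy)).mdifferentiableAt (by simp)

lemma mdifferentiableAt_extChartAt_of_mem {p q : M} (hq : q ∈ (extChartAt 𝓘(ℝ, E) p).source) :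
    MDifferentiableAt 𝓘(ℝ, E) 𝓘(ℝ, E) (extChartAt 𝓘(ℝ, E) p) q :=
  (contMDiffAt_extChartAt' (n := ∞) (by simpa using hq)).mdifferentiableAt (by simp)

/-- The tangent space at `p` is identified with the model space by the preferred chart at `p`, so at
base points no coordinate change appears. -/
lemma dAt_extChartAt (p : M) : dAt E E (extChartAt 𝓘(ℝ, E) p) p = ContinuousLinearMap.id ℝ E := by
  have : IsManifold 𝓘(ℝ, E) 1 M := .of_le (n := ∞) (by simp)
  exact mfderiv_extChartAt_self

lemma dAt_extChartAt_symm (p : M) :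
    dAt E E (extChartAt 𝓘(ℝ, E) p).symm (extChartAt 𝓘(ℝ, E) p p) = ContinuousLinearMap.id ℝ E := by
  have h1 := dAt_comp (E := E) (F := E) (E' := E) (g := extChartAt 𝓘(ℝ, E) p)
    (f := (extChartAt 𝓘(ℝ, E) p).symm) (x := extChartAt 𝓘(ℝ, E) p p) (y := p)
    (mdifferentiableAt_extChartAt_of_mem (mem_extChartAt_source p))
    (mdifferentiableAt_extChartAt_symm p (mem_extChartAt_target p)) (by simp)
  have h2 : (fun z => extChartAt 𝓘(ℝ, E) p ((extChartAt 𝓘(ℝ, E) p).symm z))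
      =ᶠ[𝓝 (extChartAt 𝓘(ℝ, E) p p)] fun z => z := by
    filter_upwards [extChartAt_target_mem_nhds p] with z hz
    exact (extChartAt 𝓘(ℝ, E) p).right_inv hz
  rw [dAt_congr h2, dAt_extChartAt, dAt_id] at h1
  simpa using h1.symm

end Differentials

/-! ### Smooth group actions in charts. -/

section Action

variable {E F : Type*} [NormedAddCommGroup E] [NormedSpace ℝ E]
  [NormedAddCommGroup F] [NormedSpace ℝ F]
  {G N : Type*} [TopologicalSpace G] [ChartedSpace E G] [Group G] [LieGroup 𝓘(ℝ, E) ∞ G]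
  [TopologicalSpace N] [ChartedSpace F N] [IsManifold 𝓘(ℝ, F) ∞ N] [MulAction G N]
  [ContMDiffSMul 𝓘(ℝ, E) 𝓘(ℝ, F) ∞ G N]

variable (E G) in
/-- An action in the charts around `1` and around `p`. -/
def actChart (p : N) (z : E × F) : F :=
  extChartAt 𝓘(ℝ, F) p ((extChartAt 𝓘(ℝ, E) (1 : G)).symm z.1 • (extChartAt 𝓘(ℝ, F) p).symm z.2)

lemma continuousAt_actChart (p : N) : ContinuousAt (fun z : E × F =>
    (extChartAt 𝓘(ℝ, E) (1 : G)).symm z.1 • (extChartAt 𝓘(ℝ, F) p).symm z.2)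
    (extChartAt 𝓘(ℝ, E) (1 : G) 1, extChartAt 𝓘(ℝ, F) p p) := by
  have := ContMDiffSMul.continuousSMul (I := 𝓘(ℝ, E)) (I' := 𝓘(ℝ, F)) (G := G) (M := N) ∞
  have h1 : ContinuousAt (fun z : E × F => (extChartAt 𝓘(ℝ, E) (1 : G)).symm z.1)
      (extChartAt 𝓘(ℝ, E) (1 : G) 1, extChartAt 𝓘(ℝ, F) p p) :=
    ContinuousAt.comp_of_eq (continuousAt_extChartAt_symm (1 : G)) continuousAt_fst rfl
  have h2 : ContinuousAt (fun z : E × F => (extChartAt 𝓘(ℝ, F) p).symm z.2)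
      (extChartAt 𝓘(ℝ, E) (1 : G) 1, extChartAt 𝓘(ℝ, F) p p) :=
    ContinuousAt.comp_of_eq (continuousAt_extChartAt_symm p) continuousAt_snd rfl
  exact h1.smul h2

/-- Near the base point, products of points of the charts stay in the chart. -/
lemma eventually_smul_mem_source (p : N) :
    ∀ᶠ z in 𝓝 (extChartAt 𝓘(ℝ, E) (1 : G) 1, extChartAt 𝓘(ℝ, F) p p),
      (extChartAt 𝓘(ℝ, E) (1 : G)).symm z.1 • (extChartAt 𝓘(ℝ, F) p).symm z.2 ∈
        (extChartAt 𝓘(ℝ, F) p).source := by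
  refine (continuousAt_actChart (G := G) p).eventually ?_
  simp only [extChartAt_to_inv, one_smul]
  exact extChartAt_source_mem_nhds p

lemma eventually_symm_actChart (p : N) :
    ∀ᶠ z in 𝓝 (extChartAt 𝓘(ℝ, E) (1 : G) 1, extChartAt 𝓘(ℝ, F) p p),
      (extChartAt 𝓘(ℝ, F) p).symm (actChart E G p z) =
        (extChartAt 𝓘(ℝ, E) (1 : G)).symm z.1 • (extChartAt 𝓘(ℝ, F) p).symm z.2 := by
  filter_upwards [eventually_smul_mem_source (E := E) (G := G) p] with z hz
  exact (extChartAt 𝓘(ℝ, F) p).left_inv hz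

lemma contDiffAt_actChart (p : N) : ContDiffAt ℝ 3 (actChart E G p)
    (extChartAt 𝓘(ℝ, E) (1 : G) 1, extChartAt 𝓘(ℝ, F) p p) := by
  rw [← contMDiffAt_iff_contDiffAt]
  have h1 : ContMDiffAt 𝓘(ℝ, E × F) 𝓘(ℝ, E) 3
      (fun z : E × F => (extChartAt 𝓘(ℝ, E) (1 : G)).symm z.1)
      (extChartAt 𝓘(ℝ, E) (1 : G) 1, extChartAt 𝓘(ℝ, F) p p) :=
    ContMDiffAt.comp_of_eq (f := Prod.fst)
      (((contMDiffOn_extChartAt_symm (n := ∞) (1 : G)).contMDiffAt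
        (extChartAt_target_mem_nhds 1)).of_le (by norm_cast))
      contDiffAt_fst.contMDiffAt rfl
  have h2 : ContMDiffAt 𝓘(ℝ, E × F) 𝓘(ℝ, F) 3
      (fun z : E × F => (extChartAt 𝓘(ℝ, F) p).symm z.2)
      (extChartAt 𝓘(ℝ, E) (1 : G) 1, extChartAt 𝓘(ℝ, F) p p) :=
    ContMDiffAt.comp_of_eq (f := Prod.snd)
      (((contMDiffOn_extChartAt_symm (n := ∞) p).contMDiffAt
        (extChartAt_target_mem_nhds p)).of_le (by norm_cast))
      contDiffAt_snd.contMDiffAt rfl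
  have : ContMDiffSMul 𝓘(ℝ, E) 𝓘(ℝ, F) 3 G N := .of_le (m := ∞) (by norm_cast)
  have h3 := h1.smul h2
  refine ContMDiffAt.comp_of_eq (y := p) ?_ h3 (by simp)
  exact contMDiffAt_extChartAt.of_le (n := ∞) (by norm_cast)

/-- A smooth action is a local action in coordinates. -/
lemma isLocalAction_actChart (p : N) :
    IsLocalAction (actChart E G (1 : G)) (actChart E G p) (extChartAt 𝓘(ℝ, E) (1 : G) 1)
      (extChartAt 𝓘(ℝ, F) p p) where
  smooth_mul := contDiffAt_actChart (1 : G)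
  smooth := contDiffAt_actChart p
  mul_one := by
    filter_upwards [extChartAt_target_mem_nhds (I := 𝓘(ℝ, E)) (1 : G)] with x hx
    simp only [actChart, smul_eq_mul, extChartAt_to_inv, _root_.mul_one,
      (extChartAt 𝓘(ℝ, E) (1 : G)).right_inv hx]
  one_mul := by
    filter_upwards [extChartAt_target_mem_nhds (I := 𝓘(ℝ, E)) (1 : G)] with x hx
    simp only [actChart, smul_eq_mul, extChartAt_to_inv, _root_.one_mul,
      (extChartAt 𝓘(ℝ, E) (1 : G)).right_inv hx]
  one_smul := by
    filter_upwards [extChartAt_target_mem_nhds (I := 𝓘(ℝ, F)) p] with x hx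
    simp only [actChart, extChartAt_to_inv, _root_.one_smul, (extChartAt 𝓘(ℝ, F) p).right_inv hx]
  mul_smul := by
    have c1 : ContinuousAt (fun z : E × E × F => (z.1, z.2.1))
      (extChartAt 𝓘(ℝ, E) (1 : G) 1, extChartAt 𝓘(ℝ, E) (1 : G) 1, extChartAt 𝓘(ℝ, F) p p) := by
      fun_prop
    have c2 : ContinuousAt (fun z : E × E × F => (z.2.1, z.2.2))
      (extChartAt 𝓘(ℝ, E) (1 : G) 1, extChartAt 𝓘(ℝ, E) (1 : G) 1, extChartAt 𝓘(ℝ, F) p p) := by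
      fun_prop
    filter_upwards [c1.eventually (eventually_symm_actChart (E := E) (G := G) (1 : G)),
      c2.eventually (eventually_symm_actChart (E := E) (G := G) p)] with z h1 h2
    unfold actChart at h1 h2 ⊢
    dsimp only at h1 h2 ⊢
    rw [h1, h2, smul_eq_mul, mul_smul]

lemma mdifferentiable_mul_left (g : G) : MDifferentiable 𝓘(ℝ, E) 𝓘(ℝ, E) (fun x : G => g * x) :=
  (contMDiff_mul_left (n := ∞)).mdifferentiable (by simp)

lemma mdifferentiable_smul_const (p : N) :
    MDifferentiable 𝓘(ℝ, E) 𝓘(ℝ, F) (fun g : G => g • p) :=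
  (ContMDiff.smul (I := 𝓘(ℝ, E)) (n := ∞) (f := fun g : G => g) (g := fun _ => p) contMDiff_id
    contMDiff_const).mdifferentiable (by simp)

end Action

lemma mdifferentiable_smul (E : Type*) {F G N : Type*} [NormedAddCommGroup E] [NormedSpace ℝ E]
    [NormedAddCommGroup F] [NormedSpace ℝ F] [TopologicalSpace G] [ChartedSpace E G] [Group G]
    [TopologicalSpace N] [ChartedSpace F N] [MulAction G N]
    [ContMDiffSMul 𝓘(ℝ, E) 𝓘(ℝ, F) ∞ G N] (g : G) :
    MDifferentiable 𝓘(ℝ, F) 𝓘(ℝ, F) (fun x : N => g • x) :=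
  (ContMDiffSMul.contMDiff_const_smul (I := 𝓘(ℝ, E)) (n := ∞) g).mdifferentiable (by simp)

/-! ### The Lie bracket as a mixed second derivative of the multiplication. -/

section Bracket

variable {E : Type*} [NormedAddCommGroup E] [NormedSpace ℝ E]
  {G : Type*} [TopologicalSpace G] [ChartedSpace E G] [Group G] [LieGroup 𝓘(ℝ, E) ∞ G]

variable (G) in
/-- The left invariant vector fields in the chart around `1`. -/
def leftField (X x : E) : E :=
  fderiv ℝ (actChart E G (1 : G)) (x, extChartAt 𝓘(ℝ, E) (1 : G) 1) (0, X)

lemma leftField_eq (X : E) {x : E} (hx : x ∈ (extChartAt 𝓘(ℝ, E) (1 : G)).target)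
    (hd : DifferentiableAt ℝ (actChart E G (1 : G)) (x, extChartAt 𝓘(ℝ, E) (1 : G) 1)) :
    leftField G X x = dAt E E (extChartAt 𝓘(ℝ, E) (1 : G)) ((extChartAt 𝓘(ℝ, E) (1 : G)).symm x)
      (dAt E E (fun k : G => (extChartAt 𝓘(ℝ, E) (1 : G)).symm x * k) 1 X) := by
  set ψ := extChartAt 𝓘(ℝ, E) (1 : G)
  have h1 : fderiv ℝ (fun k => actChart E G (1 : G) (x, k)) (ψ 1) X = leftField G X x := by
    have := hd.hasFDerivAt.comp (ψ 1) (hasFDerivAt_prodMk_right x (ψ 1))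
    rw [show (fun k => actChart E G (1 : G) (x, k)) = actChart E G (1 : G) ∘ fun k => (x, k) from rfl,
      this.fderiv]
    rfl
  have h2 := dAt_comp (E := E) (F := E) (E' := E) (g := fun k : G => ψ.symm x * k)
    (f := ψ.symm) (x := ψ 1) (y := 1) (mdifferentiable_mul_left _ 1)
    (mdifferentiableAt_extChartAt_symm 1 (mem_extChartAt_target 1)) (by simp [ψ])
  have h3 := dAt_comp (E := E) (F := E) (E' := E) (g := ψ)
    (f := fun k => ψ.symm x * ψ.symm k) (x := ψ 1) (y := ψ.symm x)
    (mdifferentiableAt_extChartAt_of_mem (ψ.map_target hx))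
    ((mdifferentiable_mul_left _ _).comp _
      (mdifferentiableAt_extChartAt_symm 1 (mem_extChartAt_target 1))) (by simp [ψ])
  rw [← h1, ← dAt_eq_fderiv]
  have h4 := congrArg (fun L => L X) h3
  rw [h2, dAt_extChartAt_symm] at h4
  exact h4

lemma differentiableAt_leftField (X : E) :
    DifferentiableAt ℝ (leftField G X) (extChartAt 𝓘(ℝ, E) (1 : G) 1) := by
  have H := isLocalAction_actChart (E := E) (F := E) (G := G) (1 : G)
  exact (H.differentiableAt_fderiv.comp (f := fun x : E => (x, extChartAt 𝓘(ℝ, E) (1 : G) 1))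
    (extChartAt 𝓘(ℝ, E) (1 : G) 1) (hasFDerivAt_prodMk_left _ _).differentiableAt).clm_apply (differentiableAt_const _)

lemma fderiv_leftField (X Y : E) :
    fderiv ℝ (leftField G X) (extChartAt 𝓘(ℝ, E) (1 : G) 1) Y =
      mixedDeriv (actChart E G (1 : G)) (extChartAt 𝓘(ℝ, E) (1 : G) 1) Y X := by
  have H := isLocalAction_actChart (E := E) (F := E) (G := G) (1 : G)
  have h1 := (H.differentiableAt_fderiv.hasFDerivAt.comp
    (f := fun x : E => (x, extChartAt 𝓘(ℝ, E) (1 : G) 1)) (extChartAt 𝓘(ℝ, E) (1 : G) 1)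
    (hasFDerivAt_prodMk_left _ _)).clm_apply (hasFDerivAt_const ((0, X) : E × E)
      (extChartAt 𝓘(ℝ, E) (1 : G) 1))
  have e1 : leftField G X = fun y => ((fderiv ℝ (actChart E G (1 : G)) ∘
    fun y => (y, extChartAt 𝓘(ℝ, E) (1 : G) 1)) y) (0, X) := rfl
  rw [e1, h1.fderiv]
  simp [mixedDeriv]

variable [CompleteSpace E]

/-- The Lie bracket in coordinates. -/
lemma lie_eq_mixedDeriv (X Y : GroupLieAlgebra 𝓘(ℝ, E) G) :
    (⁅X, Y⁆ : GroupLieAlgebra 𝓘(ℝ, E) G) =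
      mixedDeriv (actChart E G (1 : G)) (extChartAt 𝓘(ℝ, E) (1 : G) 1) (X : E) (Y : E)
        - mixedDeriv (actChart E G (1 : G)) (extChartAt 𝓘(ℝ, E) (1 : G) 1) (Y : E) (X : E) := by
  have H := isLocalAction_actChart (E := E) (F := E) (G := G) (1 : G)
  have : IsManifold 𝓘(ℝ, E) 1 G := .of_le (n := ∞) (by simp)
  let W : GroupLieAlgebra 𝓘(ℝ, E) G → E → E := fun X =>
    VectorField.mpullbackWithin 𝓘(ℝ, E) 𝓘(ℝ, E) (extChartAt 𝓘(ℝ, E) (1 : G)).symm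
      (mulInvariantVectorField X) (Set.range 𝓘(ℝ, E))
  -- The bracket is defined through left invariant fields pulled back to the chart. They agree with
  -- `leftField` near the identity, which is enough for values and first derivatives there.
  have key : ∀ X, W X =ᶠ[𝓝 (extChartAt 𝓘(ℝ, E) (1 : G) 1)] leftField G (X : E) := by
    intro X
    have c1 : ContinuousAt (fun x : E => (x, extChartAt 𝓘(ℝ, E) (1 : G) 1))
      (extChartAt 𝓘(ℝ, E) (1 : G) 1) := by fun_prop
    filter_upwards [extChartAt_target_mem_nhds (I := 𝓘(ℝ, E)) (1 : G),
      c1.eventually (H.smooth.eventually (by simp))] with x hx hd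
    have h1 := ContinuousLinearMap.inverse_eq
      (mfderivWithin_extChartAt_symm_comp_mfderiv_extChartAt (I := 𝓘(ℝ, E)) hx)
      (mfderiv_extChartAt_comp_mfderivWithin_extChartAt_symm (I := 𝓘(ℝ, E)) hx)
    exact (congrArg (fun L : E →L[ℝ] E =>
      L (mulInvariantVectorField X ((extChartAt 𝓘(ℝ, E) (1 : G)).symm x) : E)) h1).trans
      (leftField_eq _ hx (hd.differentiableAt (by norm_num))).symm
  have e1 : (⁅X, Y⁆ : GroupLieAlgebra 𝓘(ℝ, E) G) =
      (dAt E E (extChartAt 𝓘(ℝ, E) (1 : G)) 1).inverse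
        (VectorField.lieBracketWithin ℝ (W X) (W Y)
          ((extChartAt 𝓘(ℝ, E) (1 : G)).symm ⁻¹' Set.univ ∩ Set.range 𝓘(ℝ, E))
          (extChartAt 𝓘(ℝ, E) (1 : G) 1)) := rfl
  have e2 : (dAt E E (extChartAt 𝓘(ℝ, E) (1 : G)) 1).inverse
        (VectorField.lieBracketWithin ℝ (W X) (W Y)
          ((extChartAt 𝓘(ℝ, E) (1 : G)).symm ⁻¹' Set.univ ∩ Set.range 𝓘(ℝ, E))
          (extChartAt 𝓘(ℝ, E) (1 : G) 1)) = mixedDeriv (actChart E G (1 : G)) (extChartAt 𝓘(ℝ, E) (1 : G) 1) (X : E) (Y : E)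
        - mixedDeriv (actChart E G (1 : G)) (extChartAt 𝓘(ℝ, E) (1 : G) 1) (Y : E) (X : E) := by
    rw [dAt_extChartAt, ContinuousLinearMap.inverse_id]
    simp only [Set.preimage_univ, Set.univ_inter, modelWithCornersSelf_coe, Set.range_id]
    have hX : ∀ Z : E, leftField G Z (extChartAt 𝓘(ℝ, E) (1 : G) 1) = Z := H.fderiv_one_smul
    rw [VectorField.lieBracketWithin_univ, VectorField.lieBracket,
      (key X).fderiv_eq, (key Y).fderiv_eq, (key X).self_of_nhds, (key Y).self_of_nhds]
    exact congrArg₂ (fun a b : E => a - b)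
      ((congrArg (fderiv ℝ (leftField (E := E) G Y) _) (hX X)).trans (fderiv_leftField (E := E) Y X))
      ((congrArg (fderiv ℝ (leftField (E := E) G X) _) (hX Y)).trans (fderiv_leftField (E := E) X Y))
  exact e1.trans e2

end Bracket

/-! ### Fundamental fields and conjugation. -/

section FundamentalField

variable {E F : Type*} [NormedAddCommGroup E] [NormedSpace ℝ E]
  [NormedAddCommGroup F] [NormedSpace ℝ F]
  {G N : Type*} [TopologicalSpace G] [ChartedSpace E G] [Group G] [LieGroup 𝓘(ℝ, E) ∞ G]
  [TopologicalSpace N] [ChartedSpace F N] [IsManifold 𝓘(ℝ, F) ∞ N] [MulAction G N]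
  [ContMDiffSMul 𝓘(ℝ, E) 𝓘(ℝ, F) ∞ G N]

lemma fundamentalField_actChart (p : N) (X : E) {y : F} (hy : y ∈ (extChartAt 𝓘(ℝ, F) p).target)
    (hd : DifferentiableAt ℝ (actChart E G p) (extChartAt 𝓘(ℝ, E) (1 : G) 1, y)) :
    fundamentalField (actChart E G p) (extChartAt 𝓘(ℝ, E) (1 : G) 1) X y =
      dAt F F (extChartAt 𝓘(ℝ, F) p) ((extChartAt 𝓘(ℝ, F) p).symm y)
        (dAt E F (fun k : G => k • (extChartAt 𝓘(ℝ, F) p).symm y) 1 X) := by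
  set ψ := extChartAt 𝓘(ℝ, E) (1 : G)
  set φ := extChartAt 𝓘(ℝ, F) p
  have h1 : fderiv ℝ (fun k => actChart E G p (k, y)) (ψ 1) X =
      fundamentalField (actChart E G p) (ψ 1) X y := by
    have := hd.hasFDerivAt.comp (f := fun k : E => (k, y)) (ψ 1) (hasFDerivAt_prodMk_left (ψ 1) y)
    rw [show (fun k => actChart E G p (k, y)) = actChart E G p ∘ fun k => (k, y) from rfl,
      this.fderiv]
    rfl
  have h2 := dAt_comp (E := E) (F := E) (E' := F) (g := fun k : G => k • φ.symm y)
    (f := ψ.symm) (x := ψ 1) (y := 1) (mdifferentiable_smul_const _ 1)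
    (mdifferentiableAt_extChartAt_symm 1 (mem_extChartAt_target 1)) (by simp [ψ])
  have h3 := dAt_comp (E := E) (F := F) (E' := F) (g := φ)
    (f := fun k => ψ.symm k • φ.symm y) (x := ψ 1) (y := φ.symm y)
    (mdifferentiableAt_extChartAt_of_mem (φ.map_target hy))
    (MDifferentiableAt.comp (I' := 𝓘(ℝ, E)) (ψ 1) (g := fun k : G => k • φ.symm y) (f := ψ.symm)
      (mdifferentiable_smul_const _ _)
      (mdifferentiableAt_extChartAt_symm 1 (mem_extChartAt_target 1))) (by simp [ψ])
  rw [← h1, ← dAt_eq_fderiv]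
  have h4 := congrArg (fun L => L X) h3
  rw [h2, dAt_extChartAt_symm] at h4
  exact h4

variable (E) in
/-- The differential at `1` of the conjugation by `a`, on the model space. -/
def conjDeriv (a : G) : E →L[ℝ] E := dAt E E (fun x : G => a * x * a⁻¹) 1

lemma mdifferentiable_conj (a : G) :
    MDifferentiable 𝓘(ℝ, E) 𝓘(ℝ, E) (fun x : G => a * x * a⁻¹) :=
  ((contMDiff_mul_right (n := ∞) (a := a⁻¹)).comp (contMDiff_mul_left (n := ∞) (a := a))
    ).mdifferentiable (by simp)

variable (E G) in
lemma conjDeriv_one : conjDeriv E (1 : G) = ContinuousLinearMap.id ℝ E := by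
  have : (fun x : G => 1 * x * 1⁻¹) = fun x => x := by ext; simp
  rw [conjDeriv, this, dAt_id]

lemma conjDeriv_mul (a b : G) : conjDeriv E (a * b) = (conjDeriv E a).comp (conjDeriv E b) := by
  have h := dAt_comp (E := E) (F := E) (E' := E) (g := fun x : G => a * x * a⁻¹)
    (f := fun x : G => b * x * b⁻¹) (x := 1) (y := 1) (mdifferentiable_conj a 1)
    (mdifferentiable_conj b 1) (by simp)
  unfold conjDeriv
  rw [← h]
  congr 1
  ext x
  simp [mul_assoc]

lemma conjDeriv_mul_apply (a b : G) (X : E) :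
    conjDeriv E (a * b) X = conjDeriv E a (conjDeriv E b X) := by rw [conjDeriv_mul]; rfl

lemma conjDeriv_inv_apply (a : G) (X : E) : conjDeriv E a (conjDeriv E a⁻¹ X) = X := by
  rw [← conjDeriv_mul_apply, mul_inv_cancel, conjDeriv_one]; rfl

lemma conjDeriv_apply_inv (a : G) (X : E) : conjDeriv E a⁻¹ (conjDeriv E a X) = X := by
  rw [← conjDeriv_mul_apply, inv_mul_cancel, conjDeriv_one]; rfl

/-- Translates of fundamental vector fields. -/
lemma dAt_smul_const_conjDeriv (a : G) (p : N) (X : E) :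
    dAt E F (fun k : G => k • (a • p)) 1 (conjDeriv E a X) =
      dAt F F (fun q : N => a • q) p (dAt E F (fun k : G => k • p) 1 X) := by
  have h1 := dAt_comp (E := E) (F := E) (E' := F) (g := fun k : G => k • (a • p))
    (f := fun x : G => a * x * a⁻¹) (x := 1) (y := 1) (mdifferentiable_smul_const _ 1)
    (mdifferentiable_conj a 1) (by simp)
  have h2 := dAt_comp (E := E) (F := F) (E' := F) (g := fun q : N => a • q)
    (f := fun x : G => x • p) (x := 1) (y := p) (mdifferentiable_smul E a p)
    (mdifferentiable_smul_const _ 1) (by simp)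
  have h3 : (fun z : G => (a * z * a⁻¹) • (a • p)) = fun z : G => a • z • p := by
    ext z; simp [smul_smul, mul_assoc]
  rw [h3, h2] at h1
  exact (congrArg (fun L => L X) h1).symm

end FundamentalField

/-! ### The derivative of the adjoint representation. -/

section Adjoint

variable {E : Type*} [NormedAddCommGroup E] [NormedSpace ℝ E]
  {G : Type*} [TopologicalSpace G] [ChartedSpace E G] [Group G] [LieGroup 𝓘(ℝ, E) ∞ G]

/-- The bracket of the Lie algebra, on the model space. -/
def coordLie (G : Type*) [TopologicalSpace G] [ChartedSpace E G] [Group G] (X Y : E) : E :=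
  mixedDeriv (actChart E G (1 : G)) (extChartAt 𝓘(ℝ, E) (1 : G) 1) X Y
    - mixedDeriv (actChart E G (1 : G)) (extChartAt 𝓘(ℝ, E) (1 : G) 1) Y X

/-- In coordinates, left invariant fields are right invariant fields rotated by `Ad`. -/
lemma eventually_leftField_eq (X : E) :
    ∀ᶠ x in 𝓝 (extChartAt 𝓘(ℝ, E) (1 : G) 1), leftField G X x =
      fundamentalField (actChart E G (1 : G)) (extChartAt 𝓘(ℝ, E) (1 : G) 1)
        (conjDeriv E ((extChartAt 𝓘(ℝ, E) (1 : G)).symm x) X) x := by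
  have H := isLocalAction_actChart (E := E) (F := E) (G := G) (1 : G)
  have c1 : ContinuousAt (fun x : E => (x, extChartAt 𝓘(ℝ, E) (1 : G) 1))
      (extChartAt 𝓘(ℝ, E) (1 : G) 1) := by fun_prop
  filter_upwards [extChartAt_target_mem_nhds (I := 𝓘(ℝ, E)) (1 : G),
    c1.eventually (H.smooth.eventually (by simp)), H.eventually] with x hx hd hx'
  rw [leftField_eq _ hx (hd.differentiableAt (by norm_num)),
    fundamentalField_actChart _ _ hx (hx'.smooth.differentiableAt (by norm_num))]
  set g := (extChartAt 𝓘(ℝ, E) (1 : G)).symm x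
  -- The group identity behind this is g k = (g k g⁻¹) g.
  have h := dAt_smul_const_conjDeriv (E := E) (F := E) (N := G) g 1 X
  simp only [smul_eq_mul, mul_one] at h
  rw [dAt_id] at h
  exact congrArg _ h.symm

variable [CompleteSpace E]

/-- The derivative of the adjoint representation at `1`, in coordinates. -/
lemma hasFDerivAt_conjDeriv_symm (X : E) :
    ∃ D : E →L[ℝ] E, (∀ Y, D Y = coordLie G Y X) ∧
      HasFDerivAt (fun x => conjDeriv E ((extChartAt 𝓘(ℝ, E) (1 : G)).symm x) X) D
        (extChartAt 𝓘(ℝ, E) (1 : G) 1) := by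
  have H := isLocalAction_actChart (E := E) (F := E) (G := G) (1 : G)
  set e := extChartAt 𝓘(ℝ, E) (1 : G) 1 with he
  set μ : E × E → E := actChart E G (1 : G) with hμ
  let T : E → E →L[ℝ] E := fun x => (fderiv ℝ μ (e, x)).comp (ContinuousLinearMap.inl ℝ E E)
  have hTe : T e = ContinuousLinearMap.id ℝ E := by
    ext u; exact H.fderiv_mul_one u
  have dT0 := (H.differentiableAt_fderiv.hasFDerivAt.comp e (hasFDerivAt_prodMk_right e e))
  have dT : DifferentiableAt ℝ T e :=
    DifferentiableAt.clm_comp dT0.differentiableAt (differentiableAt_const _)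
  have hTY : ∀ Y u, fderiv ℝ T e Y u = mixedDeriv μ e u Y := by
    intro Y u
    have h1 : HasFDerivAt (fun x => T x u) _ e := dT.hasFDerivAt.clm_apply (hasFDerivAt_const u e)
    have h2 : HasFDerivAt (fun x => T x u) _ e :=
      dT0.clm_apply (hasFDerivAt_const ((u, 0) : E × E) e)
    have h3 := congrArg (fun L => L Y) (h1.unique h2)
    simp only [ContinuousLinearMap.comp_zero, zero_add, ContinuousLinearMap.flip_apply,
      ContinuousLinearMap.comp_apply, ContinuousLinearMap.inr_apply] at h3
    rw [h3]
    change fderiv ℝ (fderiv ℝ μ) (e, e) (0, Y) (u, 0) = _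
    rw [H.isSymmSndFDerivAt (0, Y) (u, 0)]
    rfl
  let A : E → E := fun x => conjDeriv E ((extChartAt 𝓘(ℝ, E) (1 : G)).symm x) X
  have hA : ∀ᶠ x in 𝓝 e, leftField G X x = T x (A x) := eventually_leftField_eq X
  have hi : (T e).IsInvertible := by
    rw [hTe]; exact ⟨ContinuousLinearEquiv.refl ℝ E, rfl⟩
  have hinv : ∀ᶠ x in 𝓝 e, (T x).IsInvertible := by
    obtain ⟨i, hi⟩ := hi
    have := ContinuousLinearEquiv.nhds i
    rw [hi] at this
    exact dT.continuousAt this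
  have hA' : ∀ᶠ x in 𝓝 e, A x = (T x).inverse (leftField G X x) := by
    filter_upwards [hA, hinv] with x h1 h2
    rw [h1, ← ContinuousLinearMap.comp_apply, h2.inverse_comp_self]
    rfl
  -- Differentiability of Ad at 1 comes from solving `leftField = T · A` for `A`, as `T` is
  -- invertible near `e`.
  have dinv : DifferentiableAt ℝ (fun x => (T x).inverse) e :=
    ((hi.contDiffAt_map_inverse (n := 1)).differentiableAt (by norm_num)).comp e dT
  have dA : DifferentiableAt ℝ A e :=
    (dinv.clm_apply (differentiableAt_leftField X)).congr_of_eventuallyEq hA'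
  refine ⟨fderiv ℝ A e, fun Y => ?_, dA.hasFDerivAt⟩
  -- The product rule reads mixed(Y, X) = mixed(X, Y) + A'(Y), so A'(Y) = [Y, X].
  have h1 := (dT.hasFDerivAt.clm_apply dA.hasFDerivAt).congr_of_eventuallyEq hA
  have h2 := congrArg (fun L => L Y) h1.fderiv
  have hAe : A e = X := by
    simp only [A, he, extChartAt_to_inv, conjDeriv_one]; rfl
  simp only [add_apply, ContinuousLinearMap.comp_apply, ContinuousLinearMap.flip_apply, hTe,
    hTY, hAe, ContinuousLinearMap.id_apply] at h2
  rw [he, fderiv_leftField, ← he] at h2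
  rw [coordLie, ← he, h2]
  exact (add_sub_cancel_right _ _).symm

/-- The adjoint representation is differentiable at `1` with derivative the bracket. -/
lemma mdifferentiableAt_conjDeriv_one (X : E) :
    MDifferentiableAt 𝓘(ℝ, E) 𝓘(ℝ, E) (fun a : G => conjDeriv E a X) 1 ∧
      ∀ Y, dAt E E (fun a : G => conjDeriv E a X) 1 Y = coordLie G Y X := by
  obtain ⟨D, hD, hd⟩ := hasFDerivAt_conjDeriv_symm (G := G) X
  have h1 : (fun a : G => conjDeriv E a X) =ᶠ[𝓝 1] fun a => (fun x => conjDeriv E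
      ((extChartAt 𝓘(ℝ, E) (1 : G)).symm x) X) (extChartAt 𝓘(ℝ, E) (1 : G) a) := by
    filter_upwards [extChartAt_source_mem_nhds (I := 𝓘(ℝ, E)) (1 : G)] with a ha
    simp only [(extChartAt 𝓘(ℝ, E) (1 : G)).left_inv ha]
  have m1 : MDifferentiableAt 𝓘(ℝ, E) 𝓘(ℝ, E) (fun x => conjDeriv E
      ((extChartAt 𝓘(ℝ, E) (1 : G)).symm x) X) (extChartAt 𝓘(ℝ, E) (1 : G) 1) :=
    hd.differentiableAt.mdifferentiableAt
  have m2 := mdifferentiableAt_extChartAt_of_mem (E := E) (mem_extChartAt_source (I := 𝓘(ℝ, E)) (1 : G))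
  refine ⟨(m1.comp 1 m2).congr_of_eventuallyEq h1, fun Y => ?_⟩
  rw [dAt_congr h1, dAt_comp m1 m2 rfl, dAt_extChartAt, dAt_eq_fderiv, hd.fderiv]
  exact hD Y

lemma mdifferentiableAt_conjDeriv (X : E) (g : G) :
    MDifferentiableAt 𝓘(ℝ, E) 𝓘(ℝ, E) (fun a : G => conjDeriv E a X) g := by
  have h1 : (fun a : G => conjDeriv E a X) =
      fun a => conjDeriv E g (conjDeriv E (g⁻¹ * a) X) := by
    ext a; rw [← conjDeriv_mul_apply]; simp
  have h2 : MDifferentiableAt 𝓘(ℝ, E) 𝓘(ℝ, E) (fun a : G => conjDeriv E (g⁻¹ * a) X) g :=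
    MDifferentiableAt.comp (I' := 𝓘(ℝ, E)) g (g := fun a : G => conjDeriv E a X)
      (f := fun a => g⁻¹ * a) (by rw [inv_mul_cancel]; exact (mdifferentiableAt_conjDeriv_one X).1)
      (mdifferentiable_mul_left _ _)
  rw [h1]
  exact (conjDeriv E g).mdifferentiable.mdifferentiableAt.comp g h2

lemma continuous_conjDeriv (X : E) : Continuous (fun a : G => conjDeriv E a X) :=
  continuous_iff_continuousAt.2 fun g => (mdifferentiableAt_conjDeriv X g).continuousAt

/-- The derivative of `Ad` along left invariant vector fields. -/
lemma dAt_conjDeriv_mul_left (X Y : E) (g : G) :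
    dAt E E (fun a : G => conjDeriv E a X) g (dAt E E (fun k : G => g * k) 1 Y) =
      conjDeriv E g (coordLie G Y X) := by
  have h1 := dAt_comp (E := E) (F := E) (E' := E) (g := fun a : G => conjDeriv E a X)
    (f := fun k : G => g * k) (x := 1) (y := g) (mdifferentiableAt_conjDeriv X g)
    (mdifferentiable_mul_left _ _) (by simp)
  have h2 := dAt_comp (E := E) (F := E) (E' := E) (g := fun Z : E => conjDeriv E g Z)
    (f := fun k : G => conjDeriv E k X) (x := 1) (y := X)
    (conjDeriv E g).mdifferentiable.mdifferentiableAt (mdifferentiableAt_conjDeriv X 1)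
    (by rw [conjDeriv_one]; rfl)
  have h3 : (fun z : G => conjDeriv E (g * z) X) = fun z => conjDeriv E g (conjDeriv E z X) := by
    ext z; rw [conjDeriv_mul_apply]
  rw [h3, h2] at h1
  have h4 := congrArg (fun L => L Y) h1
  rw [dAt_eq_fderiv] at h4
  simp only [ContinuousLinearMap.comp_apply, ContinuousLinearMap.fderiv] at h4
  rw [← h4, (mdifferentiableAt_conjDeriv_one X).2]

/-- Differentiate Ad(a k a⁻¹) Ad(a) X = Ad(a) Ad(k) X in k at the identity. -/
lemma conjDeriv_coordLie (a : G) (Y X : E) :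
    conjDeriv E a (coordLie G Y X) = coordLie G (conjDeriv E a Y) (conjDeriv E a X) := by
  have h1 := dAt_comp (E := E) (F := E) (E' := E)
    (g := fun b : G => conjDeriv E b (conjDeriv E a X))
    (f := fun k : G => a * k * a⁻¹) (x := 1) (y := 1) (mdifferentiableAt_conjDeriv _ _)
    (mdifferentiable_conj a _) (by simp)
  have h2 := dAt_comp (E := E) (F := E) (E' := E) (g := fun Z : E => conjDeriv E a Z)
    (f := fun k : G => conjDeriv E k X) (x := 1) (y := X)
    (conjDeriv E a).mdifferentiable.mdifferentiableAt (mdifferentiableAt_conjDeriv X 1)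
    (by rw [conjDeriv_one]; rfl)
  have h3 : (fun z : G => conjDeriv E (a * z * a⁻¹) (conjDeriv E a X)) =
      fun z => conjDeriv E a (conjDeriv E z X) := by
    ext z; rw [conjDeriv_mul_apply, conjDeriv_mul_apply, conjDeriv_apply_inv]
  rw [h3, h2] at h1
  have h4 := congrArg (fun L => L Y) h1
  rw [dAt_eq_fderiv] at h4
  simp only [ContinuousLinearMap.comp_apply, ContinuousLinearMap.fderiv] at h4
  rw [(mdifferentiableAt_conjDeriv_one X).2, (mdifferentiableAt_conjDeriv_one _).2] at h4
  exact h4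

end Adjoint

/-! ### Local sections and the homogeneous space G/K. -/

/-- A submersion has smooth local sections. -/
lemma exists_local_section {E : Type*} {F : Type*} [NormedAddCommGroup E] [NormedSpace ℝ E]
    [NormedAddCommGroup F] [NormedSpace ℝ F]
    {M N : Type*} [TopologicalSpace M] [ChartedSpace E M] [IsManifold 𝓘(ℝ, E) ∞ M]
    [TopologicalSpace N] [ChartedSpace F N] [IsManifold 𝓘(ℝ, F) ∞ N] {f : M → N} {x : M}
    (h : Manifold.IsSubmersionAt 𝓘(ℝ, E) 𝓘(ℝ, F) ∞ f x) :
    ∃ s : N → M, s (f x) = x ∧ ContMDiffAt 𝓘(ℝ, F) 𝓘(ℝ, E) ∞ s (f x) ∧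
      ∀ᶠ q in 𝓝 (f x), f (s q) = q := by
  have hw : ∀ z ∈ h.domChart.target, h.codChart (f (h.domChart.symm z)) = (h.equiv z).1 := by
    intro z hz
    have h1 : z ∈ (h.domChart.extend 𝓘(ℝ, E)).target := by simpa using hz
    have := h.writtenInCharts h1
    simpa using this
  have hx := h.mem_domChart_source
  have hfx := h.mem_codChart_source
  set Φ := h.domChart
  set Ψ := h.codChart
  set L := h.equiv
  -- In adapted charts `f` is the first projection; the section freezes the fibre coordinate at that
  -- of `x`.
  let σ : N → E := fun q => L.symm (Ψ q, (L (Φ x)).2)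
  have e1 : σ (f x) = Φ x := by
    have := hw (Φ x) (Φ.map_source hx)
    rw [Φ.left_inv hx] at this
    simp only [σ, this, Prod.mk.eta, ContinuousLinearEquiv.symm_apply_apply]
  have hΨ : ContMDiffAt 𝓘(ℝ, F) 𝓘(ℝ, F) ∞ Ψ (f x) :=
    contMDiffAt_of_mem_maximalAtlas h.codChart_mem_maximalAtlas hfx
  have hσ : ContMDiffAt 𝓘(ℝ, F) 𝓘(ℝ, E) ∞ σ (f x) :=
    ContMDiffAt.comp (I' := 𝓘(ℝ, F)) (f x) (g := fun y => L.symm (y, (L (Φ x)).2))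
      (ContDiff.contMDiff (by fun_prop)).contMDiffAt hΨ
  have hΦ : ContMDiffAt 𝓘(ℝ, E) 𝓘(ℝ, E) ∞ Φ.symm (Φ x) :=
    contMDiffAt_symm_of_mem_maximalAtlas h.domChart_mem_maximalAtlas (Φ.map_source hx)
  refine ⟨fun q => Φ.symm (σ q), by simp only [e1, Φ.left_inv hx], ?_, ?_⟩
  · exact ContMDiffAt.comp_of_eq hΦ hσ e1
  · have h1 : ∀ᶠ q in 𝓝 (f x), σ q ∈ Φ.target := by
      refine hσ.continuousAt.eventually ?_
      rw [e1]
      exact Φ.open_target.mem_nhds (Φ.map_source hx)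
    filter_upwards [h1, Ψ.open_source.mem_nhds hfx] with q hq hq'
    refine Ψ.injOn (h.source_subset_preimage_source (Φ.map_target hq)) hq' ?_
    rw [hw _ hq]
    simp [σ]

section Quotient

variable {E F : Type*} [NormedAddCommGroup E] [NormedSpace ℝ E]
  [NormedAddCommGroup F] [NormedSpace ℝ F]
  {G : Type*} [TopologicalSpace G] [ChartedSpace E G] [Group G] [LieGroup 𝓘(ℝ, E) ∞ G]
  {K : Subgroup G} [ChartedSpace F (G ⧸ K)] [IsManifold 𝓘(ℝ, F) ∞ (G ⧸ K)]
  (hπ : Manifold.IsSubmersion 𝓘(ℝ, E) 𝓘(ℝ, F) ∞ (QuotientGroup.mk : G → G ⧸ K))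

include hπ

/-- The action on a homogeneous space is smooth. -/
lemma contMDiffSMul_quotient : ContMDiffSMul 𝓘(ℝ, E) 𝓘(ℝ, F) ∞ G (G ⧸ K) := by
  refine ⟨fun z => ?_⟩
  obtain ⟨g, p⟩ := z
  obtain ⟨a, rfl⟩ := QuotientGroup.mk_surjective p
  obtain ⟨s, hs1, hs2, hs3⟩ := exists_local_section (hπ.isSubmersionAt a)
  have h1 : ContMDiffAt (𝓘(ℝ, E).prod 𝓘(ℝ, F)) 𝓘(ℝ, E) ∞ (fun z : G × (G ⧸ K) => s z.2)
      (g, QuotientGroup.mk a) := hs2.comp_of_eq contMDiffAt_snd rfl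
  -- Near the point the action is g · q = π(g s(q)), a composite of smooth maps.
  have h2 : ContMDiffAt (𝓘(ℝ, E).prod 𝓘(ℝ, F)) 𝓘(ℝ, E) ∞ (fun z : G × (G ⧸ K) => z.1 * s z.2)
      (g, QuotientGroup.mk a) := contMDiffAt_fst.mul h1
  have h3 := ContMDiffAt.comp (I' := 𝓘(ℝ, E)) (g, (QuotientGroup.mk a : G ⧸ K))
    (g := (QuotientGroup.mk : G → G ⧸ K)) (hπ.contMDiff _) h2
  refine h3.congr_of_eventuallyEq ?_
  filter_upwards [continuousAt_snd.eventually hs3] with z hz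
  change z.1 • z.2 = z.1 • (QuotientGroup.mk (s z.2) : G ⧸ K)
  rw [hz]

lemma surjective_dAt_quotient :
    Function.Surjective (dAt E F (QuotientGroup.mk : G → G ⧸ K) 1) := by
  obtain ⟨s, hs1, hs2, hs3⟩ := exists_local_section (hπ.isSubmersionAt 1)
  have h1 := dAt_comp (E := F) (F := E) (E' := F) (hπ.contMDiff.mdifferentiable (by simp) 1)
    (hs2.mdifferentiableAt (by simp)) hs1
  rw [dAt_congr hs3, dAt_id] at h1
  intro v
  exact ⟨dAt F E s (QuotientGroup.mk 1) v, (congrArg (fun L => L v) h1).symm⟩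

variable [CompleteSpace E] {γ : E}

/-- The map k ↦ Ad(k)γ is constant on cosets, so near 1 it factors differentiably through G/K by a
local section; its derivative [·, γ] therefore vanishes on the kernel of the projection. -/
lemma coordLie_eq_zero_of_dAt_quotient (hK : ∀ a, a ∈ K → conjDeriv E a γ = γ) {X : E}
    (hX : dAt E F (QuotientGroup.mk : G → G ⧸ K) 1 X = 0) : coordLie G X γ = 0 := by
  obtain ⟨s, hs1, hs2, hs3⟩ := exists_local_section (hπ.isSubmersionAt 1)
  have hmk := hπ.contMDiff.mdifferentiable (by simp) 1
  have h1 : MDifferentiableAt 𝓘(ℝ, F) 𝓘(ℝ, E) (fun q => conjDeriv E (s q) γ)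
      (QuotientGroup.mk 1 : G ⧸ K) :=
    MDifferentiableAt.comp (I' := 𝓘(ℝ, E)) (QuotientGroup.mk 1 : G ⧸ K)
      (g := fun a : G => conjDeriv E a γ) (mdifferentiableAt_conjDeriv _ _)
      (hs2.mdifferentiableAt (by simp))
  have h2 : (fun k : G => conjDeriv E (s (QuotientGroup.mk k)) γ) =ᶠ[𝓝 1]
      fun k => conjDeriv E k γ := by
    filter_upwards [hmk.continuousAt.eventually hs3] with k hk
    have h4 : (s (QuotientGroup.mk k))⁻¹ * k ∈ K := QuotientGroup.eq.1 hk
    have h5 := hK _ h4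
    calc conjDeriv E (s (QuotientGroup.mk k)) γ = conjDeriv E (s (QuotientGroup.mk k))
          (conjDeriv E ((s (QuotientGroup.mk k))⁻¹ * k) γ) := by rw [h5]
      _ = conjDeriv E k γ := by rw [← conjDeriv_mul_apply, mul_inv_cancel_left]
  have h3 := dAt_comp (E := E) (F := F) (E' := E) h1 hmk rfl
  rw [dAt_congr h2] at h3
  rw [← (mdifferentiableAt_conjDeriv_one γ).2, h3, ContinuousLinearMap.comp_apply, hX, map_zero]

end Quotient

/-! ### Curves in the stabilizer and its Lie algebra. -/

section Curve

variable {E F : Type*} [NormedAddCommGroup E] [NormedSpace ℝ E] [CompleteSpace E]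
  [NormedAddCommGroup F] [NormedSpace ℝ F]
  {G : Type*} [TopologicalSpace G] [ChartedSpace E G] [Group G] [LieGroup 𝓘(ℝ, E) ∞ G]

lemma dAt_curve {c : ℝ → G} {t : ℝ} {X : GroupLieAlgebra 𝓘(ℝ, E) G}
    (hc : HasMFDerivAt 𝓘(ℝ, ℝ) 𝓘(ℝ, E) c t
      ((1 : ℝ →L[ℝ] ℝ).smulRight (mulInvariantVectorField X (c t)))) :
    dAt ℝ E c t 1 = dAt E E (fun k : G => c t * k) 1 X :=
  (congrArg (fun L : ℝ →L[ℝ] E => L 1) hc.mfderiv).trans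
    (one_smul ℝ (dAt E E (fun k : G => c t * k) 1 X))

lemma hasDerivAt_conjDeriv_comp {c : ℝ → G} {t : ℝ} {X : GroupLieAlgebra 𝓘(ℝ, E) G}
    (hc : HasMFDerivAt 𝓘(ℝ, ℝ) 𝓘(ℝ, E) c t
      ((1 : ℝ →L[ℝ] ℝ).smulRight (mulInvariantVectorField X (c t)))) (Y : E) :
    HasDerivAt (fun t => conjDeriv E (c t) Y) (conjDeriv E (c t) (coordLie G (X : E) Y)) t := by
  have h1 := dAt_comp (E := ℝ) (F := E) (E' := E) (mdifferentiableAt_conjDeriv Y (c t))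
    hc.mdifferentiableAt rfl
  have h2 : DifferentiableAt ℝ (fun t => conjDeriv E (c t) Y) t :=
    mdifferentiableAt_iff_differentiableAt.1
      ((mdifferentiableAt_conjDeriv Y (c t)).comp t hc.mdifferentiableAt)
  rw [dAt_eq_fderiv] at h1
  have h3 := congrArg (fun L : ℝ →L[ℝ] E => L 1) h1
  have h4 : deriv (fun t => conjDeriv E (c t) Y) t = conjDeriv E (c t) (coordLie G (X : E) Y) :=
    h3.trans ((congrArg (dAt E E (fun a : G => conjDeriv E a Y) (c t)) (dAt_curve hc)).trans
      (dAt_conjDeriv_mul_left (G := G) Y (X : E) (c t)))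
  exact h4 ▸ h2.hasDerivAt

/-- Local one-parameter subgroups. -/
lemma exists_curve (X : E) : ∃ c : ℝ → G, c 0 = 1 ∧ ContinuousAt c 0 ∧
    MDifferentiableAt 𝓘(ℝ, ℝ) 𝓘(ℝ, E) c 0 ∧ dAt ℝ E c 0 1 = X ∧
    ∀ Y : E, ∀ᶠ t in 𝓝 0,
      HasDerivAt (fun t => conjDeriv E (c t) Y) (conjDeriv E (c t) (coordLie G X Y)) t := by
  have : IsManifold 𝓘(ℝ, E) 1 G := .of_le (n := ∞) (by simp)
  have h1 : ContMDiffAt 𝓘(ℝ, E) 𝓘(ℝ, E).tangent 1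
      (fun g => (⟨g, mulInvariantVectorField (X : GroupLieAlgebra 𝓘(ℝ, E) G) g⟩ :
        TangentBundle 𝓘(ℝ, E) G)) 1 :=
    (contMDiffAt_mulInvariantVectorField (X : GroupLieAlgebra 𝓘(ℝ, E) G)).of_le
      (by rw [minSmoothness_of_isRCLikeNormedField]; norm_num)
  obtain ⟨c, hc0, hc⟩ := exists_isMIntegralCurveAt_of_contMDiffAt_boundaryless 0 h1
  have h0 := hc.self_of_nhds
  -- An integral curve of the left invariant field suffices: only the differential equation for
  -- Ad(c(t))Y is needed, not the homomorphism property.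
  refine ⟨c, hc0, h0.continuousAt, h0.mdifferentiableAt, ?_, fun Y => ?_⟩
  · refine (dAt_curve h0).trans ?_
    rw [hc0]
    simp only [one_mul, dAt_id]
    rfl
  · filter_upwards [hc] with t ht
    exact hasDerivAt_conjDeriv_comp ht Y

/-- Elements commuting with `γ` are tangent to its stabilizer. -/
lemma exists_curve_mem {K : Subgroup G} {γ : E} (hK : ∀ a, conjDeriv E a γ = γ → a ∈ K) {X : E}
    (hX : coordLie G X γ = 0) : ∃ c : ℝ → G, c 0 = 1 ∧
      MDifferentiableAt 𝓘(ℝ, ℝ) 𝓘(ℝ, E) c 0 ∧ dAt ℝ E c 0 1 = X ∧ (∀ᶠ t in 𝓝 0, c t ∈ K) ∧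
      ∀ Y : E, HasDerivAt (fun t => conjDeriv E (c t) Y) (coordLie G X Y) 0 := by
  obtain ⟨c, hc0, hc1, hc2, hc3, hc4⟩ := exists_curve (G := G) X
  refine ⟨c, hc0, hc2, hc3, ?_, fun Y => ?_⟩
  · have h1 := hc4 γ
    rw [hX] at h1
    obtain ⟨ε, hε, h2⟩ := Metric.eventually_nhds_iff_ball.1 h1
    filter_upwards [Metric.ball_mem_nhds (0 : ℝ) hε] with t ht
    refine hK _ ?_
    have h3 : ∀ s ∈ Metric.ball (0 : ℝ) ε,
        HasDerivWithinAt (fun t => conjDeriv E (c t) γ) 0 (Metric.ball (0 : ℝ) ε) s := by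
      intro s hs
      simpa using (h2 s hs).hasDerivWithinAt
    -- The derivative of Ad(c(t))γ is Ad(c(t))[X, γ] = 0, so the mean value inequality with constant
    -- 0 keeps it equal to γ.
    have h4 := (convex_ball (0 : ℝ) ε).norm_image_sub_le_of_norm_hasDerivWithin_le
      (C := 0) h3 (by simp) (Metric.mem_ball_self hε) ht
    rw [zero_mul] at h4
    have h5 := sub_eq_zero.1 (norm_le_zero_iff.1 h4)
    rw [h5, hc0, conjDeriv_one]
    rfl
  · have h1 := (hc4 Y).self_of_nhds
    rw [hc0, conjDeriv_one] at h1
    exact h1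

/-- The tangent space of the stabilizer of `γ`. -/
lemma dAt_quotient_eq_zero {K : Subgroup G} [ChartedSpace F (G ⧸ K)]
    (hπ : MDifferentiableAt 𝓘(ℝ, E) 𝓘(ℝ, F) (QuotientGroup.mk : G → G ⧸ K) 1) {γ : E}
    (hK : ∀ a, conjDeriv E a γ = γ → a ∈ K) {X : E} (hX : coordLie G X γ = 0) :
    dAt E F (QuotientGroup.mk : G → G ⧸ K) 1 X = 0 := by
  obtain ⟨c, hc0, hc2, hc3, hc4, -⟩ := exists_curve_mem hK hX
  have h1 := dAt_comp (E := ℝ) (F := E) (E' := F) hπ hc2 hc0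
  have h2 : (fun t => (QuotientGroup.mk (c t) : G ⧸ K)) =ᶠ[𝓝 0] fun _ => QuotientGroup.mk 1 := by
    filter_upwards [hc4] with t ht
    rw [QuotientGroup.eq]
    simpa using K.inv_mem ht
  rw [dAt_congr h2, dAt_const] at h1
  rw [← hc3]
  exact (congrArg (fun L => L 1) h1).symm

/-- Subspaces invariant under the stabilizer of `γ` are invariant under its Lie algebra. -/
lemma coordLie_mem [FiniteDimensional ℝ E] {K : Subgroup G} {γ : E}
    (hK : ∀ a, conjDeriv E a γ = γ → a ∈ K) {W : Submodule ℝ E}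
    (hW : ∀ a ∈ K, ∀ Y ∈ W, conjDeriv E a Y ∈ W) {X Y : E} (hX : coordLie G X γ = 0)
    (hY : Y ∈ W) : coordLie G X Y ∈ W := by
  obtain ⟨c, -, -, -, hc4, hc5⟩ := exists_curve_mem hK hX
  by_contra hn
  -- A functional that kills `W` but not the bracket is zero along Ad(c(t))Y, yet its derivative at
  -- 0 is its value on the bracket.
  obtain ⟨f, hf, hfW⟩ := Submodule.exists_dual_map_eq_bot_of_notMem hn inferInstance
  have h1 : HasDerivAt (fun t => (LinearMap.toContinuousLinearMap f) (conjDeriv E (c t) Y))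
      (f (coordLie G X Y)) 0 := (LinearMap.toContinuousLinearMap f).hasFDerivAt.comp_hasDerivAt 0 (hc5 Y)
  have h2 : (fun t => (LinearMap.toContinuousLinearMap f) (conjDeriv E (c t) Y)) =ᶠ[𝓝 0]
      fun _ => 0 := by
    filter_upwards [hc4] with t ht
    have : f (conjDeriv E (c t) Y) ∈ W.map f := Submodule.mem_map_of_mem (hW _ ht _ hY)
    rw [hfW] at this
    exact this
  exact hf (h1.unique ((hasDerivAt_const 0 0).congr_of_eventuallyEq h2))

end Curve

/-! ### Negative definiteness of the Killing form by averaging. -/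

/-- The square of a nonzero skew operator has negative trace. -/
lemma trace_sq_neg {W : Type*} [AddCommGroup W] [Module ℝ W] [FiniteDimensional ℝ W]
    (β : LinearMap.BilinForm ℝ W) (hs : ∀ A B, β A B = β B A) (hp : ∀ A, A ≠ 0 → 0 < β A A)
    {D : W →ₗ[ℝ] W} (hD : ∀ A B, β (D A) B = -β A (D B)) (h0 : D ≠ 0) :
    LinearMap.trace ℝ W (D ∘ₗ D) < 0 := by
  obtain ⟨b, hb⟩ := exists_orthonormal_basis β hs hp
  have h1 : LinearMap.trace ℝ W (D ∘ₗ D) = ∑ i, β ((D ∘ₗ D) (b i)) (b i) := by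
    rw [LinearMap.trace_eq_matrix_trace ℝ b, Matrix.trace]
    refine Finset.sum_congr rfl fun i _ => ?_
    rw [Matrix.diag_apply, LinearMap.toMatrix_apply]
    conv_rhs => rw [← b.sum_repr ((D ∘ₗ D) (b i))]
    rw [map_sum, LinearMap.sum_apply]
    simp only [map_smul, LinearMap.smul_apply, hb, smul_eq_mul, mul_ite, mul_one, mul_zero,
      Finset.sum_ite_eq', Finset.mem_univ, if_true]
  obtain ⟨i, hi⟩ : ∃ i, D (b i) ≠ 0 := by
    by_contra! h
    exact h0 (b.ext fun i => by simpa using h i)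
  have hnn : ∀ A, 0 ≤ β A A := fun A => by
    rcases eq_or_ne A 0 with rfl | h
    · simp
    · exact (hp A h).le
  rw [h1]
  have h2 : ∀ j, β ((D ∘ₗ D) (b j)) (b j) = -β (D (b j)) (D (b j)) := fun j => hD _ _
  simp only [h2, Finset.sum_neg_distrib, neg_lt_zero]
  exact Finset.sum_pos' (fun j _ => hnn _) ⟨i, Finset.mem_univ i, hp _ hi⟩

section Compact

variable {E : Type*} [NormedAddCommGroup E] [InnerProductSpace ℝ E] [FiniteDimensional ℝ E]
  {G : Type*} [TopologicalSpace G] [ChartedSpace E G] [Group G] [LieGroup 𝓘(ℝ, E) ∞ G]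
  [CompactSpace G]

open MeasureTheory in
variable (E G) in
/-- Averaging an inner product over a compact group. -/
lemma exists_invariant_form : ∃ β : LinearMap.BilinForm ℝ E, (∀ X Y, β X Y = β Y X) ∧
    (∀ X, X ≠ 0 → 0 < β X X) ∧
    ∀ (a : G) X Y, β (conjDeriv E a X) (conjDeriv E a Y) = β X Y := by
  have : CompleteSpace E := FiniteDimensional.complete ℝ E
  have := topologicalGroup_of_lieGroup (G := G) 𝓘(ℝ, E) ∞
  let _ : MeasurableSpace G := borel G
  have _ : BorelSpace G := ⟨rfl⟩
  have hc : ∀ X Y : E, Continuous fun a : G => inner ℝ (conjDeriv E a⁻¹ X) (conjDeriv E a⁻¹ Y) :=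
    fun X Y => ((continuous_conjDeriv X).comp continuous_inv).inner
      ((continuous_conjDeriv Y).comp continuous_inv)
  have hi : ∀ X Y : E, Integrable
      (fun a : G => inner ℝ (conjDeriv E a⁻¹ X) (conjDeriv E a⁻¹ Y)) Measure.haar :=
    fun X Y => (hc X Y).integrable_of_hasCompactSupport (HasCompactSupport.of_compactSpace _)
  refine ⟨LinearMap.mk₂ ℝ
    (fun X Y => ∫ a : G, inner ℝ (conjDeriv E a⁻¹ X) (conjDeriv E a⁻¹ Y) ∂Measure.haar)
    ?_ ?_ ?_ ?_, fun X Y => ?_, fun X hX => ?_, fun a X Y => ?_⟩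
  · intro X X' Y
    rw [← integral_add (hi _ _) (hi _ _)]
    simp only [map_add, inner_add_left]
  · intro c X Y
    rw [← integral_smul]
    simp only [map_smul, real_inner_smul_left, smul_eq_mul]
  · intro X Y Y'
    rw [← integral_add (hi _ _) (hi _ _)]
    simp only [map_add, inner_add_right]
  · intro c X Y
    rw [← integral_smul]
    simp only [map_smul, real_inner_smul_right, smul_eq_mul]
  · simp only [LinearMap.mk₂_apply, real_inner_comm]
  · rw [LinearMap.mk₂_apply]
    refine (hc X X).integral_pos_of_hasCompactSupport_nonneg_nonzero
      (HasCompactSupport.of_compactSpace _) (fun a => real_inner_self_nonneg) (x := 1) ?_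
    rw [inv_one, conjDeriv_one]
    simpa using hX
  · simp only [LinearMap.mk₂_apply]
    -- The inverse in the integrand lets left invariance of Haar measure suffice.
    rw [← integral_mul_left_eq_self (μ := Measure.haar)
      (fun k : G => inner ℝ (conjDeriv E k⁻¹ (conjDeriv E a X)) (conjDeriv E k⁻¹ (conjDeriv E a Y))) a]
    simp only [← conjDeriv_mul_apply, mul_inv_rev, inv_mul_cancel_right]

variable [CompleteSpace E]

/-- Differentiate the invariance of `β` along a curve through 1 with velocity X. -/
lemma form_coordLie {β : LinearMap.BilinForm ℝ E}
    (hβ : ∀ (a : G) X Y, β (conjDeriv E a X) (conjDeriv E a Y) = β X Y) (X Y Z : E) :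
    β (coordLie G X Y) Z = -β Y (coordLie G X Z) := by
  obtain ⟨c, hc0, -, -, -, hc⟩ := exists_curve (G := G) X
  have hY := (hc Y).self_of_nhds
  have hZ := (hc Z).self_of_nhds
  have h1 := (LinearMap.toContinuousBilinearMap β).hasFDerivAt_of_bilinear
    hY.hasFDerivAt hZ.hasFDerivAt
  have h2 : HasFDerivAt (fun t => LinearMap.toContinuousBilinearMap β
      (conjDeriv E (c t) Y) (conjDeriv E (c t) Z)) (0 : ℝ →L[ℝ] ℝ) 0 := by
    have : (fun t => LinearMap.toContinuousBilinearMap β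
      (conjDeriv E (c t) Y) (conjDeriv E (c t) Z)) = fun _ => β Y Z := by
      ext t; exact hβ _ _ _
    rw [this]
    exact hasFDerivAt_const _ _
  have h3 := congrArg (fun L => L 1) (h1.unique h2)
  simp [hc0, conjDeriv_one] at h3
  linarith

end Compact

section Killing

variable {n : ℕ} {G : Type*} [TopologicalSpace G] [ChartedSpace (EuclideanSpace ℝ (Fin n)) G]
  [Group G] [LieGroup (𝓡 n) ∞ G]

lemma lie_eq_coordLie (X Y : GroupLieAlgebra (𝓡 n) G) :
    (⁅X, Y⁆ : GroupLieAlgebra (𝓡 n) G) =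
      coordLie (E := EuclideanSpace ℝ (Fin n)) G X Y := lie_eq_mixedDeriv X Y

lemma Ad_lie (a : G) (X Y : GroupLieAlgebra (𝓡 n) G) : Ad a ⁅X, Y⁆ = ⁅Ad a X, Ad a Y⁆ :=
  (congrArg (conjDeriv (EuclideanSpace ℝ (Fin n)) a) (lie_eq_coordLie X Y)).trans
    ((conjDeriv_coordLie a _ _).trans (lie_eq_coordLie _ _).symm)

lemma Ad_inv_apply (a : G) (X : GroupLieAlgebra (𝓡 n) G) : Ad a (Ad a⁻¹ X) = X :=
  conjDeriv_inv_apply (E := EuclideanSpace ℝ (Fin n)) a X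

lemma Ad_apply_inv (a : G) (X : GroupLieAlgebra (𝓡 n) G) : Ad a⁻¹ (Ad a X) = X :=
  conjDeriv_apply_inv (E := EuclideanSpace ℝ (Fin n)) a X

/-- The adjoint action by Lie algebra automorphisms. -/
def adEquiv (a : G) : GroupLieAlgebra (𝓡 n) G ≃ₗ⁅ℝ⁆ GroupLieAlgebra (𝓡 n) G where
  toFun := Ad a
  invFun := Ad a⁻¹
  map_add' := map_add _
  map_smul' := map_smul _
  map_lie' := Ad_lie a _ _
  left_inv := Ad_apply_inv a
  right_inv := Ad_inv_apply a

lemma B_Ad (a : G) (X Y : GroupLieAlgebra (𝓡 n) G) : B (Ad a X) (Ad a Y) = B X Y :=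
  LieAlgebra.killingForm_of_equiv_apply (adEquiv a) X Y

/-- The Killing form of a compact simple group is negative definite. -/
lemma B_neg [CompactSpace G] [LieAlgebra.IsSimple ℝ (GroupLieAlgebra (𝓡 n) G)]
    {X : GroupLieAlgebra (𝓡 n) G} (hX : X ≠ 0) : B X X < 0 := by
  obtain ⟨β, hs, hp, hβ⟩ := exists_invariant_form (EuclideanSpace ℝ (Fin n)) G
  let β' : LinearMap.BilinForm ℝ (GroupLieAlgebra (𝓡 n) G) := β
  have hf : FiniteDimensional ℝ (GroupLieAlgebra (𝓡 n) G) :=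
    inferInstanceAs (FiniteDimensional ℝ (EuclideanSpace ℝ (Fin n)))
  refine trace_sq_neg β' hs hp (D := LieAlgebra.ad ℝ _ X) (fun Y Z => ?_) fun h0 => hX ?_
  · have h1 := form_coordLie hβ X Y Z
    have h2 := congrArg (fun W => β' W Z) (lie_eq_coordLie X Y)
    have h3 := congrArg (fun W => -β' Y W) (lie_eq_coordLie X Z)
    exact (h2.trans h1).trans h3.symm
  -- Strictness: ad(X) = 0 would place X in the centre, which is trivial by simplicity.
  · have : X ∈ LieAlgebra.center ℝ (GroupLieAlgebra (𝓡 n) G) := by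
      rw [LieModule.mem_maxTrivSubmodule]
      intro Y
      have := LinearMap.congr_fun h0 Y
      rw [LieAlgebra.ad_apply] at this
      rw [← lie_skew, this]
      simp
    rwa [LieAlgebra.center_eq_bot, LieSubmodule.mem_bot] at this

end Killing

/-! ### Riemannian metrics and isometric actions in charts. -/

/-- A positive definite form on a finite-dimensional space is invertible. -/
lemma isInvertible_of_pos {F : Type*} [NormedAddCommGroup F] [NormedSpace ℝ F]
    [FiniteDimensional ℝ F] (h : F →L[ℝ] F →L[ℝ] ℝ) (hp : ∀ v, v ≠ 0 → 0 < h v v) :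
    h.IsInvertible := by
  have hinj : Function.Injective h.toLinearMap := by
    rw [← LinearMap.ker_eq_bot, LinearMap.ker_eq_bot']
    intro v hv
    by_contra hne
    have := hp v hne
    rw [show h v = 0 from hv] at this
    simp at this
  have hdim : Module.finrank ℝ F = Module.finrank ℝ (F →L[ℝ] ℝ) := by
    rw [← (LinearMap.toContinuousLinearMap (𝕜 := ℝ) (E := F) (F' := ℝ)).finrank_eq]
    exact (Subspace.dual_finrank_eq).symm
  exact ⟨(LinearEquiv.ofInjectiveOfFinrankEq h.toLinearMap hinj hdim).toContinuousLinearEquiv, rfl⟩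

section Metric

variable {d : ℕ} {N : Type*} [TopologicalSpace N] [ChartedSpace (EuclideanSpace ℝ (Fin d)) N]
  [IsManifold (𝓡 d) ∞ N]

/-- A Riemannian metric, as a field of forms on the model space. -/
def metricAt (g : RiemMetric d N) (q : N) :
    EuclideanSpace ℝ (Fin d) →L[ℝ] EuclideanSpace ℝ (Fin d) →L[ℝ] ℝ := g.inner q

lemma chartMetric_apply (g : RiemMetric d N) (p : N) (y u w : EuclideanSpace ℝ (Fin d)) :
    chartMetric g p y u w = metricAt g ((extChartAt (𝓡 d) p).symm y)
      (dAt _ _ (extChartAt (𝓡 d) p).symm y u) (dAt _ _ (extChartAt (𝓡 d) p).symm y w) := rfl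

lemma chartMetric_symm (g : RiemMetric d N) (p : N) (y u w : EuclideanSpace ℝ (Fin d)) :
    chartMetric g p y u w = chartMetric g p y w u := g.symm _ _ _

lemma chartMetric_isInvertible (g : RiemMetric d N) (p : N) {y : EuclideanSpace ℝ (Fin d)}
    (hy : y ∈ (extChartAt (𝓡 d) p).target) : (chartMetric g p y).IsInvertible := by
  refine isInvertible_of_pos _ fun v hv => ?_
  have h1 := dAt_comp (mdifferentiableAt_extChartAt_of_mem ((extChartAt (𝓡 d) p).map_target hy))
    (mdifferentiableAt_extChartAt_symm p hy) rfl
  have h2 : (fun z => extChartAt (𝓡 d) p ((extChartAt (𝓡 d) p).symm z)) =ᶠ[𝓝 y] fun z => z := by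
    filter_upwards [(isOpen_extChartAt_target p).mem_nhds hy] with z hz
    exact (extChartAt (𝓡 d) p).right_inv hz
  rw [dAt_congr h2, dAt_id] at h1
  refine g.pos _ _ fun h0 => hv ?_
  have h3 : dAt _ _ (extChartAt (𝓡 d) p).symm y v = (0 : EuclideanSpace ℝ (Fin d)) := h0
  have h4 := congrArg (fun L => L v) h1
  rw [ContinuousLinearMap.comp_apply, h3, map_zero] at h4
  exact h4

/-- Smoothness of the metric is smoothness in the bundle trivialization at `p`; on the chart domain
that trivialization is inverted by the derivative of the inverse chart, which defines `chartMetric`.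
-/
lemma contDiffAt_chartMetric (g : RiemMetric d N) (p : N) :
    ContDiffAt ℝ 2 (chartMetric g p) (extChartAt (𝓡 d) p p) := by
  have : IsManifold (𝓡 d) 1 N := .of_le (n := ∞) (by simp)
  have h1 := ((contMDiffAt_hom_bundle _).1 (g.contMDiff p)).2
  have h2 : ContMDiffAt (𝓡 d) (𝓡 d) ∞ (extChartAt (𝓡 d) p).symm (extChartAt (𝓡 d) p p) :=
    (contMDiffOn_extChartAt_symm (n := ∞) p).contMDiffAt (extChartAt_target_mem_nhds p)
  have h3 := (ContMDiffAt.comp_of_eq h1 h2 (by simp)).contDiffAt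
  refine (h3.of_le (by norm_cast)).congr_of_eventuallyEq ?_
  filter_upwards [extChartAt_target_mem_nhds (I := 𝓡 d) p] with y hy
  have hs : (extChartAt (𝓡 d) p).symm y ∈ (chartAt (EuclideanSpace ℝ (Fin d)) p).source := by
    simpa using (extChartAt (𝓡 d) p).map_target hy
  have hs' : (extChartAt (𝓡 d) p).symm y ∈ (trivializationAt (EuclideanSpace ℝ (Fin d))
    (TangentSpace (𝓡 d)) p).baseSet := by simpa using hs
  have key : ∀ u : EuclideanSpace ℝ (Fin d), (trivializationAt (EuclideanSpace ℝ (Fin d))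
      (TangentSpace (𝓡 d)) p).symm ((extChartAt (𝓡 d) p).symm y) u =
      dAt (EuclideanSpace ℝ (Fin d)) (EuclideanSpace ℝ (Fin d)) (extChartAt (𝓡 d) p).symm y u := by
    intro u
    have h4 := TangentBundle.symmL_trivializationAt (I := 𝓡 d) hs
    rw [(extChartAt (𝓡 d) p).right_inv hy] at h4
    simp only [modelWithCornersSelf_coe, Set.range_id, mfderivWithin_univ] at h4
    have h5 := congrArg (fun L : EuclideanSpace ℝ (Fin d) →L[ℝ] EuclideanSpace ℝ (Fin d) => L u) h4
    refine Eq.trans ?_ h5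
    exact (Bundle.Trivialization.symmL_apply _ hs' _).symm
  ext u w
  rw [chartMetric_apply, Function.comp_apply]
  have h5 := inCoordinates_apply_eq₂
    (F₁ := EuclideanSpace ℝ (Fin d)) (E₁ := fun q : N => TangentSpace (𝓡 d) q)
    (F₂ := EuclideanSpace ℝ (Fin d)) (E₂ := fun q : N => TangentSpace (𝓡 d) q)
    (F₃ := ℝ) (E₃ := Bundle.Trivial N ℝ) (v := u) (w := w)
    (ϕ := g.inner ((extChartAt (𝓡 d) p).symm y)) hs' hs' (Set.mem_univ _)
  rw [key, key] at h5
  have h6 : ∀ r : ℝ, (trivializationAt ℝ (Bundle.Trivial N ℝ) p).linearMapAt ℝ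
      ((extChartAt (𝓡 d) p).symm y) r = r := fun r => by simp
  exact (h6 _).symm.trans h5.symm

end Metric

section Killing

variable {d : ℕ} {N : Type*} [TopologicalSpace N] [ChartedSpace (EuclideanSpace ℝ (Fin d)) N]
  [IsManifold (𝓡 d) ∞ N]
  {E : Type*} [NormedAddCommGroup E] [NormedSpace ℝ E]
  {G : Type*} [TopologicalSpace G] [ChartedSpace E G] [Group G] [LieGroup 𝓘(ℝ, E) ∞ G]
  [MulAction G N] [ContMDiffSMul 𝓘(ℝ, E) (𝓡 d) ∞ G N]

/-- An isometric action is isometric in coordinates. -/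
lemma eventually_chartMetric_actChart {g : RiemMetric d N}
    (hg : ∀ (a : G) (q : N) (u v : EuclideanSpace ℝ (Fin d)),
      metricAt g (a • q) (dAt _ _ (fun q : N => a • q) q u) (dAt _ _ (fun q : N => a • q) q v) =
        metricAt g q u v) (p : N) :
    ∀ᶠ z in 𝓝 (extChartAt 𝓘(ℝ, E) (1 : G) 1, extChartAt (𝓡 d) p p), ∀ u w,
      chartMetric g p (actChart E G p z) (fderiv ℝ (actChart E G p) z (0, u))
        (fderiv ℝ (actChart E G p) z (0, w)) = chartMetric g p z.2 u w := by
  have H := isLocalAction_actChart (E := E) (F := EuclideanSpace ℝ (Fin d)) (G := G) p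
  have c1 : ∀ᶠ z in 𝓝 (extChartAt 𝓘(ℝ, E) (1 : G) 1, extChartAt (𝓡 d) p p),
      z.2 ∈ (extChartAt (𝓡 d) p).target :=
    continuousAt_snd (extChartAt_target_mem_nhds (I := 𝓡 d) p)
  filter_upwards [(eventually_symm_actChart (E := E) (G := G) p).eventually_nhds, c1,
    H.smooth.eventually (by simp), eventually_smul_mem_source (E := E) (G := G) p]
    with z h1 h2 h3 h4 u w
  obtain ⟨x, y⟩ := z
  dsimp only at h1 h2 h4 ⊢
  set φ := extChartAt (𝓡 d) p
  set a := (extChartAt 𝓘(ℝ, E) (1 : G)).symm x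
  have h5 : (fun y' => φ.symm (actChart E G p (x, y'))) =ᶠ[𝓝 y] fun y' => a • φ.symm y' :=
    (Continuous.prodMk_right x).continuousAt.eventually h1
  have hd := (h3.differentiableAt (by norm_num)).hasFDerivAt.comp (f := fun y' => (x, y')) y
    (hasFDerivAt_prodMk_right x y)
  have h6 : actChart E G p (x, y) ∈ φ.target := φ.map_source h4
  have h7 := dAt_comp (g := φ.symm) (f := fun y' => actChart E G p (x, y'))
    (x := y) (y := actChart E G p (x, y)) (mdifferentiableAt_extChartAt_symm p h6)
    hd.differentiableAt.mdifferentiableAt rfl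
  have h8 := dAt_comp (g := fun q : N => a • q) (f := φ.symm) (x := y) (y := φ.symm y)
    (mdifferentiable_smul E a _) (mdifferentiableAt_extChartAt_symm p h2) rfl
  rw [dAt_congr h5, h8, dAt_eq_fderiv] at h7
  have h9 : ∀ v, dAt _ _ φ.symm (actChart E G p (x, y)) (fderiv ℝ (actChart E G p) (x, y) (0, v)) =
      dAt (EuclideanSpace ℝ (Fin d)) (EuclideanSpace ℝ (Fin d)) (fun q : N => a • q) (φ.symm y)
        (dAt _ _ φ.symm y v) := by
    intro v
    have h10 := congrArg (fun L => L v) h7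
    have h11 := congrArg (fun L => L v) hd.fderiv
    simp only [ContinuousLinearMap.comp_apply, ContinuousLinearMap.inr_apply] at h10 h11
    rw [h10, ← h11]
    rfl
  rw [chartMetric_apply, chartMetric_apply, h9, h9,
    show (extChartAt (𝓡 d) p).symm (actChart E G p (x, y)) = a • φ.symm y from h5.self_of_nhds, hg]

variable {L : Type*} [LieRing L]

/-- The fundamental fields of an isometric action, in coordinates, are a family of Killing
fields. -/
lemma isKillingFamily_chartMetric {g : RiemMetric d N}
    (hg : ∀ (a : G) (q : N) (u v : EuclideanSpace ℝ (Fin d)),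
      metricAt g (a • q) (dAt _ _ (fun q : N => a • q) q u) (dAt _ _ (fun q : N => a • q) q v) =
        metricAt g q u v) (p : N) (A : L → E) (hA : ∀ X Y, A ⁅X, Y⁆ = coordLie G (A X) (A Y)) :
    IsKillingFamily (chartMetric g p) (fun X => fundamentalField (actChart E G p)
      (extChartAt 𝓘(ℝ, E) (1 : G) 1) (A X)) (extChartAt (𝓡 d) p p) := by
  have H := isLocalAction_actChart (E := E) (F := EuclideanSpace ℝ (Fin d)) (G := G) p
  have h1 := (contDiffAt_chartMetric g p).eventually (by simp)
  refine ⟨h1, .of_forall fun z => chartMetric_symm g p z, ?_, ?_, ?_, ?_⟩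
  · filter_upwards [extChartAt_target_mem_nhds p] with z hz
    exact chartMetric_isInvertible g p hz
  · filter_upwards [H.eventually] with z hz X
    exact hz.contDiffAt_fundamentalField _
  · filter_upwards [h1, H.eventually,
      (Continuous.prodMk_right _).continuousAt.eventually
        (eventually_chartMetric_actChart (E := E) hg p).eventually_nhds] with z hz hz' hz'' X u w
    exact hz'.killing_fundamentalField (hz.differentiableAt (by norm_num))
      ((Continuous.prodMk_left z).continuousAt.eventually hz'') _ _ _
  · filter_upwards [H.eventually] with z hz X Y
    rw [hz.fderiv_fundamentalField_sub, hA]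
    rfl

end Killing

/-! ### Assembly on the flag manifold. -/

section Homogeneous

variable {n d : ℕ} {G : Type*} [TopologicalSpace G] [ChartedSpace (EuclideanSpace ℝ (Fin n)) G]
  [Group G] [LieGroup (𝓡 n) ∞ G] {K : Subgroup G}
  [ChartedSpace (EuclideanSpace ℝ (Fin d)) (G ⧸ K)] [IsManifold (𝓡 d) ∞ (G ⧸ K)]

instance : FiniteDimensional ℝ (GroupLieAlgebra (𝓡 n) G) :=
  inferInstanceAs (FiniteDimensional ℝ (EuclideanSpace ℝ (Fin n)))

/-- Minus the Killing form. -/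
def negKilling (n : ℕ) (G : Type*) [TopologicalSpace G]
    [ChartedSpace (EuclideanSpace ℝ (Fin n)) G] [Group G] [LieGroup (𝓡 n) ∞ G] :
    LinearMap.BilinForm ℝ (GroupLieAlgebra (𝓡 n) G) := -killingForm ℝ (GroupLieAlgebra (𝓡 n) G)

/-- One inclusion is that Ad(·)γ factors through G/K; the other is that curves with velocity
centralizing γ stay in the stabilizer. -/
lemma mem_lieK_iff (hπ : Manifold.IsSubmersion (𝓡 n) (𝓡 d) ∞ (QuotientGroup.mk : G → G ⧸ K))
    {γ : GroupLieAlgebra (𝓡 n) G} (hK : ∀ a : G, a ∈ K ↔ Ad a γ = γ)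
    (X : GroupLieAlgebra (𝓡 n) G) : X ∈ lieK n d K ↔ ⁅X, γ⁆ = 0 := by
  have h1 : X ∈ lieK n d K ↔ dAt (EuclideanSpace ℝ (Fin n)) (EuclideanSpace ℝ (Fin d))
    (QuotientGroup.mk : G → G ⧸ K) 1 X = 0 := Iff.rfl
  rw [h1]
  constructor
  · intro h
    exact (lie_eq_coordLie X γ).trans
      (coordLie_eq_zero_of_dAt_quotient hπ (γ := (γ : EuclideanSpace ℝ (Fin n)))
        (fun a ha => (hK a).1 ha) h)
  · intro h
    exact dAt_quotient_eq_zero (hπ.contMDiff.mdifferentiable (by simp) 1)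
      (γ := (γ : EuclideanSpace ℝ (Fin n)))
      (fun a ha => (hK a).2 ha) ((lie_eq_coordLie X γ).symm.trans h)

/-- A flag manifold with two isotropy summands, infinitesimally. -/
lemma isFlagData [CompactSpace G] [LieAlgebra.IsSimple ℝ (GroupLieAlgebra (𝓡 n) G)]
    (hπ : Manifold.IsSubmersion (𝓡 n) (𝓡 d) ∞ (QuotientGroup.mk : G → G ⧸ K))
    {γ : GroupLieAlgebra (𝓡 n) G} (hK : ∀ a : G, a ∈ K ↔ Ad a γ = γ)
    {m : Fin 2 → Submodule ℝ (GroupLieAlgebra (𝓡 n) G)} (hm : IsIsotropyDecomposition d K m) :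
    IsFlagData (negKilling n G) γ (lieK n d K) m
      ((fun a : G => (Ad a : GroupLieAlgebra (𝓡 n) G →L[ℝ] GroupLieAlgebra (𝓡 n) G).toLinearMap)
        '' K) where
  symm X Y := congrArg Neg.neg (LieModule.traceForm_comm ℝ _ _ X Y)
  invariant X Y Z := congrArg Neg.neg (LieModule.traceForm_apply_lie_apply ℝ _ _ X Y Z)
  pos X hX := neg_pos.2 (B_neg hX)
  mem_k X := by
    rw [mem_lieK_iff hπ hK, ← lie_skew, neg_eq_zero]
  mem_m X := by
    rw [hm.sup_eq, complM, LinearMap.BilinForm.mem_orthogonal_iff]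
    refine forall₂_congr fun Y hY => ?_
    rw [LieModule.traceForm_comm]
    exact neg_eq_zero.symm
  preserves := by
    rintro _ ⟨a, -, rfl⟩ X Y
    exact congrArg Neg.neg (B_Ad a X Y)
  commutes := by
    rintro _ ⟨a, ha, rfl⟩ X
    exact (Ad_lie a γ X).trans (by rw [(hK a).1 ha]; rfl)
  ne_bot i := (hm.irreducible i).ne_bot
  mapsTo := by
    rintro i _ ⟨a, ha, rfl⟩ X hX
    exact (hm.irreducible i).invariant a ha X hX
  irreducible i W hW h := (hm.irreducible i).eq_bot_or_eq W hW fun a ha X hX => h _ ⟨a, ha, rfl⟩ X hX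
  inequivalent := by
    rintro ⟨f, hf⟩
    exact hm.inequivalent ⟨f, fun a ha X Y h => hf _ ⟨a, ha, rfl⟩ X Y h⟩
  lie_mem i X hX Y hY := by
    have h1 := (lie_eq_coordLie X γ).symm.trans ((mem_lieK_iff hπ hK X).1 hX)
    have h2 := coordLie_mem (E := EuclideanSpace ℝ (Fin n)) (γ := (γ : EuclideanSpace ℝ (Fin n))) (fun a ha => (hK a).2 ha)
      (W := m i) (fun a ha Z hZ => (hm.irreducible i).invariant a ha Z hZ) h1 hY
    rw [lie_eq_coordLie]
    exact h2

/-- Fundamental fields at the base point of a chart. -/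
lemma fundamentalField_translate [ContMDiffSMul (𝓡 n) (𝓡 d) ∞ G (G ⧸ K)] (a : G)
    (X : EuclideanSpace ℝ (Fin n)) :
    fundamentalField (actChart (EuclideanSpace ℝ (Fin n)) G (a • (QuotientGroup.mk 1 : G ⧸ K)))
      (extChartAt (𝓡 n) (1 : G) 1) (conjDeriv (EuclideanSpace ℝ (Fin n)) a X)
      (extChartAt (𝓡 d) (a • (QuotientGroup.mk 1 : G ⧸ K)) (a • (QuotientGroup.mk 1 : G ⧸ K))) =
    dAt (EuclideanSpace ℝ (Fin d)) (EuclideanSpace ℝ (Fin d)) (fun q : G ⧸ K => a • q)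
      (QuotientGroup.mk 1) (dAt (EuclideanSpace ℝ (Fin n)) (EuclideanSpace ℝ (Fin d))
        (QuotientGroup.mk : G → G ⧸ K) 1 X) := by
  have H := isLocalAction_actChart (E := EuclideanSpace ℝ (Fin n))
    (F := EuclideanSpace ℝ (Fin d)) (G := G) (a • (QuotientGroup.mk 1 : G ⧸ K))
  rw [fundamentalField_actChart _ _ (mem_extChartAt_target _)
    (H.smooth.differentiableAt (by norm_num)), extChartAt_to_inv, dAt_extChartAt,
    dAt_smul_const_conjDeriv]
  have h1 : (fun k : G => k • (QuotientGroup.mk 1 : G ⧸ K)) = QuotientGroup.mk := by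
    ext k
    change (QuotientGroup.mk (k * 1) : G ⧸ K) = _
    rw [mul_one]
  rw [h1]
  rfl

lemma surjective_dAt_smul [ContMDiffSMul (𝓡 n) (𝓡 d) ∞ G (G ⧸ K)] (a : G) (p : G ⧸ K) :
    Function.Surjective (dAt (EuclideanSpace ℝ (Fin d)) (EuclideanSpace ℝ (Fin d))
      (fun q : G ⧸ K => a • q) p) := by
  have h1 := dAt_comp (g := fun q : G ⧸ K => a • q) (f := fun q : G ⧸ K => a⁻¹ • q)
    (x := a • p) (y := p)
    (mdifferentiable_smul (F := EuclideanSpace ℝ (Fin d)) (EuclideanSpace ℝ (Fin n)) a p)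
    (mdifferentiable_smul (F := EuclideanSpace ℝ (Fin d)) (EuclideanSpace ℝ (Fin n)) a⁻¹ (a • p)) (inv_smul_smul a p)
  simp only [smul_inv_smul, dAt_id] at h1
  exact fun v => ⟨_, (congrArg (fun L => L v) h1).symm⟩

lemma chartMetric_base (g : RiemMetric d (G ⧸ K)) (p : G ⧸ K) (u w : EuclideanSpace ℝ (Fin d)) :
    chartMetric g p (extChartAt (𝓡 d) p p) u w = metricAt g p u w := by
  rw [chartMetric_apply, dAt_extChartAt_symm, extChartAt_to_inv]
  rfl

/-- The scalar curvature of an invariant diagonal metric on a flag manifold with two isotropy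
summands. -/
lemma scalarCurvature_eq [CompactSpace G] [LieAlgebra.IsSimple ℝ (GroupLieAlgebra (𝓡 n) G)]
    (hπ : Manifold.IsSubmersion (𝓡 n) (𝓡 d) ∞ (QuotientGroup.mk : G → G ⧸ K))
    {γ : GroupLieAlgebra (𝓡 n) G} (hK : ∀ a : G, a ∈ K ↔ Ad a γ = γ)
    {m : Fin 2 → Submodule ℝ (GroupLieAlgebra (𝓡 n) G)} (hm : IsIsotropyDecomposition d K m)
    {i j : Fin 2} (hij : i ≠ j) (h1 : BracketLE (m i) (m j) (m i))
    (h2 : BracketLE (m i) (m i) (lieK n d K ⊔ m j)) (h3 : BracketLE (m j) (m j) (lieK n d K))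
    {b : ∀ i, Module.Basis (Fin (Module.finrank ℝ (m i))) ℝ (m i)} (hb : IsOrthonormalFamily b)
    {g : RiemMetric d (G ⧸ K)} {x₁ x₂ : ℝ} (hx₁ : 0 < x₁) (hx₂ : 0 < x₂)
    (hg : IsInvariantMetric K g) (hd : IsDiagonalMetric K g (m i) (m j) x₁ x₂) (p : G ⧸ K) :
    scalarCurvature g p =
      1 / 2 * (Module.finrank ℝ (m i) / x₁ + Module.finrank ℝ (m j) / x₂) -
        1 / 4 * (triple b i i j * x₂ / x₁ ^ 2 + 2 * triple b i i j / x₂) := by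
  have := contMDiffSMul_quotient hπ
  obtain ⟨a, rfl⟩ : ∃ a : G, a • (QuotientGroup.mk 1 : G ⧸ K) = p := by
    obtain ⟨a, rfl⟩ := QuotientGroup.mk_surjective p
    refine ⟨a, ?_⟩
    change (QuotientGroup.mk (a * 1) : G ⧸ K) = _
    rw [mul_one]
  have hg' : ∀ (a : G) (q : G ⧸ K) (u v : EuclideanSpace ℝ (Fin d)),
      metricAt g (a • q) (dAt _ _ (fun q : G ⧸ K => a • q) q u)
        (dAt _ _ (fun q : G ⧸ K => a • q) q v) = metricAt g q u v := hg
  -- Indexing the fields by Ad(a)X makes their values at a·o the translates by `a` of the fields of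
  -- X at o, so the metric at any point is read off at o.
  have hfam := isKillingFamily_chartMetric (E := EuclideanSpace ℝ (Fin n)) hg'
    (a • (QuotientGroup.mk 1 : G ⧸ K)) (L := GroupLieAlgebra (𝓡 n) G)
    (fun X => conjDeriv (EuclideanSpace ℝ (Fin n)) a X)
    (fun X Y => (Ad_lie a X Y).trans (lie_eq_coordLie _ _))
  have hV := fun X : GroupLieAlgebra (𝓡 n) G => fundamentalField_translate (d := d) (K := K) a X
  refine (isFlagData hπ hK hm).scalar_eq (b := b) (fun X Y => rfl) hb hij h1 h2 h3 hfam
    (fun X Y => ?_) (fun c X => ?_) (fun v => ?_) (fun C hC => ?_) hx₁ hx₂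
    (fun X hX X' hX' Y hY Y' hY' => ?_)
  · refine (hV _).trans (Eq.trans ?_ (congrArg₂ (· + ·) (hV X) (hV Y)).symm)
    exact (congrArg _ (map_add _ X Y)).trans (map_add _ _ _)
  · refine (hV _).trans (Eq.trans ?_ (congrArg (c • ·) (hV X)).symm)
    exact (congrArg _ (map_smul _ c X)).trans (map_smul _ _ _)
  · obtain ⟨u, rfl⟩ := surjective_dAt_smul (n := n) a (QuotientGroup.mk 1 : G ⧸ K) v
    obtain ⟨X, rfl⟩ := surjective_dAt_quotient hπ u
    exact ⟨X, hV X⟩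
  · refine (hV C).trans ?_
    have h0 : dAt (EuclideanSpace ℝ (Fin n)) (EuclideanSpace ℝ (Fin d))
      (QuotientGroup.mk : G → G ⧸ K) 1 C = 0 := hC
    rw [h0, map_zero]
  · refine Eq.trans ?_ (hd X hX X' hX' Y hY Y' hY')
    refine (chartMetric_base g _ _ _).trans (Eq.trans ?_ (hg' a (QuotientGroup.mk 1) _ _))
    exact congrArg₂ (fun u v => metricAt g (a • (QuotientGroup.mk 1 : G ⧸ K)) u v)
      (hV (X + Y)) (hV (X' + Y'))

end Homogeneous

end FlagManifold

end

theorem proposition2 {n d : ℕ}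
    {G : Type*} [TopologicalSpace G] [ChartedSpace (EuclideanSpace ℝ (Fin n)) G] [Group G]
    [LieGroup (𝓡 n) ∞ G] [T2Space G] [CompactSpace G] [ConnectedSpace G]
    [LieAlgebra.IsSimple ℝ (GroupLieAlgebra (𝓡 n) G)]
    (γ : GroupLieAlgebra (𝓡 n) G) (K : Subgroup G) (hK : ∀ a : G, a ∈ K ↔ Ad a γ = γ)
    [ChartedSpace (EuclideanSpace ℝ (Fin d)) (G ⧸ K)] [IsManifold (𝓡 d) ∞ (G ⧸ K)]
    (hπ : Manifold.IsSubmersion (𝓡 n) (𝓡 d) ∞ (QuotientGroup.mk : G → G ⧸ K))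
    (m : Fin 2 → Submodule ℝ (GroupLieAlgebra (𝓡 n) G))
    (hm : IsIsotropyDecomposition d K m) :
    ∃ i₁ i₂ : Fin 2, i₁ ≠ i₂ ∧
      (∃ Z ∈ lieK n d K, (∀ X ∈ lieK n d K, ⁅Z, X⁆ = 0) ∧
        (∀ X ∈ m i₁, ⁅Z, ⁅Z, X⁆⁆ = -X) ∧ (∀ X ∈ m i₂, ⁅Z, ⁅Z, X⁆⁆ = -((4 : ℝ) • X))) ∧
      BracketLE (m i₁) (m i₂) (m i₁) ∧
      BracketLE (m i₁) (m i₁) (lieK n d K ⊔ m i₂) ∧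
      BracketLE (m i₂) (m i₂) (lieK n d K) ∧
      ∀ b : ∀ i, Module.Basis (Fin (Module.finrank ℝ (m i))) ℝ (m i), IsOrthonormalFamily b →
        triple b i₁ i₁ i₂ ≠ 0 ∧
        triple b i₁ i₂ i₁ = triple b i₁ i₁ i₂ ∧ triple b i₂ i₁ i₁ = triple b i₁ i₁ i₂ ∧
        triple b i₁ i₁ i₁ = 0 ∧ triple b i₂ i₂ i₂ = 0 ∧
        triple b i₂ i₂ i₁ = 0 ∧ triple b i₂ i₁ i₂ = 0 ∧ triple b i₁ i₂ i₂ = 0 ∧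
        ∀ (g : RiemMetric d (G ⧸ K)) (x₁ x₂ : ℝ), 0 < x₁ → 0 < x₂ →
          IsInvariantMetric K g → IsDiagonalMetric K g (m i₁) (m i₂) x₁ x₂ →
          ∀ p : G ⧸ K, scalarCurvature g p =
            1 / 2 * (Module.finrank ℝ (m i₁) / x₁ + Module.finrank ℝ (m i₂) / x₂) -
              1 / 4 * (triple b i₁ i₁ i₂ * x₂ / x₁ ^ 2 + 2 * triple b i₁ i₁ i₂ / x₂) := by
  have H := isFlagData hπ hK hm
  obtain ⟨i, j, hij, ⟨c, hc1, hc2⟩, h1, h2, h3⟩ := H.exists_grading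
  -- A multiple of γ is central in 𝔨 because 𝔨 is the centralizer of γ.
  refine ⟨i, j, hij, ⟨c • γ, ?_, fun X hX => ?_, hc1, hc2⟩, h1, h2, h3, fun b hb => ?_⟩
  · rw [H.mem_k, lie_smul, lie_self, smul_zero]
  · rw [smul_lie, (H.mem_k X).1 hX, smul_zero]
  · obtain ⟨t0, t1, t2, t3, t4, t5, t6, t7⟩ := H.tripleForm_values (b := b) hij h1 h2 h3
    exact ⟨t0, t1, t2, t3, t4, t5, t6, t7, fun g x₁ x₂ hx₁ hx₂ hg hd p =>
      scalarCurvature_eq hπ hK hm hij h1 h2 h3 hb hx₁ hx₂ hg hd p⟩
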